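/- Let $P\subset\mathbb R^d$ be a $d$-dimensional parallelohedron centered at the origin, and let $\mathcal T(P)$ be a face-to-face tiling of $\mathbb R^d$ by translates of $P$ that contains $P$ as a tile. A $(d-2)$-face of $P$ is called primitive if it is a face of exactly three tiles, and non-primitive otherwise. Let $P_\delta$ be the boundary $\partial P$ with all closed non-primitive $(d-2)$-faces removed, and let $P_\pi=P_\delta/(x\sim -x)$. A path on $P_\delta$ is generic if it is continuous and piecewise linear, its endpoints are interior points of facets, it avoids all $(d-3)$-faces of $P$, and it crosses $(d-2)$-faces transversally; then $\langle\gamma\rangle=[F_0,\dots,F_k]$ denotes the sequence of facets that it visits. A path on $P_\pi$ is generic if its lifts to $P_\delta$ are. A closed generic path on $P_\pi$ is * a half-belt cycle if it has a lift $\gamma_\delta$ with $\langle\gamma_\delta\rangle=[F_1,F_2,F_3,-F_1]$, where $F_1,F_2,F_3$ are parallel to some primitive $(d-2)$-face of $P$; * a trivially contractible cycle if it has a lift $\gamma_\delta$ with $\langle\gamma_\delta\rangle=[F_1,\dots,F_k,F_1]$, where $F_1,\dots,F_k$ are distinct and share a common $(d-3)$-face of $P$. The red Venkov graph $VG_r(P)$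 has as vertices the pairs $\{F,-F\}$ of opposite facets of $P$; two distinct pairs $\{F,-F\}$, $\{F',-F'\}$ are adjacent if $F\cap F'$ or $F\cap(-F')$ is a primitive $(d-2)$-face. Its group of cycles is $H_1(VG_r(P),\mathbb Q)$, the graph being viewed as a one-dimensional simplicial complex. A closed generic path on $P_\pi$ having a lift with facet sequence $[F_0,\dots,F_k]$ is identified with the cycle $[\{F_0,-F_0\},\dots,\{F_k,-F_k\}]$ of $VG_r(P)$. The basic cycles are the cycles of $VG_r(P)$ that are identified with half-belt or trivially contractible cycles on $P_\pi$. Then the singular homology group $H_1(P_\pi,\mathbb Q)$ is generated, as a vector space over $\mathbb Q$, by the classes of the half-belt cycles if and only if the group of cycles of $VG_r(P)$ is generated, as a vector space over $\mathbb Q$, by the basic cycles. -/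

import Mathlib

open scoped Pointwise unitInterval

noncomputable section

namespace Parallelohedron

/-- The Euclidean space `ℝ^d`. -/
abbrev Euc (d : ℕ) : Type := EuclideanSpace ℝ (Fin d)

variable {d : ℕ}

/-! ### Parallelohedra, their tilings and their faces -/

/-- `P` is a parallelohedron in `ℝ^d` centered at the origin, and `{P + t | t ∈ T}` is a
face-to-face tiling of `ℝ^d` by translates of `P` that contains `P` itself as a tile. -/
structure IsTiling (P T : Set (Euc d)) : Prop where
  /-- `P` is a convex polytope. -/
  polytope : ∃ S : Set (Euc d), S.Finite ∧ P = convexHull ℝ S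
  /-- `P` is `d`-dimensional. -/
  full_dim : (interior P).Nonempty
  /-- The origin is the center of `P`. -/
  centered : -P = P
  zero_mem : (0 : Euc d) ∈ T
  cover : ⋃ t ∈ T, (t +ᵥ P) = Set.univ
  disjoint_interior : ∀ s ∈ T, ∀ t ∈ T, s ≠ t →
    Disjoint (interior (s +ᵥ P)) (interior (t +ᵥ P))
  /-- Any two tiles meet in a common (possibly empty) face. -/
  face_to_face : ∀ s ∈ T, ∀ t ∈ T,
    IsExposed ℝ (s +ᵥ P) ((s +ᵥ P) ∩ (t +ᵥ P)) ∧ IsExposed ℝ (t +ᵥ P) ((s +ᵥ P) ∩ (t +ᵥ P))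

/-- `G` is a (nonempty) face of dimension `d - j` of the `d`-dimensional polytope `P`. The faces
of a polytope are its exposed subsets. -/
def IsFaceOfCodim (P : Set (Euc d)) (j : ℕ) (G : Set (Euc d)) : Prop :=
  G.Nonempty ∧ IsExposed ℝ P G ∧ Module.finrank ℝ (vectorSpan ℝ G) + j = d

/-- The facets of `P`. -/
def Facet (P : Set (Euc d)) : Type := {F : Set (Euc d) // IsFaceOfCodim P 1 F}

/-- `G` is a primitive `(d - 2)`-face of `P`: it is a face of exactly three tiles. -/
def IsPrimitive (P T G : Set (Euc d)) : Prop :=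
  IsFaceOfCodim P 2 G ∧ {t ∈ T | IsExposed ℝ (t +ᵥ P) G}.ncard = 3

/-- `G` is a non-primitive `(d - 2)`-face of `P`. -/
def IsNonPrimitive (P T G : Set (Euc d)) : Prop :=
  IsFaceOfCodim P 2 G ∧ ¬ IsPrimitive P T G

/-! ### The `δ`-surface and the `π`-surface -/

/-- The `δ`-surface: the boundary of `P` without the closed non-primitive `(d - 2)`-faces. -/
def deltaSurface (P T : Set (Euc d)) : Set (Euc d) :=
  frontier P \ ⋃₀ {G | IsNonPrimitive P T G}

/-- The identification of opposite points of the `δ`-surface. -/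
def antipodal (P T : Set (Euc d)) : Setoid (deltaSurface P T) where
  r x y := (x : Euc d) = y ∨ (x : Euc d) = -(y : Euc d)
  iseqv :=
    { refl := fun _ => Or.inl rfl
      symm := by
        rintro x y (h | h)
        · exact Or.inl h.symm
        · exact Or.inr (by rw [h, neg_neg])
      trans := by
        rintro x y z (h | h) (h' | h')
        · exact Or.inl (h.trans h')
        · exact Or.inr (h.trans h')
        · exact Or.inr (by rw [h, h'])
        · exact Or.inl (by rw [h, h', neg_neg]) }

/-- The `π`-surface `P_π = P_δ / (x ∼ -x)`, with the quotient topology. -/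
abbrev PiSurface (P T : Set (Euc d)) : Type := Quotient (antipodal P T)

/-! ### Generic paths -/

/-- `γ` is piecewise linear: it is affine on every interval `[a, b]` that has none of finitely
many break points in its interior. -/
def IsPiecewiseLinear (γ : I → Euc d) : Prop :=
  ∃ S : Finset I, ∀ a t b : I, a ≤ t → t ≤ b → (∀ s ∈ S, ¬ (a < s ∧ s < b)) →
    ((b : ℝ) - a) • γ t = ((b : ℝ) - t) • γ a + ((t : ℝ) - a) • γ b

/-- `γ` is a generic path on `P_δ` and `⟨γ⟩ = [F 0, …, F k]`: at the times `τ 1 < … < τ k` the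
path crosses, at a relative interior point, the primitive `(d - 2)`-face `F (i - 1) ∩ F i` from
the interior of `F (i - 1)` to the interior of `F i`; at all other times it lies in the interior
of the respective facet. -/
def IsGenericPath {P T : Set (Euc d)} (γ : C(I, deltaSurface P T)) {k : ℕ}
    (F : Fin (k + 1) → Facet P) : Prop :=
  IsPiecewiseLinear (fun t => (γ t : Euc d)) ∧
  (γ 0 : Euc d) ∈ intrinsicInterior ℝ (F 0).1 ∧
  (γ 1 : Euc d) ∈ intrinsicInterior ℝ (F (Fin.last k)).1 ∧
  ∃ τ : Fin (k + 2) → I, StrictMono τ ∧ τ 0 = 0 ∧ τ (Fin.last (k + 1)) = 1 ∧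
    (∀ (i : Fin (k + 1)) (t : I), τ i.castSucc < t → t < τ i.succ →
      (γ t : Euc d) ∈ intrinsicInterior ℝ (F i).1) ∧
    (∀ i : Fin k, F i.castSucc ≠ F i.succ ∧
      IsPrimitive P T ((F i.castSucc).1 ∩ (F i.succ).1) ∧
      (γ (τ i.castSucc.succ) : Euc d) ∈
        intrinsicInterior ℝ ((F i.castSucc).1 ∩ (F i.succ).1))

/-- `γ` is a closed generic path on `P_π`, and it has a lift `γ'` to `P_δ` with
`⟨γ'⟩ = [F 0, …, F k]`. -/
def IsGenericLoop {P T : Set (Euc d)} (γ : C(I, PiSurface P T)) {k : ℕ}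
    (F : Fin (k + 1) → Facet P) : Prop :=
  γ 0 = γ 1 ∧ ∃ γ' : C(I, deltaSurface P T),
    (∀ t, (Quotient.mk (antipodal P T) (γ' t) : PiSurface P T) = γ t) ∧ IsGenericPath γ' F

/-- Half-belt circuits: `⟨γ'⟩ = [F₁, F₂, F₃, -F₁]` for a lift `γ'`, where `F₁`, `F₂`, `F₃` are
parallel to some primitive `(d - 2)`-face `G` of `P`. -/
def IsHalfBelt {P T : Set (Euc d)} (γ : C(I, PiSurface P T)) : Prop :=
  ∃ F : Fin 4 → Facet P, IsGenericLoop γ F ∧ (F 3).1 = -(F 0).1 ∧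
    ∃ G, IsPrimitive P T G ∧ ∀ i : Fin 4, i ≠ 3 → vectorSpan ℝ G ≤ vectorSpan ℝ (F i).1

/-- Trivially contractible circuits: `⟨γ'⟩ = [F₁, …, F_k, F₁]` for a lift `γ'`, where
`F₁, …, F_k` are distinct and share a common `(d - 3)`-face `G` of `P`. -/
def IsTriviallyContractible {P T : Set (Euc d)} (γ : C(I, PiSurface P T)) : Prop :=
  ∃ (k : ℕ) (F : Fin (k + 1) → Facet P), 1 ≤ k ∧ IsGenericLoop γ F ∧ F (Fin.last k) = F 0 ∧
    (Function.Injective fun i : Fin k => F i.castSucc) ∧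
    ∃ G, IsFaceOfCodim P 3 G ∧ ∀ i, G ⊆ (F i).1

/-! ### The red Venkov graph and its group of cycles -/

/-- The pairs `{F, -F}` of opposite facets of `P`. -/
def FacetPair (P : Set (Euc d)) : Type :=
  {v : Set (Set (Euc d)) // ∃ F : Facet P, v = {F.1, -F.1}}

/-- The pair `{F, -F}`. -/
def Facet.pair {P : Set (Euc d)} (F : Facet P) : FacetPair P := ⟨{F.1, -F.1}, F, rfl⟩

/-- The red Venkov graph: two distinct pairs of opposite facets are adjacent if some member of
the first and some member of the second meet in a primitive `(d - 2)`-face. -/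
def redVenkovGraph (P T : Set (Euc d)) : SimpleGraph (FacetPair P) where
  Adj v w := v ≠ w ∧ ∃ F ∈ v.1, ∃ F' ∈ w.1, IsPrimitive P T (F ∩ F')
  symm := ⟨by
    rintro v w ⟨hne, F, hF, F', hF', h⟩
    exact ⟨hne.symm, F', hF', F, hF, by rwa [Set.inter_comm]⟩⟩
  loopless := ⟨fun _ h => h.1 rfl⟩

/-- The oriented edge from `v` to `w` as a simplicial `1`-chain, where `1`-chains of a graph are
written as alternating functions on ordered pairs of vertices. -/
def edgeChain {V : Type} (v w : V) : V × V →₀ ℚ :=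
  Finsupp.single (v, w) 1 - Finsupp.single (w, v) 1

/-- The group of cycles `H₁(G, ℚ)` of a graph `G`, seen as a one-dimensional simplicial complex:
the `1`-chains (finitely supported alternating functions on ordered pairs of vertices that vanish
off the edges) with zero boundary. The boundary map, `c ↦ (w ↦ ∑ v, c (v, w))`, sends
`edgeChain v w` to `w - v`. -/
def cycleSpace {V : Type} (G : SimpleGraph V) : Submodule ℚ (V × V →₀ ℚ) where
  carrier := {c | (∀ v w, c (w, v) = -c (v, w)) ∧ (∀ v w, ¬ G.Adj v w → c (v, w) = 0) ∧
    Finsupp.lmapDomain ℚ ℚ (Prod.snd : V × V → V) c = 0}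
  zero_mem' := by simp
  add_mem' := by
    rintro a b ⟨ha, ha', ha''⟩ ⟨hb, hb', hb''⟩
    refine ⟨fun v w => ?_, fun v w h => ?_, ?_⟩
    · rw [Finsupp.add_apply, Finsupp.add_apply, ha, hb, neg_add]
    · rw [Finsupp.add_apply, ha' v w h, hb' v w h, add_zero]
    · rw [map_add, ha'', hb'', add_zero]
  smul_mem' := by
    rintro r a ⟨ha, ha', ha''⟩
    refine ⟨fun v w => ?_, fun v w h => ?_, ?_⟩
    · rw [Finsupp.smul_apply, Finsupp.smul_apply, ha, smul_neg]
    · rw [Finsupp.smul_apply, ha' v w h, smul_zero]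
    · rw [map_smul, ha'', smul_zero]

/-- The closed generic path `γ` on `P_π` is identified with the cycle `c` of the red Venkov graph:
`c = [{F 0, -F 0}, …, {F k, -F k}]` where `[F 0, …, F k] = ⟨γ'⟩` for a lift `γ'` of `γ`. If
`γ'` stays in one facet then `c` is the empty cycle. -/
def IsIdentifiedWith {P T : Set (Euc d)} (γ : C(I, PiSurface P T))
    (c : FacetPair P × FacetPair P →₀ ℚ) : Prop :=
  ∃ (k : ℕ) (F : Fin (k + 1) → Facet P), IsGenericLoop γ F ∧
    c = ∑ i : Fin k, edgeChain (F i.castSucc).pair (F i.succ).pair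

/-- The set of basic cycles of the red Venkov graph. -/
def basicCycles (P T : Set (Euc d)) : Set (FacetPair P × FacetPair P →₀ ℚ) :=
  {c | ∃ γ : C(I, PiSurface P T), (IsHalfBelt γ ∨ IsTriviallyContractible γ) ∧
    IsIdentifiedWith γ c}

/-! ### First rational singular homology -/

/-- The singular chain complex of `X` with rational coefficients: the chain complex of the
singular simplicial set of `X`. -/
abbrev singularChains (X : Type) [TopologicalSpace X] : ChainComplex (ModuleCat.{0} ℚ) ℕ :=
  (TopCat.toSSet.obj (TopCat.of X)).chainComplex (ModuleCat.of ℚ ℚ)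

/-- The singular homology group `H₁(X, ℚ)`. -/
abbrev H1 (X : Type) [TopologicalSpace X] : ModuleCat.{0} ℚ :=
  (singularChains X).homology 1

/-- The path `γ` as a singular `1`-simplex. -/
def pathSimplex {X : Type} [TopologicalSpace X] (γ : C(I, X)) :
    (TopCat.toSSet.obj (TopCat.of X)).obj (Opposite.op (SimplexCategory.mk 1)) :=
  (TopCat.toSSetObjEquiv (TopCat.of X) (Opposite.op (SimplexCategory.mk 1))).symm
    (γ.comp ⟨stdSimplexHomeomorphUnitInterval, stdSimplexHomeomorphUnitInterval.continuous⟩)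

/-- The path `γ` as a singular `1`-chain: the simplex of `γ` with coefficient `1`. -/
def pathChain {X : Type} [TopologicalSpace X] (γ : C(I, X)) : (singularChains X).X 1 :=
  (SSet.ιChainComplex (TopCat.toSSet.obj (TopCat.of X)) (R := ModuleCat.of ℚ ℚ)
    (pathSimplex γ)).hom (1 : ℚ)

/-- `h` is the class in `H₁(X, ℚ)` of the closed path `γ`. -/
def IsClassOf {X : Type} [TopologicalSpace X] (γ : C(I, X)) (h : H1 X) : Prop :=
  ∃ z : (singularChains X).cycles 1,
    ((singularChains X).iCycles 1).hom z = pathChain γ ∧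
    ((singularChains X).homologyπ 1).hom z = h

end Parallelohedron

end

/-!
Both spans are compared with the whole space by means of linear functionals to `ℚ`. A functional on
the first homology group of a space is the same thing as a path cocycle, a rational function of
paths that extends to a singular cocycle (`exists_isPathCocycle`,
`IsPathCocycle.exists_functional`), so everything happens on the level of paths. The link with the
red Venkov graph is that the value of a suitable cocycle on a generic path is the sum of a function
`w` over the edges of the graph that the path traverses.

Suppose that the half-belt cycles generate the homology of the `π`-surface, and let `L` be a
functional on chains of the graph that vanishes on the basic cycles; put `w` for its values on
edges. Call `φ` a potential of `w` at a point `x` of the `δ`-surface if `w F F' = φ F' - φ F` for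
adjacent facets `F`, `F'` at `x`. It exists at every `x`: at points of faces of codimension three
because `w` vanishes on the trivially contractible cycles there, and at points of faces of higher
codimension by induction (`exists_potential_facetsAt`), because the facets at such a point are
arranged like the cones of a normal fan, and deleting a half-space of a subspace of codimension at
least two leaves a star-shaped complement, on which local potentials glue. The potentials at the
points of the `δ`-surface agree locally up to constants, so they glue along every path and triangle
(`exists_global_potential`) to a path cocycle on the `π`-surface
(`IsTiling.exists_isPathCocycle_of_potential`). It vanishes on half-belt cycles, hence on all closed
paths. Each closed walk in the graph comes from a closed generic path (`exists_isGenericPath`,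
`exists_isGenericLoop`), so `L` vanishes on all cycles of the graph.

Conversely, suppose that the basic cycles span, and let `g` be the path cocycle of a functional that
vanishes on the half-belt cycles. The open stars of points of the `δ`-surface are star-shaped and
embed in the `π`-surface, so integration of `g` along segments turns `g` into a function `w` on the
edges of the graph: up to a coboundary, `g` takes a path to the value at a graph chain of a
functional `W` extending `w` (`IsTiling.exists_edge_function`). A singular cycle gives a cycle of
the graph, hence a combination of basic cycles. On those `W` vanishes: on half-belt cycles by
hypothesis; and for a trivially contractible cycle around a face `G` of codimension three, either the
cycle runs back and forth, or it meets every facet at `G` because each of these facets has only two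
neighbours there. In that case `G` belongs to the `δ`-surface
(`IsTiling.mem_deltaSurface_of_cycle`), and `w` has a potential at its points.

The tiling enters through two facts. A tiling by translates of `P` that contains `P` is unique
(`IsTiling.subset_of_isTiling`), so it is centrally symmetric, primitivity is invariant under
`x ↦ -x`, and the quotient is a quotient of the `δ`-surface by an involution. And `F ∩ F'` and
`F ∩ -F'` are never both primitive (`IsTiling.not_isPrimitive_of_inter_opp`), so an edge of the red
Venkov graph lifts uniquely once one of its facets is chosen.
-/

open scoped Pointwise unitInterval

noncomputable section

namespace Parallelohedron

/-! ### Singular homology in degree one by cocycles on paths -/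

section
open CategoryTheory

section Singular
variable {X : Type} [TopologicalSpace X]

/-- The singular simplicial set of `X`. -/
abbrev sing (X : Type) [TopologicalSpace X] : SSet.{0} := TopCat.toSSet.obj (TopCat.of X)

/-- The singular simplex `s` as a singular chain. -/
def simplexChain {n : ℕ} (s : (sing X).obj (Opposite.op (SimplexCategory.mk n))) :
    (singularChains X).X n :=
  (SSet.ιChainComplex (sing X) (R := ModuleCat.of ℚ ℚ) s).hom (1 : ℚ)

lemma chain_hom_ext {M : Type} [AddCommGroup M] [Module ℚ M] {n : ℕ}
    {f g : (singularChains X).X n →ₗ[ℚ] M}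
    (h : ∀ s, f (simplexChain (n := n) s) = g (simplexChain s)) : f = g := by
  have : ModuleCat.ofHom f = ModuleCat.ofHom g := by
    apply SSet.chainComplex_hom_ext
    intro x
    ext
    exact h x
  exact congrArg ModuleCat.Hom.hom this

lemma exists_chain_desc {M : Type} [AddCommGroup M] [Module ℚ M] {n : ℕ}
    (φ : (sing X).obj (Opposite.op (SimplexCategory.mk n)) → M) :
    ∃ f : (singularChains X).X n →ₗ[ℚ] M, ∀ s, f (simplexChain s) = φ s := by
  let c : Limits.Cofan (fun _ : (sing X).obj (Opposite.op (SimplexCategory.mk n)) =>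
      ModuleCat.of ℚ ℚ) :=
    Limits.Cofan.mk (ModuleCat.of ℚ M)
      fun s => ModuleCat.ofHom (LinearMap.toSpanSingleton ℚ M (φ s))
  let D := SSet.isColimitChainComplexXCofan (sing X) (ModuleCat.of ℚ ℚ) n
  refine ⟨(D.desc c).hom, fun s => ?_⟩
  have h := D.fac c ⟨s⟩
  have h2 := congrArg (fun f => f.hom (1 : ℚ)) h
  refine h2.trans ?_
  simp [c]

lemma d_simplexChain {n : ℕ} (s : (sing X).obj (Opposite.op (SimplexCategory.mk (n + 1)))) :
    ((singularChains X).d (n + 1) n).hom (simplexChain s) =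
      ∑ i : Fin (n + 2), (-1 : ℚ) ^ i.val • simplexChain ((sing X).δ i s) := by
  have h := SSet.ιChainComplex_d (sing X) (R := ModuleCat.of ℚ ℚ) s
  have h2 := congrArg (fun f => f.hom (1 : ℚ)) h
  refine h2.trans ?_
  simp only [ModuleCat.hom_sum, LinearMap.sum_apply]
  refine Finset.sum_congr rfl fun i _ => ?_
  rcases neg_one_pow_eq_or ℤ i.val with h | h <;>
  rcases Nat.even_or_odd i.val with h' | h' <;> simp_all [simplexChain]

lemma d_iCycles (z : (singularChains X).cycles 1) :
    ((singularChains X).d 1 0).hom (((singularChains X).iCycles 1).hom z) = 0 := by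
  have := (singularChains X).iCycles_d 1 0
  exact congrArg (fun f => f.hom z) this

lemma exists_cycle (c : (singularChains X).X 1) (hc : ((singularChains X).d 1 0).hom c = 0) :
    ∃ z : (singularChains X).cycles 1, ((singularChains X).iCycles 1).hom z = c := by
  let k : ModuleCat.of ℚ ℚ ⟶ (singularChains X).X 1 :=
    ModuleCat.ofHom (LinearMap.toSpanSingleton ℚ _ c)
  have hk : k ≫ (singularChains X).d 1 0 = 0 := by
    ext
    exact (congrArg ((singularChains X).d 1 0).hom (one_smul ℚ c)).trans hc
  refine ⟨((singularChains X).liftCycles k 0 (by simp) hk).hom (1 : ℚ), ?_⟩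
  have := (singularChains X).liftCycles_i k 0 (by simp) hk
  refine (congrArg (fun f => f.hom (1 : ℚ)) this).trans ?_
  exact one_smul ℚ c

lemma homologyπ_surjective :
    Function.Surjective ((singularChains X).homologyπ 1).hom := by
  exact (ModuleCat.epi_iff_surjective _).1 inferInstance

/-- A cocycle on singular `1`-chains induces a functional on the first homology group. -/
lemma exists_functional_of_cocycle (f : (singularChains X).X 1 →ₗ[ℚ] ℚ)
    (hf : ∀ c, f (((singularChains X).d 2 1).hom c) = 0) :
    ∃ l : H1 X →ₗ[ℚ] ℚ, ∀ z : (singularChains X).cycles 1,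
      l (((singularChains X).homologyπ 1).hom z) = f (((singularChains X).iCycles 1).hom z) := by
  let k : (singularChains X).cycles 1 ⟶ ModuleCat.of ℚ ℚ :=
    (singularChains X).iCycles 1 ≫ ModuleCat.ofHom f
  have hk : (singularChains X).toCycles 2 1 ≫ k = 0 := by
    have : (singularChains X).toCycles 2 1 ≫ (singularChains X).iCycles 1 =
      (singularChains X).d 2 1 := (singularChains X).toCycles_i 2 1
    ext c
    have h2 : ((singularChains X).iCycles 1).hom (((singularChains X).toCycles 2 1).hom c) =
      ((singularChains X).d 2 1).hom c := congrArg (fun f => f.hom c) this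
    exact (congrArg f h2).trans (hf c)
  have D := (singularChains X).homologyIsCokernel 2 1 (by simp)
  refine ⟨(D.desc (Limits.CokernelCofork.ofπ k hk)).hom, fun z => ?_⟩
  have := D.fac (Limits.CokernelCofork.ofπ k hk) Limits.WalkingParallelPair.one
  exact congrArg (fun f => f.hom z) this

/-- Every functional on the first homology group comes from a cocycle. -/
lemma exists_cocycle_of_functional (l : H1 X →ₗ[ℚ] ℚ) :
    ∃ f : (singularChains X).X 1 →ₗ[ℚ] ℚ,
      (∀ c, f (((singularChains X).d 2 1).hom c) = 0) ∧
      ∀ z : (singularChains X).cycles 1,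
        f (((singularChains X).iCycles 1).hom z) =
          l (((singularChains X).homologyπ 1).hom z) := by
  have hinj : Function.Injective ((singularChains X).iCycles 1).hom :=
    (ModuleCat.mono_iff_injective _).1 inferInstance
  obtain ⟨r, hr⟩ := LinearMap.exists_leftInverse_of_injective _ (LinearMap.ker_eq_bot.2 hinj)
  have hr' : ∀ z, r (((singularChains X).iCycles 1).hom z) = z := fun z =>
    congrArg (fun f => f z) hr
  refine ⟨l ∘ₗ ((singularChains X).homologyπ 1).hom ∘ₗ r, fun c => ?_, fun z => ?_⟩
  · have h1 : ((singularChains X).d 2 1).hom c =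
        ((singularChains X).iCycles 1).hom (((singularChains X).toCycles 2 1).hom c) :=
      (congrArg (fun f => f.hom c) ((singularChains X).toCycles_i 2 1)).symm
    have h2 : ((singularChains X).homologyπ 1).hom (((singularChains X).toCycles 2 1).hom c) = 0 :=
      congrArg (fun f => f.hom c) ((singularChains X).toCycles_comp_homologyπ 2 1)
    simp only [LinearMap.comp_apply]
    rw [h1, hr', h2, map_zero]
  · simp only [LinearMap.comp_apply, hr']

/-- The singular simplex of a continuous map on the standard simplex. -/
def mkSimplex {n : ℕ} (τ : C(stdSimplex ℝ (Fin (n + 1)), X)) :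
    (sing X).obj (Opposite.op (SimplexCategory.mk n)) :=
  (TopCat.toSSetObjEquiv (TopCat.of X) (Opposite.op (SimplexCategory.mk n))).symm τ

lemma mkSimplex_surjective {n : ℕ} (s : (sing X).obj (Opposite.op (SimplexCategory.mk n))) :
    ∃ τ, mkSimplex τ = s :=
  ⟨_, (TopCat.toSSetObjEquiv (TopCat.of X) (Opposite.op (SimplexCategory.mk n))).symm_apply_apply s⟩

lemma pathSimplex_surjective (s : (sing X).obj (Opposite.op (SimplexCategory.mk 1))) :
    ∃ γ : C(I, X), pathSimplex γ = s := by
  obtain ⟨τ, rfl⟩ := mkSimplex_surjective s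
  refine ⟨τ.comp ⟨stdSimplexHomeomorphUnitInterval.symm,
    stdSimplexHomeomorphUnitInterval.symm.continuous⟩, ?_⟩
  unfold pathSimplex mkSimplex
  congr 1
  ext x
  simp

lemma δ_mkSimplex {n : ℕ} (τ : C(stdSimplex ℝ (Fin (n + 2)), X)) (i : Fin (n + 2)) :
    (sing X).δ i (mkSimplex τ) =
      mkSimplex (τ.comp ⟨stdSimplex.map (Fin.succAbove i), stdSimplex.continuous_map _⟩) := by
  rfl

/-- The `i`-th edge of the standard triangle, parametrised by the unit interval. -/
def triangleEdge (i : Fin 3) : C(I, stdSimplex ℝ (Fin 3)) :=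
  (⟨stdSimplex.map (Fin.succAbove i), stdSimplex.continuous_map _⟩ :
    C(stdSimplex ℝ (Fin 2), stdSimplex ℝ (Fin 3))).comp
  ⟨stdSimplexHomeomorphUnitInterval.symm, stdSimplexHomeomorphUnitInterval.symm.continuous⟩

lemma coe_stdSimplexHomeomorphUnitInterval (x : stdSimplex ℝ (Fin 2)) :
    (stdSimplexHomeomorphUnitInterval x : ℝ) = x 1 := rfl

lemma stdSimplexHomeomorphUnitInterval_symm_apply_zero (t : I) :
    stdSimplexHomeomorphUnitInterval.symm t 0 = 1 - (t : ℝ) := rfl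

lemma stdSimplexHomeomorphUnitInterval_symm_apply_one (t : I) :
    stdSimplexHomeomorphUnitInterval.symm t 1 = (t : ℝ) := rfl

lemma triangleEdge_apply (i j : Fin 3) (t : I) : (triangleEdge i t : Fin 3 → ℝ) j =
    (if i.succAbove 0 = j then 1 - (t : ℝ) else 0) +
      (if i.succAbove 1 = j then (t : ℝ) else 0) := by
  simp [triangleEdge, stdSimplex.map_coe, FunOnFinite.linearMap_apply_apply, Finset.sum_filter,
    Fin.sum_univ_two, stdSimplexHomeomorphUnitInterval_symm_apply_zero,
    stdSimplexHomeomorphUnitInterval_symm_apply_one]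

lemma pathChain_eq (γ : C(I, X)) : pathChain γ = simplexChain (pathSimplex γ) := rfl

lemma d_mkSimplex_two (τ : C(stdSimplex ℝ (Fin 3), X)) :
    ((singularChains X).d 2 1).hom (simplexChain (mkSimplex τ)) =
      pathChain (τ.comp (triangleEdge 0)) - pathChain (τ.comp (triangleEdge 1)) +
        pathChain (τ.comp (triangleEdge 2)) := by
  have h (i : Fin 3) : (sing X).δ i (mkSimplex τ) = pathSimplex (τ.comp (triangleEdge i)) := by
    rw [δ_mkSimplex]
    unfold pathSimplex mkSimplex
    congr 1
    ext x
    simp [triangleEdge]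
  rw [d_simplexChain, Fin.sum_univ_three, h, h, h]
  simp [pathChain_eq, sub_eq_add_neg]

/-- The point `x` as a singular `0`-chain. -/
def pointChain (x : X) : (singularChains X).X 0 :=
  simplexChain (mkSimplex (ContinuousMap.const _ x))

lemma d_pathChain (γ : C(I, X)) :
    ((singularChains X).d 1 0).hom (pathChain γ) = pointChain (γ 1) - pointChain (γ 0) := by
  have h (i : Fin 2) (t : I) (h : ∀ x : stdSimplex ℝ (Fin 1),
      stdSimplexHomeomorphUnitInterval (stdSimplex.map (Fin.succAbove i) x) = t) :
      (sing X).δ i (pathSimplex γ) = mkSimplex (ContinuousMap.const _ (γ t)) := by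
    refine (δ_mkSimplex (γ.comp ⟨stdSimplexHomeomorphUnitInterval,
      stdSimplexHomeomorphUnitInterval.continuous⟩) i).trans ?_
    congr 1
    ext x
    simp [h]
  rw [pathChain_eq, d_simplexChain, Fin.sum_univ_two, h 0 1, h 1 0]
  · simp [pointChain, sub_eq_add_neg]
  all_goals
    intro x
    apply Subtype.ext
    rw [coe_stdSimplexHomeomorphUnitInterval, stdSimplex.map_coe,
      FunOnFinite.linearMap_apply_apply]
    simp
  decide

lemma path_hom_ext {M : Type} [AddCommGroup M] [Module ℚ M]
    {f g : (singularChains X).X 1 →ₗ[ℚ] M}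
    (h : ∀ γ, f (pathChain γ) = g (pathChain γ)) : f = g := by
  apply chain_hom_ext
  intro s
  obtain ⟨γ, rfl⟩ := pathSimplex_surjective s
  exact h γ

lemma exists_path_desc {M : Type} [AddCommGroup M] [Module ℚ M] (φ : C(I, X) → M) :
    ∃ f : (singularChains X).X 1 →ₗ[ℚ] M, ∀ γ, f (pathChain γ) = φ γ := by
  choose p hp using pathSimplex_surjective (X := X)
  have hp' (γ : C(I, X)) : p (pathSimplex γ) = γ := by
    have := hp (pathSimplex γ)
    have h2 := (TopCat.toSSetObjEquiv (TopCat.of X) _).symm.injective this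
    ext t
    simpa using congrArg (fun f => f (stdSimplexHomeomorphUnitInterval.symm t)) h2
  obtain ⟨f, hf⟩ := exists_chain_desc (X := X) (n := 1) fun s => φ (p s)
  exact ⟨f, fun γ => by rw [pathChain_eq, hf, hp']⟩

/-- A function on paths that is additive along the boundary of every singular triangle. -/
def IsPathCocycle (g : C(I, X) → ℚ) : Prop :=
  ∀ τ : C(stdSimplex ℝ (Fin 3), X),
    g (τ.comp (triangleEdge 1)) = g (τ.comp (triangleEdge 0)) + g (τ.comp (triangleEdge 2))

lemma IsPathCocycle.exists_functional {g : C(I, X) → ℚ} (hg : IsPathCocycle g) :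
    ∃ l : H1 X →ₗ[ℚ] ℚ, ∀ γ h, IsClassOf γ h → l h = g γ := by
  obtain ⟨f, hf'⟩ := exists_path_desc g
  have hd : f ∘ₗ ((singularChains X).d 2 1).hom = 0 := by
    apply chain_hom_ext
    intro s
    obtain ⟨τ, rfl⟩ := mkSimplex_surjective s
    simp only [LinearMap.comp_apply, LinearMap.zero_apply]
    rw [d_mkSimplex_two, map_add, map_sub, hf', hf', hf', hg τ]
    ring
  obtain ⟨l, hl⟩ := exists_functional_of_cocycle f fun c => congrArg (fun f => f c) hd
  refine ⟨l, ?_⟩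
  rintro γ _ ⟨z, hz, rfl⟩
  rw [hl, hz, hf']

lemma exists_isPathCocycle (l : H1 X →ₗ[ℚ] ℚ) :
    ∃ f : (singularChains X).X 1 →ₗ[ℚ] ℚ, IsPathCocycle (fun γ => f (pathChain γ)) ∧
      (∀ z : (singularChains X).cycles 1, f (((singularChains X).iCycles 1).hom z) =
          l (((singularChains X).homologyπ 1).hom z)) := by
  obtain ⟨f, hf, hf'⟩ := exists_cocycle_of_functional l
  refine ⟨f, fun τ => ?_, hf'⟩
  have := hf (simplexChain (mkSimplex τ))
  rw [d_mkSimplex_two, map_add, map_sub] at this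
  linarith

lemma exists_point_desc {M : Type} [AddCommGroup M] [Module ℚ M] (φ : X → M) :
    ∃ f : (singularChains X).X 0 →ₗ[ℚ] M, ∀ x, f (pointChain x) = φ x := by
  obtain ⟨f, hf⟩ := exists_chain_desc (X := X) (n := 0) fun s =>
    φ (TopCat.toSSetObjEquiv (TopCat.of X) _ s (Classical.arbitrary (stdSimplex ℝ (Fin 1))))
  exact ⟨f, fun x => by rw [pointChain, hf]; rfl⟩

lemma exists_isClassOf {γ : C(I, X)} (h : γ 0 = γ 1) : ∃ c, IsClassOf γ c := by
  obtain ⟨z, hz⟩ := exists_cycle (pathChain γ) (by rw [d_pathChain, h, sub_self])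
  exact ⟨_, z, hz, rfl⟩

end Singular
end

/-! ### Gluing local potentials -/

section

section PathCocycle
variable {X : Type} [TopologicalSpace X]

/-- The affine path in the unit interval from `a` to `b`. -/
def affinePath (a b : I) : C(I, I) where
  toFun t := ⟨(1 - t) * a + t * b, by
    have := convex_Icc (0 : ℝ) 1 a.2 b.2 (sub_nonneg.2 t.2.2) t.2.1 (by ring)
    simpa using this⟩
  continuous_toFun := by fun_prop

lemma coe_affinePath (a b t : I) : (affinePath a b t : ℝ) = (1 - t) * a + t * b := rfl

@[simp] lemma affinePath_zero (a b : I) : affinePath a b 0 = a := by ext; simp [coe_affinePath]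
@[simp] lemma affinePath_one (a b : I) : affinePath a b 1 = b := by ext; simp [coe_affinePath]
@[simp] lemma affinePath_self (a : I) : affinePath a a = .const _ a := by
  ext; simp [coe_affinePath]; ring
@[simp] lemma affinePath_zero_one : affinePath 0 1 = .id _ := by ext; simp [coe_affinePath]

lemma affinePath_mem_Icc {a b : I} (h : a ≤ b) (t : I) : affinePath a b t ∈ Set.Icc a b := by
  have h' : (a : ℝ) ≤ b := h
  have h0 := t.2.1
  have h1 := t.2.2
  constructor <;> rw [← Subtype.coe_le_coe, coe_affinePath] <;> nlinarith

/-- The affine path in the unit square from `p` to `q`. -/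
def squarePath (p q : I × I) : C(I, I × I) := (affinePath p.1 q.1).prodMk (affinePath p.2 q.2)

/-- The affine map from the standard triangle to the unit interval with given values at the
vertices. -/
def affineTriangle (a : Fin 3 → I) : C(stdSimplex ℝ (Fin 3), I) where
  toFun s := ⟨∑ i, s i * a i, by
    have := (convex_Icc (0 : ℝ) 1).sum_mem (t := Finset.univ) (w := s) (z := fun i => (a i : ℝ))
      (fun i _ => s.2.1 i) s.2.2 (fun i _ => (a i).2)
    simpa using this⟩
  continuous_toFun := by
    refine Continuous.subtype_mk (continuous_finsetSum _ fun i _ => ?_) _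
    exact ((continuous_apply i).comp continuous_subtype_val).mul continuous_const

lemma affineTriangle_comp_triangleEdge (a : Fin 3 → I) (i : Fin 3) :
    (affineTriangle a).comp (triangleEdge i) =
      affinePath (a (i.succAbove 0)) (a (i.succAbove 1)) := by
  ext t
  change ∑ j, (triangleEdge i t : Fin 3 → ℝ) j * (a j : ℝ) = _
  simp only [triangleEdge_apply, add_mul, ite_mul, zero_mul, Finset.sum_add_distrib,
    Finset.sum_ite_eq, Finset.mem_univ, if_true, coe_affinePath]

lemma IsPathCocycle.square {g : C(I, X) → ℚ} (hg : IsPathCocycle g) (K : C(I × I, X))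
    (p q r : I × I) :
    g (K.comp (squarePath p r)) = g (K.comp (squarePath p q)) + g (K.comp (squarePath q r)) := by
  let a : Fin 3 → I × I := ![p, q, r]
  have h := hg (K.comp ((affineTriangle fun i => (a i).1).prodMk (affineTriangle fun i => (a i).2)))
  have e (i : Fin 3) : (K.comp ((affineTriangle fun i => (a i).1).prodMk
      (affineTriangle fun i => (a i).2))).comp (triangleEdge i) =
      K.comp (squarePath (a (i.succAbove 0)) (a (i.succAbove 1))) := by
    rw [squarePath, ← affineTriangle_comp_triangleEdge (fun i => (a i).1),
      ← affineTriangle_comp_triangleEdge (fun i => (a i).2)]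
    rfl
  rw [e, e, e] at h
  exact h.trans (add_comm _ _)

/-- The piece of the path `γ` from time `a` to time `b`. -/
def subpath (γ : C(I, X)) (a b : I) : C(I, X) := γ.comp (affinePath a b)

@[simp] lemma subpath_zero (γ : C(I, X)) (a b : I) : subpath γ a b 0 = γ a := by simp [subpath]
@[simp] lemma subpath_one (γ : C(I, X)) (a b : I) : subpath γ a b 1 = γ b := by simp [subpath]
@[simp] lemma subpath_zero_one (γ : C(I, X)) : subpath γ 0 1 = γ := by ext; simp [subpath]

lemma IsPathCocycle.subpath_trans {g : C(I, X) → ℚ} (hg : IsPathCocycle g) (γ : C(I, X))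
    (a b c : I) : g (subpath γ a c) = g (subpath γ a b) + g (subpath γ b c) :=
  hg.square (γ.comp .fst) (a, 0) (b, 0) (c, 0)

lemma IsPathCocycle.const {g : C(I, X) → ℚ} (hg : IsPathCocycle g) (x : X) :
    g (.const _ x) = 0 := by
  have := hg.subpath_trans (.const _ x) 0 0 0
  simpa [subpath] using this

/-- The value of a path cocycle on the top of a square whose left side and right side are joined
to a constant bottom. -/
lemma IsPathCocycle.cone {g : C(I, X) → ℚ} (hg : IsPathCocycle g) (K : C(I × I, X)) {x : X}
    (hx : ∀ t, K (0, t) = x) :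
    g (K.comp (squarePath (1, 0) (1, 1))) =
      g (K.comp (squarePath (0, 1) (1, 1))) - g (K.comp (squarePath (0, 0) (1, 0))) := by
  have h1 := hg.square K (0, 0) (1, 0) (1, 1)
  have h2 := hg.square K (0, 0) (0, 1) (1, 1)
  have h3 : K.comp (squarePath (0, 0) (0, 1)) = .const _ x := by
    ext t
    simp [squarePath, hx]
  rw [h3, hg.const] at h2
  linarith

/-- A property of pairs of times that holds for close times and is transitive holds for the
end points of the unit interval. -/
lemma unitInterval_induction {Q : I → I → Prop} (htrans : ∀ a b c, Q a b → Q b c → Q a c)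
    (hloc : ∀ t, ∃ U, IsOpen U ∧ t ∈ U ∧ ∀ a b, a ≤ b → Set.Icc a b ⊆ U → Q a b) : Q 0 1 := by
  choose U hU ht hQ using hloc
  obtain ⟨t, t0, tm, ⟨n, tn⟩, ht⟩ := exists_monotone_Icc_subset_open_cover_unitInterval hU
    (fun x _ => Set.mem_iUnion.2 ⟨x, ht x⟩)
  have h (k : ℕ) : Q 0 (t (k + 1)) := by
    induction k with
    | zero =>
      obtain ⟨i, hi⟩ := ht 0
      rw [← t0]
      exact hQ i _ _ (tm (Nat.zero_le _)) hi
    | succ k ih =>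
      obtain ⟨i, hi⟩ := ht (k + 1)
      exact htrans _ _ _ ih (hQ i _ _ (tm (Nat.le_succ _)) hi)
  have := h n
  rwa [tn (n + 1) (Nat.le_succ _)] at this

end PathCocycle

section Glue
open Bundle Topology

/-- `Ψ` is a global potential for the local potentials `ψ i` on `U i`. -/
def IsGlobalPotential {Y ι : Type*} [TopologicalSpace Y] (U : ι → Set Y) (ψ : ι → Y → ℚ)
    (Ψ : Y → ℚ) : Prop :=
  ∀ i, ∀ y ∈ U i, ∀ᶠ z in 𝓝 y, Ψ z - ψ i z = Ψ y - ψ i y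

/-- Local potentials whose differences are locally constant glue to a global potential on a simply
connected space: they are the local trivialisations of a covering space with fibre `ℚ`, which has a
section. -/
theorem exists_global_potential {Y ι : Type*} [TopologicalSpace Y] [SimplyConnectedSpace Y]
    [LocallyPathConnectedSpace Y] (U : ι → Set Y) (hU : ∀ i, IsOpen (U i))
    (hcov : ∀ y, ∃ i, y ∈ U i) (ψ : ι → Y → ℚ)
    (hψ : ∀ i j, ∀ y ∈ U i ∩ U j, ∀ᶠ z in 𝓝 y, ψ i z - ψ j z = ψ i y - ψ j y) :
    ∃ Ψ : Y → ℚ, IsGlobalPotential U ψ Ψ := by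
  let _ : TopologicalSpace ℚ := ⊥
  have : DiscreteTopology ℚ := ⟨rfl⟩
  choose ind hind using hcov
  let Z : FiberBundleCore ι Y ℚ :=
    { baseSet := U
      isOpen_baseSet := hU
      indexAt := ind
      mem_baseSet_at := hind
      coordChange := fun i j y v => v + (ψ i y - ψ j y)
      coordChange_self := fun i y _ v => by simp
      continuousOn_coordChange := fun i j => by
        rintro ⟨y, v⟩ ⟨hy, -⟩
        refine ContinuousAt.continuousWithinAt ?_
        refine ContinuousAt.congr (f := fun p : Y × ℚ => p.2 + (ψ i y - ψ j y)) ?_ ?_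
        · exact (continuous_of_discreteTopology
            (f := fun v : ℚ => v + (ψ i y - ψ j y))).continuousAt.comp
            continuousAt_snd
        · have := (continuousAt_fst (p := ((y, v) : Y × ℚ))).eventually (hψ i j y hy)
          filter_upwards [this] with p hp
          rw [hp]
      coordChange_comp := fun i j k y _ v => by ring }
  have hcovering : IsCoveringMap Z.proj := by
    exact FiberBundle.isCoveringMap (F := ℚ) (E := Z.Fiber)
  obtain ⟨y₀⟩ : Nonempty Y := inferInstance
  obtain ⟨S, ⟨-, hS⟩, -⟩ := hcovering.existsUnique_continuousMap_lifts (.id Y) y₀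
    (⟨y₀, (0 : ℚ)⟩ : Z.TotalSpace) rfl
  have hS' (y : Y) : (S y).1 = y := congrFun hS y
  let s : Y → ℚ := fun y => (S y).2
  refine ⟨fun y => s y + ψ (ind y) y, fun i y hy => ?_⟩
  have hloc (z : Y) (hz : z ∈ U i) : (Z.localTriv i (S z)).2 = s z + (ψ (ind z) z - ψ i z) := by
    have := hS' z
    rw [Z.localTriv_apply]
    change s z + (ψ (ind (S z).1) (S z).1 - ψ i (S z).1) = _
    rw [this]
  have hc : ContinuousAt (fun z => (Z.localTriv i (S z)).2) y := by
    refine continuousAt_snd.comp (ContinuousAt.comp ?_ S.continuous.continuousAt)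
    refine (Z.localTriv i).continuousOn_toFun.continuousAt ?_
    refine (Z.localTriv i).open_source.mem_nhds ?_
    rw [Z.mem_localTriv_source]
    change (S y).1 ∈ U i
    rw [hS']
    exact hy
  have he : ∀ᶠ z in 𝓝 y, (Z.localTriv i (S y)).2 = (Z.localTriv i (S z)).2 := by
    exact hc.eventually (by rw [nhds_discrete]; exact Filter.eventually_pure.2 rfl)
  filter_upwards [he, (hU i).mem_nhds hy] with z hz hzU
  rw [hloc z hzU, hloc y hy] at hz
  linarith

lemma IsGlobalPotential.sub_eq {Y ι : Type*} [TopologicalSpace Y] [PreconnectedSpace Y]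
    {U : ι → Set Y} {ψ : ι → Y → ℚ} (hcov : ∀ y, ∃ i, y ∈ U i) {Ψ Ψ' : Y → ℚ}
    (h : IsGlobalPotential U ψ Ψ) (h' : IsGlobalPotential U ψ Ψ') (y z : Y) :
    Ψ y - Ψ z = Ψ' y - Ψ' z := by
  have hc : IsLocallyConstant fun y => Ψ y - Ψ' y := by
    rw [IsLocallyConstant.iff_eventually_eq]
    intro y
    obtain ⟨i, hi⟩ := hcov y
    filter_upwards [h i y hi, h' i y hi] with z hz hz'
    linarith
  have := hc.apply_eq_of_preconnectedSpace y z
  linarith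

lemma IsGlobalPotential.comp {Y Z ι : Type*} [TopologicalSpace Y] [TopologicalSpace Z]
    {U : ι → Set Y} {ψ : ι → Y → ℚ} {Ψ : Y → ℚ}
    (h : IsGlobalPotential U ψ Ψ) (f : C(Z, Y)) :
    IsGlobalPotential (fun i => f ⁻¹' U i) (fun i => ψ i ∘ f) (Ψ ∘ f) := fun i z hz =>
  (f.continuous.tendsto z).eventually (h i (f z) hz)

/-- Local potentials whose differences are locally constant define a path cocycle. -/
theorem exists_pathCocycle {X : Type} {ι : Type*} [TopologicalSpace X] (U : ι → Set X)
    (hU : ∀ i, IsOpen (U i)) (hcov : ∀ y, ∃ i, y ∈ U i) (ψ : ι → X → ℚ)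
    (hψ : ∀ i j, ∀ y ∈ U i ∩ U j, ∀ᶠ z in 𝓝 y, ψ i z - ψ j z = ψ i y - ψ j y) :
    ∃ g : C(I, X) → ℚ, IsPathCocycle g ∧
      ∀ i γ, (∀ t, γ t ∈ U i) → g γ = ψ i (γ 1) - ψ i (γ 0) := by
  have key {Y : Type} [TopologicalSpace Y] [SimplyConnectedSpace Y] [LocallyPathConnectedSpace Y]
      (f : C(Y, X)) : ∃ Ψ, IsGlobalPotential (fun i => f ⁻¹' U i) (fun i => ψ i ∘ f) Ψ :=
    exists_global_potential _ (fun i => (hU i).preimage f.continuous) (fun y => hcov (f y)) _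
      fun i j y hy => (f.continuous.tendsto y).eventually (hψ i j (f y) hy)
  have : ContractibleSpace I := (convex_Icc (0 : ℝ) 1).contractibleSpace ⟨0, by simp⟩
  have : LocallyPathConnectedSpace I := (convex_Icc (0 : ℝ) 1).locallyPathConnectedSpace
  have : ContractibleSpace (stdSimplex ℝ (Fin 3)) := (convex_stdSimplex ℝ (Fin 3)).contractibleSpace
    ⟨_, single_mem_stdSimplex ℝ 0⟩
  have : LocallyPathConnectedSpace (stdSimplex ℝ (Fin 3)) :=
    (convex_stdSimplex ℝ (Fin 3)).locallyPathConnectedSpace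
  choose Ψ hΨ using fun γ : C(I, X) => key γ
  refine ⟨fun γ => Ψ γ 1 - Ψ γ 0, fun τ => ?_, fun i γ hγ => ?_⟩
  · obtain ⟨Φ, hΦ⟩ := key τ
    have h (i : Fin 3) := (hΨ (τ.comp (triangleEdge i))).sub_eq
      (fun t => hcov (τ (triangleEdge i t)))
      (hΦ.comp (triangleEdge i)) 1 0
    have e10 : triangleEdge 1 0 = triangleEdge 2 0 := by
      ext j; simp only [triangleEdge_apply]; fin_cases j <;> simp
    have e01 : triangleEdge 0 0 = triangleEdge 2 1 := by
      ext j; simp only [triangleEdge_apply]; fin_cases j <;> simp <;> decide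
    have e11 : triangleEdge 1 1 = triangleEdge 0 1 := by
      ext j; simp only [triangleEdge_apply]; fin_cases j <;> simp
    simp only [h, Function.comp, e10, e01, e11]
    ring
  · have hc : IsLocallyConstant fun t => Ψ γ t - ψ i (γ t) := by
      rw [IsLocallyConstant.iff_eventually_eq]
      exact fun t => hΨ γ i t (hγ t)
    have := hc.apply_eq_of_preconnectedSpace 1 0
    simp only
    linarith

end Glue

end

/-! ### The cycle space of a graph -/

section

section Graph
variable {V : Type*} {M : Type*} [AddCommGroup M] {G : SimpleGraph V}

/-- The sum of `w` over the oriented edges of a walk. -/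
def walkSum (w : V → V → M) {u v : V} : G.Walk u v → M
  | .nil => 0
  | .cons (v := x) _ p => w u x + walkSum w p

@[simp] lemma walkSum_nil (w : V → V → M) (u : V) : walkSum w (.nil : G.Walk u u) = 0 := rfl

@[simp] lemma walkSum_cons (w : V → V → M) {u v x : V} (h : G.Adj u v) (p : G.Walk v x) :
    walkSum w (.cons h p) = w u v + walkSum w p := rfl

@[simp] lemma walkSum_append (w : V → V → M) {u v x : V} (p : G.Walk u v) (q : G.Walk v x) :
    walkSum w (p.append q) = walkSum w p + walkSum w q := by
  induction p with
  | nil => simp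
  | cons h p ih => simp [ih, add_assoc]

lemma walkSum_reverse (w : V → V → M) (hw : ∀ u v, w v u = -w u v) {u v : V} (p : G.Walk u v) :
    walkSum w p.reverse = -walkSum w p := by
  induction p with
  | nil => simp
  | @cons u v x h p ih =>
    rw [SimpleGraph.Walk.reverse_cons, walkSum_append, ih]
    simp only [walkSum_cons, walkSum_nil]
    rw [hw u v]
    abel

lemma walkSum_eq_sum (w : V → V → M) {u v : V} (p : G.Walk u v) :
    walkSum w p = ∑ i : Fin p.length, w (p.getVert i) (p.getVert (i + 1)) := by
  induction p with
  | nil => exact (Fin.sum_univ_zero _).symm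
  | cons h p ih =>
    rw [walkSum_cons, ih, SimpleGraph.Walk.length_cons, Fin.sum_univ_succ]
    simp

lemma map_walkSum {N : Type*} [AddCommGroup N] (f : M →+ N) (w : V → V → M) {u v : V}
    (p : G.Walk u v) : f (walkSum w p) = walkSum (fun a b => f (w a b)) p := by
  induction p with
  | nil => simp
  | cons h p ih => simp [ih]

/-- An alternating function on edges that vanishes on all closed walks has a potential. -/
lemma exists_potential (w : V → V → M) (hw : ∀ u v, w v u = -w u v)
    (h : ∀ u (p : G.Walk u u), walkSum w p = 0) :
    ∃ φ : V → M, ∀ u v, G.Adj u v → w u v = φ v - φ u := by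
  classical
  have hr (v : V) : ∃ r : V, r = (G.connectedComponentMk v).out ∧ G.Reachable r v := by
    refine ⟨_, rfl, ?_⟩
    rw [← SimpleGraph.ConnectedComponent.eq]
    exact (G.connectedComponentMk v).out_eq
  choose r hr hreach using hr
  refine ⟨fun v => walkSum w (hreach v).some, fun u v huv => ?_⟩
  have e : r u = r v := by
    rw [hr, hr, SimpleGraph.ConnectedComponent.sound huv.reachable]
  have key : ∀ (a b : V) (hab : a = b) (p : G.Walk a u) (q : G.Walk b v),
      w u v = walkSum w q - walkSum w p := by
    rintro a b rfl p q
    have := h a ((p.append (.cons huv .nil)).append q.reverse)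
    simp only [walkSum_append, walkSum_cons, walkSum_nil, walkSum_reverse w hw] at this
    have h2 : w u v - (walkSum w q - walkSum w p) = 0 := by rw [← this]; abel
    exact sub_eq_zero.1 h2
  exact key _ _ e _ _

/-- An alternating function on edges vanishes on all closed walks as soon as it vanishes on those
that consist of an edge and a path. -/
lemma walkSum_closed_eq_zero (w : V → V → M)
    (h : ∀ u v (_ : G.Adj u v) (p : G.Walk v u), p.IsPath → w u v + walkSum w p = 0)
    (u : V) (p : G.Walk u u) : walkSum w p = 0 := by
  classical
  have key {u v : V} (p : G.Walk u v) : walkSum w p = walkSum w p.bypass := by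
    induction p with
    | nil => rfl
    | @cons u v x huv p ih =>
      rw [walkSum_cons, ih, SimpleGraph.Walk.bypass]
      split_ifs with hs
      · have e := congrArg (walkSum w) (p.bypass.take_spec hs)
        rw [walkSum_append] at e
        change w u v + _ = walkSum w (p.bypass.dropUntil u hs)
        rw [← e, ← add_assoc, h u v huv _ (p.bypass_isPath.takeUntil hs), zero_add]
      · rw [walkSum_cons]
  rw [key, (SimpleGraph.Walk.isPath_iff_nil.1 p.bypass_isPath).eq_nil]
  rfl

end Graph

section Chains
variable {V : Type} {G : SimpleGraph V}

lemma edgeChain_symm (v w : V) : edgeChain w v = -edgeChain v w := by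
  simp [edgeChain]

/-- The boundary map on simplicial `1`-chains of a graph. -/
abbrev boundary (V : Type) : (V × V →₀ ℚ) →ₗ[ℚ] (V →₀ ℚ) := Finsupp.lmapDomain ℚ ℚ Prod.snd

lemma boundary_edgeChain (v w : V) :
    boundary V (edgeChain v w) = Finsupp.single w 1 - Finsupp.single v 1 := by
  rw [edgeChain, map_sub]
  simp [Finsupp.lmapDomain_apply, Finsupp.mapDomain_single]

/-- The simplicial `1`-chains of a graph. -/
def graphChains (G : SimpleGraph V) : Submodule ℚ (V × V →₀ ℚ) where
  carrier := {c | (∀ v w, c (w, v) = -c (v, w)) ∧ (∀ v w, ¬ G.Adj v w → c (v, w) = 0)}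
  zero_mem' := by simp
  add_mem' := by
    rintro a b ⟨ha, ha'⟩ ⟨hb, hb'⟩
    refine ⟨fun v w => ?_, fun v w h => ?_⟩
    · rw [Finsupp.add_apply, Finsupp.add_apply, ha, hb, neg_add]
    · rw [Finsupp.add_apply, ha' v w h, hb' v w h, add_zero]
  smul_mem' := by
    rintro r a ⟨ha, ha'⟩
    refine ⟨fun v w => ?_, fun v w h => ?_⟩
    · rw [Finsupp.smul_apply, Finsupp.smul_apply, ha, smul_neg]
    · rw [Finsupp.smul_apply, ha' v w h, smul_zero]

lemma mem_cycleSpace_iff {c : V × V →₀ ℚ} :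
    c ∈ cycleSpace G ↔ c ∈ graphChains G ∧ boundary V c = 0 :=
  ⟨fun h => ⟨⟨h.1, h.2.1⟩, h.2.2⟩, fun h => ⟨h.1.1, h.1.2, h.2⟩⟩

lemma edgeChain_mem {v w : V} (h : G.Adj v w) : edgeChain v w ∈ graphChains G := by
  classical
  refine ⟨fun a b => ?_, fun a b hab => ?_⟩
  · simp only [edgeChain, Finsupp.sub_apply, Finsupp.single_apply, Prod.mk.injEq]
    grind
  · have h1 : (v, w) ≠ (a, b) := by rintro ⟨⟩; exact hab h
    have h2 : (w, v) ≠ (a, b) := by rintro ⟨⟩; exact hab h.symm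
    simp [edgeChain, h1, h2]

/-- The group of cycles of a graph is spanned by the closed walks. -/
lemma eq_zero_of_mem_cycleSpace (L : (V × V →₀ ℚ) →ₗ[ℚ] ℚ)
    (h : ∀ u (p : G.Walk u u), L (walkSum edgeChain p) = 0) {c : V × V →₀ ℚ}
    (hc : c ∈ cycleSpace G) : L c = 0 := by
  obtain ⟨φ, hφ⟩ := exists_potential (G := G) (fun u v => L (edgeChain u v))
    (fun u v => by rw [edgeChain_symm u v, map_neg]) fun u p => by
      rw [← h u p]
      exact (map_walkSum L.toAddMonoidHom edgeChain p).symm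
  rw [mem_cycleSpace_iff] at hc
  obtain ⟨⟨hanti, hsupp⟩, hb⟩ := hc
  let E : (V × V →₀ ℚ) →ₗ[ℚ] (V × V →₀ ℚ) := Finsupp.lmapDomain ℚ ℚ Prod.swap
  let Φ : (V →₀ ℚ) →ₗ[ℚ] ℚ := Finsupp.linearCombination ℚ φ
  have hE : E c = -c := by
    ext ⟨v, w⟩
    change Finsupp.mapDomain Prod.swap c (v, w) = -c (v, w)
    rw [← hanti v w]
    exact Finsupp.mapDomain_apply Prod.swap_injective c (w, v)
  -- On chains supported on the edges, `L` of an oriented edge is a difference of values of `φ`.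
  have key : L c - L (E c) = Φ (boundary V c) - Φ (boundary V (E c)) := by
    let D : (V × V →₀ ℚ) →ₗ[ℚ] ℚ := (L - L ∘ₗ E) - (Φ ∘ₗ boundary V - Φ ∘ₗ boundary V ∘ₗ E)
    have hD : D c = 0 := by
      rw [← Finsupp.sum_single c, Finsupp.sum, map_sum]
      refine Finset.sum_eq_zero fun e he => ?_
      have hadj : G.Adj e.1 e.2 := by
        by_contra hne
        exact (Finsupp.mem_support_iff.1 he) (hsupp _ _ hne)
      have h1 := hφ _ _ hadj
      have h2 : Finsupp.single e (c e) = c e • Finsupp.single e (1 : ℚ) := by simp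
      have h3 : D (Finsupp.single e (1 : ℚ)) = 0 := by
        have e1 : E (Finsupp.single e 1) = Finsupp.single e.swap 1 := by
          simp [E, Finsupp.lmapDomain_apply, Finsupp.mapDomain_single]
        have e2 (e : V × V) : Φ (boundary V (Finsupp.single e 1)) = φ e.2 := by
          simp [Φ, Finsupp.lmapDomain_apply, Finsupp.mapDomain_single]
        simp only [D, LinearMap.sub_apply, LinearMap.comp_apply, e1, e2]
        rw [edgeChain, map_sub] at h1
        simp only [Prod.swap] at *
        linarith
      rw [h2, map_smul, h3, smul_zero]
    simp only [D, LinearMap.sub_apply, LinearMap.comp_apply] at hD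
    linarith
  rw [hE, map_neg, map_neg, hb] at key
  simp at key
  linarith

end Chains

end

/-! ### Normal fans -/

section

open Topology Module

section General
variable {E : Type*} [NormedAddCommGroup E] [InnerProductSpace ℝ E] [FiniteDimensional ℝ E]

/-- A nonempty open set is not covered by finitely many translates of proper subspaces. -/
lemma exists_mem_open_forall_sub_notMem {κ : Type*} [Finite κ] (W : κ → Submodule ℝ E)
    (hW : ∀ k, W k ≠ ⊤) (c : κ → E) {U : Set E} (hU : IsOpen U) (hne : U.Nonempty) :
    ∃ q ∈ U, ∀ k, q - c k ∉ W k := by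
  have hd (k : κ) : IsOpen {q | q - c k ∉ W k} ∧ Dense {q | q - c k ∉ W k} := by
    constructor
    · exact ((W k).closed_of_finiteDimensional.preimage (continuous_sub_right (c k))).isOpen_compl
    · have h : Dense ((W k : Set E)ᶜ) := by
        rw [← interior_eq_empty_iff_dense_compl, ← Set.not_nonempty_iff_eq_empty]
        exact fun h => hW k ((W k).eq_top_of_nonempty_interior' h)
      exact h.preimage (Homeomorph.subRight (c k)).isOpenMap
  have := dense_iInter_of_isOpen (fun k => (hd k).1) (fun k => (hd k).2)
  obtain ⟨q, hq, hqU⟩ := this.inter_open_nonempty U hU hne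
  exact ⟨q, hq, fun k => Set.mem_iInter.1 hqU k⟩

lemma finrank_sup_span_singleton_le (W : Submodule ℝ E) (v : E) :
    finrank ℝ (W ⊔ Submodule.span ℝ {v} : Submodule ℝ E) ≤ finrank ℝ W + 1 := by
  refine (Submodule.finrank_add_le_finrank_add_finrank _ _).trans ?_
  gcongr
  exact (finrank_span_le_card _).trans (by simp)

lemma ne_top_of_finrank_lt {E : Type*} [AddCommGroup E] [Module ℝ E] {W : Submodule ℝ E}
    (h : finrank ℝ W < finrank ℝ E) : W ≠ ⊤ := by
  rintro rfl
  simp at h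

end General

section Fan
variable {E : Type*} [NormedAddCommGroup E] [InnerProductSpace ℝ E]
  {ι : Type*} (a : ι → E)

/-- The indices of the linear functionals `⟪a i, ·⟫` that are maximal at `z`. -/
def active (z : E) : Set ι := {i | ∀ j, inner ℝ (a j) z ≤ inner ℝ (a i) z}

variable {a}

lemma active_eq_of_mem {z : E} {i j : ι} (hi : i ∈ active a z) (hj : j ∈ active a z) :
    inner ℝ (a i) z = inner ℝ (a j) z := le_antisymm (hj i) (hi j)

lemma lt_of_notMem_active {z : E} {i j : ι} (hi : i ∈ active a z) (hj : j ∉ active a z) :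
    inner ℝ (a j) z < inner ℝ (a i) z := by
  refine lt_of_le_of_ne (hi j) fun h => hj fun k => ?_
  rw [h]
  exact hi k

lemma active_add_smul {z w : E} (h : (active a z ∩ active a w).Nonempty) {e : ℝ} (he : 0 < e) :
    active a (z + e • w) = active a z ∩ active a w := by
  obtain ⟨i, hiz, hiw⟩ := h
  have key (j : ι) : inner ℝ (a j) (z + e • w) = inner ℝ (a j) z + e * inner ℝ (a j) w := by
    rw [inner_add_right, inner_smul_right]
  ext j
  constructor
  · intro hj
    have h1 := hj i
    rw [key, key] at h1
    have h2 := hiz j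
    have h3 := mul_le_mul_of_nonneg_left (hiw j) he.le
    constructor
    · intro k; linarith [hiz k]
    · intro k
      have h4 : e * inner ℝ (a k) w ≤ e * inner ℝ (a j) w := by
        linarith [mul_le_mul_of_nonneg_left (hiw k) he.le]
      exact le_of_mul_le_mul_left h4 he
  · rintro ⟨hjz, hjw⟩ k
    rw [key, key]
    linarith [hjz k, mul_le_mul_of_nonneg_left (hjw k) he.le]

lemma active_smul {z : E} {e : ℝ} (he : 0 < e) : active a (e • z) = active a z := by
  ext i
  simp [active, inner_smul_right, he]

@[simp] lemma active_zero : active a 0 = Set.univ := by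
  ext i; simp [active]

lemma active_nonempty [Finite ι] [Nonempty ι] (z : E) : (active a z).Nonempty := by
  obtain ⟨i, hi⟩ := Finite.exists_max fun i => inner ℝ (a i) z
  exact ⟨i, hi⟩

lemma eventually_active_subset [Finite ι] (z : E) : ∀ᶠ y in 𝓝 z, active a y ⊆ active a z := by
  cases isEmpty_or_nonempty ι with
  | inl h => exact Filter.Eventually.of_forall fun y i => h.elim i
  | inr h =>
    obtain ⟨i, hi⟩ := active_nonempty (a := a) z
    have : ∀ j, ∀ᶠ y in 𝓝 z, j ∈ active a y → j ∈ active a z := by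
      intro j
      by_cases hj : j ∈ active a z
      · exact Filter.Eventually.of_forall fun _ _ => hj
      · have hc : Continuous fun y : E => inner ℝ (a i) y - inner ℝ (a j) y := by fun_prop
        have h0 := sub_pos.2 (lt_of_notMem_active hi hj)
        filter_upwards [hc.continuousAt.eventually (lt_mem_nhds h0)] with y hy hjy
        have := hjy i
        linarith
    filter_upwards [Filter.eventually_all.2 this] with y hy j hj using hy j hj

lemma eventually_active_eq_singleton [Finite ι] {z : E} {i : ι} (h : active a z = {i}) :
    ∀ᶠ y in 𝓝 z, active a y = {i} := by
  have : Nonempty ι := ⟨i⟩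
  filter_upwards [eventually_active_subset (a := a) z] with y hy
  rw [h] at hy
  exact (Set.Nonempty.subset_singleton_iff (active_nonempty (a := a) y)).1 hy

lemma isOpen_active_eq_singleton [Finite ι] (i : ι) : IsOpen {z | active a z = {i}} := by
  refine isOpen_iff_mem_nhds.2 fun z hz => ?_
  exact eventually_active_eq_singleton (a := a) hz

lemma active_lineMap {p q : E} (h : (active a p ∩ active a q).Nonempty) {t : ℝ} (h0 : 0 < t)
    (h1 : t < 1) : active a ((1 - t) • p + t • q) = active a p ∩ active a q := by
  have h' : 0 < 1 - t := by linarith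
  rw [active_add_smul (by rwa [active_smul h']) h0, active_smul h']

variable (a)

/-- The adjacency of the maximal cones of the fan of `a`: two of them are adjacent if they share
a cone of codimension one. -/
def fanGraph : SimpleGraph ι where
  Adj i j := i ≠ j ∧ ∃ w, active a w = {i, j}
  symm := ⟨fun i j ⟨h, w, hw⟩ => ⟨h.symm, w, by rw [hw, Set.pair_comm]⟩⟩
  loopless := ⟨fun _ h => h.1 rfl⟩

/-- Every functional is the unique maximal one somewhere. -/
def Irredundant : Prop := ∀ i, ∃ w, active a w = {i}

variable {a}

lemma Irredundant.sub_ne_zero (ha : Irredundant a) {i j : ι} (h : i ≠ j) : a j - a i ≠ 0 := by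
  intro h0
  obtain ⟨w, hw⟩ := ha i
  have hi : i ∈ active a w := by simp [hw]
  have hj : j ∉ active a w := by simp [hw, h.symm]
  have := lt_of_notMem_active hi hj
  rw [sub_eq_zero.1 h0] at this
  exact lt_irrefl _ this

lemma Irredundant.isolated (ha : Irredundant a) {i j k : ι} (hij : i ≠ j) (hik : i ≠ k)
    {x y z : ℝ} (hs : x + y + z = 0) (h : x • a i + y • a j + z • a k = 0) (hy : 0 ≤ y)
    (hz : 0 ≤ z) : x = 0 := by
  obtain ⟨w, hw⟩ := ha i
  have hi : i ∈ active a w := by simp [hw]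
  have hj := lt_of_notMem_active hi (by simp [hw, hij.symm] : j ∉ active a w)
  have hk := lt_of_notMem_active hi (by simp [hw, hik.symm] : k ∉ active a w)
  have := congrArg (fun v => inner ℝ v w) h
  simp only [inner_add_left, real_inner_smul_left, inner_zero_left] at this
  have hx : x = -y - z := by linarith
  subst hx
  have h1 := mul_nonneg hy (sub_pos.2 hj).le
  have h2 := mul_nonneg hz (sub_pos.2 hk).le
  have h3 : y * (inner ℝ (a i) w - inner ℝ (a j) w) = 0 := by linarith
  have h4 : z * (inner ℝ (a i) w - inner ℝ (a k) w) = 0 := by linarith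
  rw [mul_eq_zero, or_iff_left (sub_pos.2 hj).ne'] at h3
  rw [mul_eq_zero, or_iff_left (sub_pos.2 hk).ne'] at h4
  simp [h3, h4]

/-- Three distinct members of an irredundant family are affinely independent. -/
lemma Irredundant.linearIndependent (ha : Irredundant a) {i j k : ι} (hij : i ≠ j) (hik : i ≠ k)
    (hjk : j ≠ k) : LinearIndependent ℝ ![a j - a i, a k - a i] := by
  rw [LinearIndependent.pair_iff]
  intro y z h
  have hs : (-y - z) + y + z = 0 := by ring
  have h' : (-y - z) • a i + y • a j + z • a k = 0 := by rw [← h]; module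
  generalize hx : -y - z = x at *
  have e1 : x + y + z = 0 → x • a i + y • a j + z • a k = 0 → 0 ≤ y → 0 ≤ z → x = 0 :=
    fun h1 h2 => ha.isolated hij hik h1 h2
  have p1 := fun x y z => ha.isolated (x := x) (y := y) (z := z) hij hik
  have p2 := fun x y z => ha.isolated (x := x) (y := y) (z := z) hij.symm hjk
  have p3 := fun x y z => ha.isolated (x := x) (y := y) (z := z) hik.symm hjk.symm
  have h2 : y • a j + x • a i + z • a k = 0 := by rw [← h']; module
  have h3 : z • a k + x • a i + y • a j = 0 := by rw [← h']; module
  have n1 : (-x) • a i + (-y) • a j + (-z) • a k = 0 := by rw [← neg_zero, ← h']; module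
  have n2 : (-y) • a j + (-x) • a i + (-z) • a k = 0 := by rw [← neg_zero, ← h']; module
  have n3 : (-z) • a k + (-x) • a i + (-y) • a j = 0 := by rw [← neg_zero, ← h']; module
  rcases le_total 0 x with hx0 | hx0 <;> rcases le_total 0 y with hy0 | hy0 <;>
    rcases le_total 0 z with hz0 | hz0
  · constructor <;> linarith
  · have := p3 z x y (by linarith) h3 hx0 hy0; constructor <;> linarith
  · have := p2 y x z (by linarith) h2 hx0 hz0; constructor <;> linarith
  · have := p1 (-x) (-y) (-z) (by linarith) n1 (by linarith) (by linarith)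
    constructor <;> linarith
  · have := p1 x y z (by linarith) h' hy0 hz0; constructor <;> linarith
  · have := p2 (-y) (-x) (-z) (by linarith) n2 (by linarith) (by linarith)
    constructor <;> linarith
  · have := p3 (-z) (-x) (-y) (by linarith) n3 (by linarith) (by linarith)
    constructor <;> linarith
  · constructor <;> linarith

/-- In a two-dimensional fan every maximal cone has at most two neighbours. -/
lemma fanGraph_adj_eq_of_finrank [FiniteDimensional ℝ E] (W : Submodule ℝ E)
    (hW : finrank ℝ W ≤ 2) (haW : ∀ i j, a i - a j ∈ W) {i j k l : ι} (hj : (fanGraph a).Adj i j)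
    (hk : (fanGraph a).Adj i k) (hl : (fanGraph a).Adj i l) (hjk : j ≠ k) : l = j ∨ l = k := by
  by_contra! hcon
  obtain ⟨hlj, hlk⟩ := hcon
  have hdep : ¬ LinearIndependent ℝ
      (![⟨a j - a i, haW j i⟩, ⟨a k - a i, haW k i⟩, ⟨a l - a i, haW l i⟩] : Fin 3 → W) := by
    intro h
    have := h.fintype_card_le_finrank
    simp at this
    omega
  rw [Fintype.not_linearIndependent_iff] at hdep
  obtain ⟨g, hg, hne⟩ := hdep
  have hg' : g 0 • (a j - a i) + g 1 • (a k - a i) + g 2 • (a l - a i) = 0 := by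
    have := congrArg Subtype.val hg
    simpa [Fin.sum_univ_three] using this
  have ev (w : E) : g 0 * (inner ℝ (a j) w - inner ℝ (a i) w) +
      g 1 * (inner ℝ (a k) w - inner ℝ (a i) w) +
        g 2 * (inner ℝ (a l) w - inner ℝ (a i) w) = 0 := by
    have := congrArg (fun v => inner ℝ v w) hg'
    simpa only [inner_add_left, real_inner_smul_left, inner_zero_left, inner_sub_left] using this
  have hN {m n : ι} (hm : (fanGraph a).Adj i m) : ∃ w, inner ℝ (a m) w - inner ℝ (a i) w = 0 ∧
      ∀ n, n ≠ i → n ≠ m → inner ℝ (a n) w - inner ℝ (a i) w < 0 := by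
    obtain ⟨-, w, hw⟩ := hm
    have h1 : i ∈ active a w := by simp [hw]
    have h2 : m ∈ active a w := by simp [hw]
    refine ⟨w, sub_eq_zero.2 (active_eq_of_mem h2 h1), fun n hni hnm => ?_⟩
    exact sub_neg.2 (lt_of_notMem_active h1 (by simp [hw, hni, hnm]))
  obtain ⟨wj, hj0, hwj⟩ := hN (n := i) hj
  obtain ⟨wk, hk0, hwk⟩ := hN (n := i) hk
  obtain ⟨wl, hl0, hwl⟩ := hN (n := i) hl
  have ej := ev wj
  have ek := ev wk
  have el := ev wl
  rw [hj0] at ej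
  rw [hk0] at ek
  rw [hl0] at el
  have jk := hwj k hk.1.symm hjk.symm
  have jl := hwj l hl.1.symm hlj
  have kj := hwk j hj.1.symm hjk
  have kl := hwk l hl.1.symm hlk
  have lj := hwl j hj.1.symm hlj.symm
  have lk := hwl k hk.1.symm hlk.symm
  -- Each two coefficients of the relation have opposite signs, so all of them vanish.
  have main : g 0 = 0 ∧ g 1 = 0 ∧ g 2 = 0 := by
    have opp {x y p q : ℝ} (hp : p < 0) (hq : q < 0) (h : x * p + y * q = 0) :
        (0 ≤ x → y ≤ 0) ∧ (x ≤ 0 → 0 ≤ y) := by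
      constructor <;> intro hx <;> by_contra! hy
      · have := mul_nonpos_of_nonneg_of_nonpos hx hp.le
        have := mul_neg_of_pos_of_neg hy hq
        linarith
      · have := mul_nonneg_of_nonpos_of_nonpos hx hp.le
        have := mul_pos_of_neg_of_neg hy hq
        linarith
    have s01 := opp (x := g 0) (y := g 1) lj lk (by linarith)
    have s12 := opp (x := g 1) (y := g 2) jk jl (by linarith)
    have s02 := opp (x := g 0) (y := g 2) kj kl (by linarith)
    have s10 := opp (x := g 1) (y := g 0) lk lj (by linarith)
    have s20 := opp (x := g 2) (y := g 0) kl kj (by linarith)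
    rcases le_total 0 (g 0) with h | h
    · have h1 := s01.1 h
      have h2 := s02.1 h
      have h3 := s12.2 h1
      refine ⟨le_antisymm (s20.1 h3) h, ?_, le_antisymm h2 h3⟩
      exact le_antisymm h1 (s01.2 (s20.1 h3))
    · have h1 := s01.2 h
      have h2 := s02.2 h
      have h3 := s12.1 h1
      refine ⟨le_antisymm h (s20.2 h3), ?_, le_antisymm h3 h2⟩
      exact le_antisymm (s01.1 (s20.2 h3)) h1
  obtain ⟨m, hm⟩ := hne
  fin_cases m
  · exact hm main.1
  · exact hm main.2.1
  · exact hm main.2.2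

end Fan
end

/-! ### Connectedness of fans, and potentials on them -/

section

open Topology Module

section Fan

lemma isLocallyConstant_apply_active {E : Type*} [NormedAddCommGroup E]
    [InnerProductSpace ℝ E] {ι : Type*} {a : ι → E} [Finite ι] {Y β : Type*}
    [TopologicalSpace Y] [Nonempty ι] (f : ι → β)
    (γ : Y → E) (hγ : Continuous γ)
    (hf : ∀ t, ∀ i ∈ active a (γ t), ∀ j ∈ active a (γ t), f i = f j) {c : E → ι}
    (hc : ∀ z, c z ∈ active a z) : IsLocallyConstant fun t => f (c (γ t)) := by
  rw [IsLocallyConstant.iff_eventually_eq]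
  intro t
  filter_upwards [hγ.continuousAt.eventually (eventually_active_subset (a := a) (γ t))] with s hs
  exact hf t _ (hs (hc _)) _ (hc _)

variable {E : Type*} [NormedAddCommGroup E] [InnerProductSpace ℝ E] [FiniteDimensional ℝ E]
  {ι : Type*} {a : ι → E} [Finite ι]

/-- The maximal cones around a point are connected through cones of codimension one: a generic
segment close to the point crosses no cone of higher codimension. -/
lemma Irredundant.connected (ha : Irredundant a) {β : Type*} (f : ι → β) (z : E)
    (hf : ∀ i ∈ active a z, ∀ j ∈ active a z, (fanGraph a).Adj i j → f i = f j) {i j : ι}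
    (hi : i ∈ active a z) (hj : j ∈ active a z) : f i = f j := by
  have : Nonempty ι := ⟨i⟩
  choose w hw using ha
  obtain ⟨r, hr, hball⟩ := Metric.eventually_nhds_iff_ball.1 (eventually_active_subset (a := a) z)
  have hsmall (k : ι) : ∃ e : ℝ, 0 < e ∧ z + e • w k ∈ Metric.ball z r := by
    have hc : Continuous fun e : ℝ => z + e • w k := by fun_prop
    have : ∀ᶠ e in 𝓝[>] (0 : ℝ), z + e • w k ∈ Metric.ball z r := by
      refine Filter.Eventually.filter_mono nhdsWithin_le_nhds ?_
      exact hc.continuousAt.eventually (Metric.isOpen_ball.mem_nhds (by simpa using hr))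
    obtain ⟨e, he, he0⟩ := (this.and self_mem_nhdsWithin).exists
    exact ⟨e, he0, he⟩
  have hact (k : ι) (hk : k ∈ active a z) (e : ℝ) (he : 0 < e) : active a (z + e • w k) = {k} := by
    rw [active_add_smul ⟨k, hk, by simp [hw]⟩ he, hw]
    simpa using hk
  obtain ⟨e, he, heb⟩ := hsmall i
  obtain ⟨e', he', heb'⟩ := hsmall j
  set p := z + e • w i with hp
  -- The subspaces spanned by `p` and a cone of codimension two.
  let M : ι × ι × ι → Submodule ℝ E := fun t =>
    (Submodule.span ℝ {a t.2.1 - a t.1, a t.2.2 - a t.1})ᗮ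
  have hM (t : {t : ι × ι × ι // t.1 ≠ t.2.1 ∧ t.1 ≠ t.2.2 ∧ t.2.1 ≠ t.2.2}) :
      M t.1 ⊔ Submodule.span ℝ {p} ≠ ⊤ := by
    apply ne_top_of_finrank_lt
    have h1 := Irredundant.linearIndependent (fun i => ⟨w i, hw i⟩) t.2.1 t.2.2.1 t.2.2.2
    have h2 := finrank_span_eq_card h1
    rw [Matrix.range_cons, Matrix.range_cons, Matrix.range_empty, Set.union_empty,
      Set.singleton_union, Fintype.card_fin] at h2
    have h3 :=
      (Submodule.span ℝ {a t.1.2.1 - a t.1.1, a t.1.2.2 - a t.1.1}).finrank_add_finrank_orthogonal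
    have h4 := finrank_sup_span_singleton_le (M t.1) p
    change _ + finrank ℝ (M t.1) = _ at h3
    omega
  obtain ⟨q, ⟨hqb, hqj⟩, hq⟩ := exists_mem_open_forall_sub_notMem _ hM (fun _ => 0)
    (Metric.isOpen_ball.inter (isOpen_active_eq_singleton (a := a) j)) ⟨_, heb', hact j hj e' he'⟩
  simp only [sub_zero] at hq
  have hpi : active a p = {i} := hact i hi e he
  choose c hc using fun z : E => active_nonempty (a := a) z
  let γ : I → E := fun t => (1 - (t : ℝ)) • p + (t : ℝ) • q
  have hγb (t : I) : active a (γ t) ⊆ active a z := by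
    refine hball _ ((convex_ball z r) heb hqb (sub_nonneg.2 t.2.2) t.2.1 (by ring))
  -- By the choice of `q`, the segment from `p` to `q` meets no cone of codimension two.
  have htriple (t : I) {k l m : ι} (hkl : k ≠ l) (hkm : k ≠ m) (hlm : l ≠ m)
      (hk : k ∈ active a (γ t)) (hl : l ∈ active a (γ t)) (hm : m ∈ active a (γ t)) : False := by
    by_cases ht : (t : ℝ) = 0
    · have : γ t = p := by simp [γ, ht]
      rw [this, hpi, Set.mem_singleton_iff] at hk hl
      exact hkl (hk.trans hl.symm)
    · refine hq ⟨(k, l, m), hkl, hkm, hlm⟩ ?_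
      have hmem : γ t ∈ M (k, l, m) := by
        rw [Submodule.mem_orthogonal]
        intro u hu
        induction hu using Submodule.span_induction with
        | mem x hx =>
          rcases hx with rfl | rfl
          · rw [inner_sub_left, active_eq_of_mem hl hk, sub_self]
          · rw [inner_sub_left, active_eq_of_mem hm hk, sub_self]
        | zero => simp
        | add x y _ _ hx hy => rw [inner_add_left, hx, hy, add_zero]
        | smul r x _ hx => rw [real_inner_smul_left, hx, mul_zero]
      have : q = (t : ℝ)⁻¹ • (γ t) + (-((t : ℝ)⁻¹ * (1 - t))) • p := by
        simp only [γ, smul_add, smul_smul, inv_mul_cancel₀ ht]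
        module
      rw [this]
      exact Submodule.add_mem_sup (Submodule.smul_mem _ _ hmem)
        (Submodule.smul_mem _ _ (Submodule.mem_span_singleton_self p))
  have hconst : IsLocallyConstant fun t : I => f (c (γ t)) := by
    refine isLocallyConstant_apply_active f γ (by fun_prop) (fun t k hk l hl => ?_) hc
    by_cases hkl : k = l
    · rw [hkl]
    · refine hf k (hγb t hk) l (hγb t hl) ⟨hkl, γ t, Set.Subset.antisymm (fun m hm => ?_) ?_⟩
      · by_contra hcon
        simp only [Set.mem_insert_iff, Set.mem_singleton_iff, not_or] at hcon
        exact htriple t hkl (Ne.symm hcon.1) (Ne.symm hcon.2) hk hl hm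
      · rintro m (rfl | rfl) <;> assumption
  have h01 := hconst.apply_eq_of_preconnectedSpace 0 1
  have e0 : c (γ 0) = i := by have := hc (γ 0); simpa [γ, hpi] using this
  have e1 : c (γ 1) = j := by
    have := hc (γ 1)
    have hqj' : active a q = {j} := hqj
    simpa [γ, hqj'] using this
  rwa [e0, e1] at h01

lemma IsGlobalPotential.eventually {E : Type*} [TopologicalSpace E] {Y : Set E} {κ : Type*}
    {U : κ → Set Y} {ψ : κ → Y → ℚ} {Ψ : Y → ℚ} (h : IsGlobalPotential U ψ Ψ) {k : κ} {y : E}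
    (hy : y ∈ Y) (hk : ⟨y, hy⟩ ∈ U k) :
    ∀ᶠ z in 𝓝 y, ∀ hz : z ∈ Y, Ψ ⟨z, hz⟩ - ψ k ⟨z, hz⟩ = Ψ ⟨y, hy⟩ - ψ k ⟨y, hy⟩ := by
  have := h k _ hk
  rw [nhds_subtype_eq_comap, Filter.eventually_comap] at this
  filter_upwards [this] with z hz hzY using hz _ rfl

/-- In a fan whose lineality space has codimension at least three, an alternating function on the
pairs of adjacent maximal cones has a potential if it has one around every point outside the
lineality space `Λ`. Removing from the space all points whose ray in a generic direction `v` meets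
`Λ` leaves a star-shaped set, on which the local potentials glue, and this does not disconnect any
maximal cone or remove any cone of codimension one. -/
theorem Irredundant.exists_potential (ha : Irredundant a) (w : ι → ι → ℚ) (Λ : Submodule ℝ E)
    (hΛ : ∀ z, z ∈ Λ ↔ active a z = Set.univ) (hdim : finrank ℝ Λ + 3 ≤ finrank ℝ E)
    (hloc : ∀ z, active a z ≠ Set.univ → ∃ φ : ι → ℚ, ∀ i ∈ active a z, ∀ j ∈ active a z,
      (fanGraph a).Adj i j → w i j = φ j - φ i) :
    ∃ φ : ι → ℚ, ∀ i j, (fanGraph a).Adj i j → w i j = φ j - φ i := by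
  cases isEmpty_or_nonempty ι with
  | inl h => exact ⟨fun _ => 0, fun i => h.elim i⟩
  | inr h =>
  obtain ⟨i₀⟩ := h
  have : Nonempty ι := ⟨i₀⟩
  obtain ⟨v, hv⟩ := ha i₀
  choose c hc using fun z : E => active_nonempty (a := a) z
  have hpos : 0 < finrank ℝ E := by omega
  have hvΛ : v ∉ Λ := by
    intro hmem
    rw [hΛ, hv] at hmem
    have htop : Λ = ⊤ := by
      refine Submodule.eq_top_iff'.2 fun z => (hΛ z).2 (Set.eq_univ_of_forall fun i => ?_)
      have h1 (k : ι) : k = i₀ := by simpa [← hmem] using Set.mem_univ k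
      rw [h1 i, ← h1 (c z)]
      exact hc z
    rw [htop, finrank_top] at hdim
    omega
  have hR : finrank ℝ (Λ ⊔ Submodule.span ℝ {v} : Submodule ℝ E) + 2 ≤ finrank ℝ E := by
    have := finrank_sup_span_singleton_le Λ v
    omega
  have hRu (u : E) : Λ ⊔ Submodule.span ℝ {v} ⊔ Submodule.span ℝ {u} ≠ ⊤ := by
    apply ne_top_of_finrank_lt
    have := finrank_sup_span_singleton_le (Λ ⊔ Submodule.span ℝ {v}) u
    omega
  -- the complement of the half-space `Λ - ℝ≥0 v` of the span of `Λ` and `v`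
  let Y : Set E := {z | ∀ t : ℝ, 0 ≤ t → z + t • v ∉ Λ}
  -- The removed half-space has codimension at least two, so generic segments avoid its span.
  have hYR {z : E} (hz : z ∉ Λ ⊔ Submodule.span ℝ {v}) : z ∈ Y := by
    intro t _ hmem
    refine hz ?_
    have : z = (z + t • v) + (-t) • v := by module
    rw [this]
    exact Submodule.add_mem_sup hmem (Submodule.smul_mem _ _ (Submodule.mem_span_singleton_self v))
  have hYΛ {z : E} (hz : z ∈ Y) : active a z ≠ Set.univ := by
    rw [Ne, ← hΛ]
    simpa using hz 0 le_rfl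
  have hvY : v ∈ Y := by
    intro t ht hmem
    have h1 : v + t • v = (1 + t) • v := by module
    rw [h1, Λ.smul_mem_iff (by positivity)] at hmem
    exact hvΛ hmem
  have hYopen : IsOpen Y := by
    -- A functional that vanishes on `Λ` but not at `v` computes the only `t` with `z + t v ∈ Λ`.
    obtain ⟨f, hfv, hfΛ⟩ := Submodule.exists_le_ker_of_notMem hvΛ
    have hf : Continuous f := f.continuous_of_finiteDimensional
    have hYc : Y = {z | (f v)⁻¹ * f z ≤ 0 ∧ z - ((f v)⁻¹ * f z) • v ∈ Λ}ᶜ := by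
      ext z
      constructor
      · rintro hz ⟨h1, h2⟩
        refine hz (-((f v)⁻¹ * f z)) (by linarith) ?_
        rwa [neg_smul, ← sub_eq_add_neg]
      · intro hz t ht hmem
        have h1 : f (z + t • v) = 0 := hfΛ hmem
        rw [map_add, map_smul, smul_eq_mul] at h1
        have h2 : (f v)⁻¹ * f z = -t := by
          field_simp
          linarith
        refine hz ⟨by linarith, ?_⟩
        rwa [h2, neg_smul, sub_neg_eq_add]
    rw [hYc]
    refine IsClosed.isOpen_compl (self := ?_)
    have hf' : Continuous fun z => (f v)⁻¹ * f z := continuous_const.mul hf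
    exact (isClosed_le hf' continuous_const).inter
      (Λ.closed_of_finiteDimensional.preimage
        (continuous_id.sub (hf'.smul continuous_const)))
  have hYstar : StarConvex ℝ v Y := by
    intro z hz r s hr hs hrs t ht hmem
    rcases hs.eq_or_lt with rfl | hs
    · have h1 : r = 1 := by linarith
      subst h1
      refine hvY t ht ?_
      simpa using hmem
    · refine hz ((r + t) / s) (by positivity) ?_
      have h1 : r • v + s • z + t • v = s • (z + ((r + t) / s) • v) := by
        rw [smul_add, smul_smul, mul_div_cancel₀ _ hs.ne']
        module
      rwa [h1, Λ.smul_mem_iff hs.ne'] at hmem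
  -- The local potential near `y ∈ Y` is the value of `φ` at the maximal cone of a point.
  have : ContractibleSpace Y := hYstar.contractibleSpace ⟨v, hvY⟩
  have : LocallyPathConnectedSpace Y := hYopen.locallyPathConnectedSpace
  choose φ hφ using hloc
  let U : Y → Set Y := fun y => {z | active a z.1 ⊆ active a y.1}
  let ψ : Y → Y → ℚ := fun y z => φ y.1 (hYΛ y.2) (c z.1)
  obtain ⟨Ψ, hΨ⟩ := exists_global_potential U (fun y => by
      refine isOpen_iff_mem_nhds.2 fun z hz => ?_
      filter_upwards [continuous_subtype_val.continuousAt.eventually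
        (eventually_active_subset (a := a) z.1)] with z' hz'
      exact hz'.trans hz) (fun y => ⟨y, Set.Subset.refl (active a y.1)⟩) ψ (by
      rintro y y' z ⟨hz, hz'⟩
      filter_upwards [continuous_subtype_val.continuousAt.eventually
        (eventually_active_subset (a := a) z.1)] with x hx
      refine ha.connected (fun i => φ y.1 (hYΛ y.2) i - φ y'.1 (hYΛ y'.2) i) z.1 ?_ (hx (hc _))
        (hc _)
      intro i hi j hj hij
      have h1 := hφ y.1 (hYΛ y.2) i (hz hi) j (hz hj) hij
      have h2 := hφ y'.1 (hYΛ y'.2) i (hz' hi) j (hz' hj) hij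
      linarith)
  have hΨ' {y : E} (hy : y ∈ Y) : ∀ᶠ z in 𝓝 y, ∀ hz : z ∈ Y,
      Ψ ⟨z, hz⟩ - φ y (hYΛ hy) (c z) = Ψ ⟨y, hy⟩ - φ y (hYΛ hy) (c y) :=
    hΨ.eventually (k := ⟨y, hy⟩) hy (subset_rfl : active a y ⊆ active a y)
  have hcsingle {z : E} {i : ι} (h : active a z = {i}) : c z = i := by
    have := hc z
    rwa [h] at this
  -- The potential is constant along segments in a maximal cone.
  have hseg (i : ι) {z m : E} (hzi : active a z = {i}) (hmi : active a m = {i}) (hz : z ∈ Y)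
      (hm' : m ∉ Λ ⊔ Submodule.span ℝ {v} ⊔ Submodule.span ℝ {z}) (hm : m ∈ Y) :
      Ψ ⟨z, hz⟩ = Ψ ⟨m, hm⟩ := by
    let γ : I → E := fun t => (1 - (t : ℝ)) • z + (t : ℝ) • m
    have hγc : Continuous γ := by fun_prop
    have hγi (t : I) : active a (γ t) = {i} := by
      rcases t.2.1.eq_or_lt with h0 | h0
      · simpa [γ, ← h0] using hzi
      rcases t.2.2.eq_or_lt with h1 | h1
      · simpa [γ, h1] using hmi
      · rw [active_lineMap (by simp [hzi, hmi]) h0 h1, hzi, hmi, Set.inter_self]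
    have hγY (t : I) : γ t ∈ Y := by
      intro s hs hmem
      by_cases h0 : (t : ℝ) = 0
      · refine hz s hs ?_
        simpa [γ, h0] using hmem
      · refine hm' ?_
        have : m = (t : ℝ)⁻¹ • (γ t + s • v) + (-((t : ℝ)⁻¹ * s)) • v +
            (-((t : ℝ)⁻¹ * (1 - t))) • z := by
          simp only [γ, smul_add, smul_smul, inv_mul_cancel₀ h0]
          module
        rw [this]
        refine Submodule.add_mem_sup (Submodule.add_mem_sup (Λ.smul_mem _ hmem) ?_) ?_
        · exact Submodule.smul_mem _ _ (Submodule.mem_span_singleton_self v)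
        · exact Submodule.smul_mem _ _ (Submodule.mem_span_singleton_self z)
    have hconst : IsLocallyConstant fun t : I => Ψ ⟨γ t, hγY t⟩ := by
      rw [IsLocallyConstant.iff_eventually_eq]
      intro t
      filter_upwards [hγc.continuousAt.eventually (hΨ' (hγY t))] with s hs
      have := hs (hγY s)
      rw [hcsingle (hγi s), hcsingle (hγi t)] at this
      linarith
    have := hconst.apply_eq_of_preconnectedSpace 0 1
    simpa [γ] using this
  have hconst (i : ι) {z z' : E} (hzi : active a z = {i}) (hzi' : active a z' = {i}) (hz : z ∈ Y)
      (hz' : z' ∈ Y) : Ψ ⟨z, hz⟩ = Ψ ⟨z', hz'⟩ := by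
    obtain ⟨m, hm, hmn⟩ := exists_mem_open_forall_sub_notMem
      (fun b : Bool => Λ ⊔ Submodule.span ℝ {v} ⊔ Submodule.span ℝ {if b then z else z'})
      (fun b => hRu _) (fun _ => 0) (isOpen_active_eq_singleton (a := a) i) ⟨z, hzi⟩
    simp only [sub_zero, Bool.forall_bool, if_true, if_false, Bool.false_eq_true] at hmn
    have hmY : m ∈ Y := hYR fun h => hmn.1 (Submodule.mem_sup_left h)
    rw [hseg i hzi hm hz hmn.2 hmY, hseg i hzi' hm hz' hmn.1 hmY]
  have hpoint (i : ι) : ∃ z ∈ Y, active a z = {i} := by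
    obtain ⟨m, hm, hmn⟩ := exists_mem_open_forall_sub_notMem
      (fun _ : Unit => Λ ⊔ Submodule.span ℝ {v} ⊔ Submodule.span ℝ {v})
      (fun b => hRu _) (fun _ => 0) (isOpen_active_eq_singleton (a := a) i) (ha i)
    simp only [sub_zero, forall_const] at hmn
    exact ⟨m, hYR fun h => hmn (Submodule.mem_sup_left h), hm⟩
  choose y hyY hy using hpoint
  refine ⟨fun i => Ψ ⟨y i, hyY i⟩, fun i j hij => ?_⟩
  -- A point of the common wall of the cones `i` and `j`, off the removed set.
  obtain ⟨u, hu, huij⟩ : ∃ u ∈ Y, active a u = {i, j} := by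
    obtain ⟨hne, w₀, hw₀⟩ := hij
    have hi₀ : i ∈ active a w₀ := by simp [hw₀]
    have hj₀ : j ∈ active a w₀ := by simp [hw₀]
    by_cases hw₀R : w₀ ∈ Λ ⊔ Submodule.span ℝ {v}
    · obtain ⟨u₀, hu₀, hu₀R⟩ : ∃ u₀ ∈ (Submodule.span ℝ {a j - a i})ᗮ,
          u₀ ∉ Λ ⊔ Submodule.span ℝ {v} := by
        by_contra! hcon
        have h1 := Submodule.finrank_mono (show (Submodule.span ℝ {a j - a i})ᗮ ≤ _ from hcon)
        have h2 := (Submodule.span ℝ {a j - a i}).finrank_add_finrank_orthogonal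
        rw [finrank_span_singleton (ha.sub_ne_zero hne)] at h2
        omega
      have hu₀' : inner ℝ (a j) u₀ = inner ℝ (a i) u₀ := by
        rw [Submodule.mem_orthogonal_singleton_iff_inner_right, inner_sub_left] at hu₀
        linarith
      have hcont : Continuous fun e : ℝ => w₀ + e • u₀ := by fun_prop
      have h0 : Filter.Tendsto (fun e : ℝ => w₀ + e • u₀) (𝓝[>] 0) (𝓝 w₀) := by
        have := hcont.tendsto 0
        simp only [zero_smul, add_zero] at this
        exact this.mono_left nhdsWithin_le_nhds
      obtain ⟨e, he, he0⟩ := ((h0.eventually (eventually_active_subset (a := a) w₀)).and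
        self_mem_nhdsWithin).exists
      refine ⟨w₀ + e • u₀, hYR fun hmem => hu₀R ?_, he.trans_eq hw₀ |>.antisymm ?_⟩
      · have h1 : u₀ = e⁻¹ • (w₀ + e • u₀ - w₀) := by
          rw [add_sub_cancel_left, smul_smul, inv_mul_cancel₀ (ne_of_gt he0), one_smul]
        rw [h1]
        exact Submodule.smul_mem _ _ (Submodule.sub_mem _ hmem hw₀R)
      · have heq : inner ℝ (a i) (w₀ + e • u₀) = inner ℝ (a j) (w₀ + e • u₀) := by
          rw [inner_add_right, inner_add_right, inner_smul_right, inner_smul_right, hu₀',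
            active_eq_of_mem hi₀ hj₀]
        have hcu := hc (w₀ + e • u₀)
        have hcu' := he hcu
        rw [hw₀] at hcu'
        have hi' : i ∈ active a (w₀ + e • u₀) := by
          intro k
          rcases hcu' with h | h
          · rw [← h]; exact hcu k
          · rw [heq, ← Set.mem_singleton_iff.1 h]; exact hcu k
        rintro k (rfl | rfl)
        · exact hi'
        · intro l; rw [← heq]; exact hi' l
    · exact ⟨w₀, hYR hw₀R, hw₀⟩
  have hiu : i ∈ active a u := by simp [huij]
  have hju : j ∈ active a u := by simp [huij]
  -- Near `u` the global potential differs from the local one by a constant.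
  have hnear (k : ι) (hk : k ∈ active a u) :
      Ψ ⟨y k, hyY k⟩ - φ u (hYΛ hu) k = Ψ ⟨u, hu⟩ - φ u (hYΛ hu) (c u) := by
    have hcont : Continuous fun e : ℝ => u + e • y k := by fun_prop
    have h0 : Filter.Tendsto (fun e : ℝ => u + e • y k) (𝓝[>] 0) (𝓝 u) := by
      have := hcont.tendsto 0
      simp only [zero_smul, add_zero] at this
      exact this.mono_left nhdsWithin_le_nhds
    obtain ⟨e, ⟨he1, he2⟩, he0⟩ := ((h0.eventually (hΨ' hu)).and
      (h0.eventually (hYopen.mem_nhds hu)) |>.and self_mem_nhdsWithin).exists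
    have hact : active a (u + e • y k) = {k} := by
      rw [active_add_smul ⟨k, hk, by simp [hy]⟩ he0, hy]
      simpa using hk
    have := he1 he2
    rw [hcsingle hact, hconst k hact (hy k) he2 (hyY k)] at this
    exact this
  have h1 := hnear i hiu
  have h2 := hnear j hju
  have h3 := hφ u (hYΛ hu) i hiu j hju hij
  linarith

end Fan
end

/-! ### Facets and normals of a symmetric polytope -/

section

open Topology Module
variable {d : ℕ}

/-- `P` is a `d`-dimensional convex polytope in `ℝ^d` that is centrally symmetric about `0`. -/
structure IsSymmPolytope (P : Set (Euc d)) : Prop where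
  polytope : ∃ S : Set (Euc d), S.Finite ∧ P = convexHull ℝ S
  full_dim : (interior P).Nonempty
  centered : -P = P

lemma IsTiling.isSymmPolytope {P T : Set (Euc d)} (h : IsTiling P T) : IsSymmPolytope P :=
  ⟨h.polytope, h.full_dim, h.centered⟩

/-- A polytope has only finitely many faces: each of them is the convex hull of its extreme
points. -/
lemma finite_isExposed_convexHull {S : Set (Euc d)} (hS : S.Finite) :
    {G | IsExposed ℝ (convexHull ℝ S) G}.Finite := by
  have hc := hS.isCompact_convexHull (𝕜 := ℝ)
  refine Set.Finite.of_finite_image (f := fun G => G.extremePoints ℝ)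
    (hS.finite_subsets.subset ?_) ?_
  · rintro _ ⟨G, hG, rfl⟩
    exact (IsExposed.isExtreme hG).extremePoints_subset_extremePoints.trans
      extremePoints_convexHull_subset
  · intro G hG H hH h
    have key {G : Set (Euc d)} (hG : IsExposed ℝ (convexHull ℝ S) G) :
        closure (convexHull ℝ (G.extremePoints ℝ)) = G :=
      closure_convexHull_extremePoints (hG.isCompact hc) (hG.convex (convex_convexHull ℝ S))
    rw [← key hG, ← key hH]
    exact congrArg (fun A => closure (convexHull ℝ A)) h

/-- A point of the relative interior of `G` can be moved away from any point of `G`. -/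
lemma exists_add_smul_sub_mem {G : Set (Euc d)} {y g : Euc d} (hy : y ∈ intrinsicInterior ℝ G)
    (hg : g ∈ G) : ∃ e : ℝ, 0 < e ∧ y + e • (y - g) ∈ G := by
  obtain ⟨y, hy, rfl⟩ := mem_intrinsicInterior.1 hy
  let g' : affineSpan ℝ G := ⟨g, subset_affineSpan ℝ G hg⟩
  have : Nonempty (affineSpan ℝ G) := ⟨g'⟩
  let γ : ℝ → affineSpan ℝ G := fun e => AffineMap.lineMap y g' (-e)
  have hγ : Continuous γ := by
    refine Continuous.subtype_mk (f := fun e : ℝ => AffineMap.lineMap (y : Euc d) g (-e)) ?_ _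
    simp only [AffineMap.lineMap_apply]
    fun_prop
  have h0 : ∀ᶠ e in 𝓝[>] (0 : ℝ), γ e ∈ interior ((↑) ⁻¹' G : Set (affineSpan ℝ G)) := by
    refine Filter.Eventually.filter_mono nhdsWithin_le_nhds ?_
    refine hγ.continuousAt.eventually (isOpen_interior.mem_nhds ?_)
    simpa [γ] using hy
  obtain ⟨e, he, he0⟩ := (h0.and self_mem_nhdsWithin).exists
  refine ⟨e, he0, ?_⟩
  have h1 : γ e ∈ ((↑) ⁻¹' G : Set (affineSpan ℝ G)) := interior_subset he
  rw [Set.mem_preimage] at h1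
  have h2 : (γ e : Euc d) = AffineMap.lineMap (y : Euc d) g (-e) := rfl
  rw [h2, AffineMap.lineMap_apply] at h1
  convert! h1 using 1
  simp only [vsub_eq_sub, vadd_eq_add]
  module

/-- A linear functional that is bounded on `G` and attains its bound in the relative interior of `G`
is constant on `G`. -/
lemma inner_eq_of_mem_intrinsicInterior {G : Set (Euc d)} {a y g : Euc d} {r : ℝ}
    (hG : ∀ x ∈ G, inner ℝ a x ≤ r) (hy : y ∈ intrinsicInterior ℝ G) (hr : inner ℝ a y = r)
    (hg : g ∈ G) : inner ℝ a g = r := by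
  obtain ⟨e, he, h⟩ := exists_add_smul_sub_mem hy hg
  have h1 := hG _ h
  rw [inner_add_right, inner_smul_right, inner_sub_right, hr] at h1
  have h2 := hG g hg
  refine le_antisymm h2 ?_
  have : e * (r - inner ℝ a g) ≤ 0 := by linarith
  by_contra! hlt
  nlinarith [mul_pos he (sub_pos.2 hlt)]

lemma inner_vectorSpan_eq_zero {G : Set (Euc d)} {a : Euc d} {r : ℝ}
    (hG : ∀ x ∈ G, inner ℝ a x = r) {u : Euc d} (hu : u ∈ vectorSpan ℝ G) : inner ℝ a u = 0 := by
  rw [vectorSpan] at hu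
  induction hu using Submodule.span_induction with
  | mem x hx =>
    obtain ⟨y, hy, z, hz, rfl⟩ := hx
    simp [inner_sub_right, hG y hy, hG z hz]
  | zero => simp
  | add x y _ _ hx hy => rw [inner_add_right, hx, hy, add_zero]
  | smul r x _ hx => rw [inner_smul_right, hx, mul_zero]

namespace IsSymmPolytope
variable {P : Set (Euc d)} (hP : IsSymmPolytope P)
include hP

lemma convex : Convex ℝ P := by
  obtain ⟨S, -, rfl⟩ := hP.polytope
  exact convex_convexHull ℝ S

lemma isCompact : IsCompact P := by
  obtain ⟨S, hS, rfl⟩ := hP.polytope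
  exact hS.isCompact_convexHull (𝕜 := ℝ)

lemma neg_mem {x : Euc d} (hx : x ∈ P) : -x ∈ P := by
  rw [← hP.centered]; simpa using hx

lemma zero_mem_interior : (0 : Euc d) ∈ interior P := by
  obtain ⟨x, hx⟩ := hP.full_dim
  have hx' : -x ∈ interior P := by
    rw [← hP.centered]
    have := (Homeomorph.neg (Euc d)).image_interior P
    rw [Homeomorph.coe_neg, Set.image_neg_eq_neg, Set.image_neg_eq_neg] at this
    rw [← this]
    simpa using hx
  have := hP.convex.interior hx hx' (by norm_num : (0 : ℝ) ≤ 1 / 2) (by norm_num : (0 : ℝ) ≤ 1 / 2)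
    (by norm_num)
  simpa using this

lemma finite_isExposed : {G | IsExposed ℝ P G}.Finite := by
  obtain ⟨S, hS, rfl⟩ := hP.polytope
  exact finite_isExposed_convexHull hS

lemma finite_facet : Finite (Facet P) :=
  (hP.finite_isExposed.subset fun _ h => h.2.1).to_subtype

lemma exists_smul_mem (u : Euc d) : ∃ e : ℝ, 0 < e ∧ e • u ∈ P := by
  have hc : Continuous fun e : ℝ => e • u := by fun_prop
  have : ∀ᶠ e in 𝓝[>] (0 : ℝ), e • u ∈ interior P := by
    refine Filter.Eventually.filter_mono nhdsWithin_le_nhds ?_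
    exact hc.continuousAt.eventually
      (isOpen_interior.mem_nhds (by simpa using hP.zero_mem_interior))
  obtain ⟨e, he, he0⟩ := (this.and self_mem_nhdsWithin).exists
  exact ⟨e, he0, interior_subset he⟩

lemma exists_normal (F : Facet P) : ∃ a : Euc d, F.1 = {x ∈ P | inner ℝ a x = 1} ∧
    ∀ x ∈ P, inner ℝ a x ≤ 1 := by
  obtain ⟨F, ⟨x₀, hx₀⟩, hF, hdim⟩ := F
  obtain ⟨l, hl⟩ := hF ⟨x₀, hx₀⟩
  obtain ⟨b, rfl⟩ := (InnerProductSpace.toDual ℝ (Euc d)).surjective l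
  simp only [InnerProductSpace.toDual_apply_apply] at hl
  have hx₀' := hx₀
  rw [hl] at hx₀'
  obtain ⟨hx₀P, hmax⟩ := hx₀'
  have hb : b ≠ 0 := by
    rintro rfl
    have : F = P := by rw [hl]; ext x; simp
    rw [this] at hdim
    have h1 : vectorSpan ℝ P = ⊤ := by
      have := affineSpan_eq_top_of_nonempty_interior (s := P) (by
        rw [hP.convex.convexHull_eq]; exact hP.full_dim)
      rw [← direction_affineSpan, this, AffineSubspace.direction_top]
    rw [h1, finrank_top, finrank_euclideanSpace_fin] at hdim
    omega
  have hM : 0 < inner ℝ b x₀ := by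
    obtain ⟨e, he, heP⟩ := hP.exists_smul_mem b
    have := hmax _ heP
    rw [inner_smul_right] at this
    have h2 : 0 < inner ℝ b b := real_inner_self_pos.2 hb
    exact (mul_pos he h2).trans_le this
  refine ⟨(inner ℝ b x₀)⁻¹ • b, ?_, fun x hx => ?_⟩
  · ext x
    change x ∈ F ↔ _
    rw [hl]
    simp only [Set.mem_sep_iff, real_inner_smul_left]
    refine and_congr_right fun hx => ⟨fun h => ?_, fun h y hy => ?_⟩
    · rw [le_antisymm (hmax x hx) (h x₀ hx₀P), inv_mul_cancel₀ hM.ne']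
    · rw [inv_mul_eq_one₀ hM.ne'] at h
      rw [← h]
      exact hmax y hy
  · rw [real_inner_smul_left, inv_mul_le_one₀ hM]
    exact hmax x hx

end IsSymmPolytope

open Classical in
/-- The outer normal vector `a` of a facet of a polytope, normalised so that the facet is
supported by the hyperplane `⟪a, x⟫ = 1`. -/
def normal {P : Set (Euc d)} (F : Facet P) : Euc d :=
  if h : ∃ a : Euc d, F.1 = {x ∈ P | inner ℝ a x = 1} ∧ ∀ x ∈ P, inner ℝ a x ≤ 1
  then h.choose else 0

lemma Facet.subset {P : Set (Euc d)} (F : Facet P) : F.1 ⊆ P := F.2.2.1.subset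

lemma eventually_inner_lt {P : Set (Euc d)} {x : Euc d} {F : Facet P}
    (h : inner ℝ (normal F) x < 1) :
    ∀ᶠ y in 𝓝 x, inner ℝ (normal F) y < 1 := by
  have hc : Continuous fun y => inner ℝ (normal F) y := by fun_prop
  exact hc.continuousAt.eventually (gt_mem_nhds h)

/-- The facets through a point. -/
def facetsAt (P : Set (Euc d)) (x : Euc d) : Set (Facet P) := {F | x ∈ F.1}

/-- The smallest face of `P` that contains the point `x` of `P`. -/
def faceOf (P : Set (Euc d)) (x : Euc d) : Set (Euc d) := {y ∈ P | facetsAt P x ⊆ facetsAt P y}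

namespace IsSymmPolytope
variable {P : Set (Euc d)} (hP : IsSymmPolytope P)
include hP

lemma normal_spec (F : Facet P) : F.1 = {x ∈ P | inner ℝ (normal F) x = 1} ∧
    ∀ x ∈ P, inner ℝ (normal F) x ≤ 1 := by
  have h := hP.exists_normal F
  rw [normal, dif_pos h]
  exact h.choose_spec

lemma inner_normal_le (F : Facet P) {x : Euc d} (hx : x ∈ P) : inner ℝ (normal F) x ≤ 1 :=
  (hP.normal_spec F).2 x hx

lemma mem_facet_iff {F : Facet P} {x : Euc d} : x ∈ F.1 ↔ x ∈ P ∧ inner ℝ (normal F) x = 1 := by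
  have := (hP.normal_spec F).1
  rw [Set.ext_iff] at this
  exact this x

lemma eq_of_normal_eq {F F' : Facet P} (h : normal F = normal F') : F = F' := by
  apply Subtype.ext
  rw [(hP.normal_spec F).1, (hP.normal_spec F').1, h]

/-- A polytope is the intersection of the half-spaces of its facets: the segment from a generic
interior point to a point outside of the polytope leaves the polytope through a facet. -/
lemma mem_of_forall_inner_normal_le {z : Euc d} (hz : ∀ F : Facet P, inner ℝ (normal F) z ≤ 1) :
    z ∈ P := by
  by_contra hzP
  let K := {G : Set (Euc d) // IsExposed ℝ P G ∧ G.Nonempty ∧ finrank ℝ (vectorSpan ℝ G) + 2 ≤ d}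
  have : Finite K := (hP.finite_isExposed.subset fun _ h => h.1).to_subtype
  choose g hg using fun G : K => G.2.2.1
  -- For `p` off these subspaces the segment from `p` to `z` avoids all faces of codimension at
  -- least two, so the face at which it leaves `P` is a facet.
  let W : K → Submodule ℝ (Euc d) := fun G => vectorSpan ℝ G.1 ⊔ Submodule.span ℝ {g G - z}
  have hW (G : K) : W G ≠ ⊤ := by
    apply ne_top_of_finrank_lt
    have h1 := finrank_sup_span_singleton_le (vectorSpan ℝ G.1) (g G - z)
    have h2 := G.2.2.2
    rw [finrank_euclideanSpace_fin]
    change finrank ℝ (W G) ≤ _ at h1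
    omega
  obtain ⟨p, hp, hpW⟩ := exists_mem_open_forall_sub_notMem W hW (fun _ => z) isOpen_interior
    hP.full_dim
  let γ : ℝ → Euc d := fun t => (1 - t) • p + t • z
  have hγ : Continuous γ := by fun_prop
  have hcomp : IsCompact (Set.Icc (0 : ℝ) 1 ∩ γ ⁻¹' P) :=
    isCompact_Icc.inter_right (hP.isCompact.isClosed.preimage hγ)
  obtain ⟨t, ⟨⟨ht0, ht1⟩, htP⟩, hmax⟩ := hcomp.exists_isGreatest
    ⟨0, by simp, by simpa [γ] using interior_subset hp⟩
  have ht1' : t < 1 := by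
    refine lt_of_le_of_ne ht1 ?_
    rintro rfl
    exact hzP (by simpa [γ] using htP)
  have hint : γ t ∉ interior P := by
    intro hmem
    have h1 : ∀ᶠ s in 𝓝[>] t, γ s ∈ interior P ∧ s < 1 := by
      refine Filter.Eventually.filter_mono nhdsWithin_le_nhds ?_
      exact (hγ.continuousAt.eventually (isOpen_interior.mem_nhds hmem)).and (gt_mem_nhds ht1')
    obtain ⟨s, ⟨hs, hs1⟩, hst⟩ := (h1.and self_mem_nhdsWithin).exists
    have : s ≤ t := hmax ⟨⟨ht0.trans (le_of_lt hst), hs1.le⟩, show γ s ∈ P from interior_subset hs⟩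
    exact absurd hst (not_lt.2 this)
  obtain ⟨f, hf⟩ := geometric_hahn_banach_open_point hP.convex.interior isOpen_interior hint
  have hfP : ∀ x ∈ P, f x ≤ f (γ t) := by
    intro x hx
    have h1 : P ⊆ closure (interior P) := by
      rw [hP.convex.closure_interior_eq_closure_of_nonempty_interior hP.full_dim]
      exact subset_closure
    exact closure_minimal (fun y hy => (hf y hy).le) (isClosed_le f.continuous continuous_const)
      (h1 hx)
  let B := f.toExposed P
  have hB : IsExposed ℝ P B := ContinuousLinearMap.toExposed.isExposed
  have htB : γ t ∈ B := ⟨htP, hfP⟩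
  have hBf : ∀ x ∈ B, f x = f (γ t) := fun x hx => le_antisymm (hfP x hx.1) (hx.2 _ htP)
  have hdim : finrank ℝ (vectorSpan ℝ B) + 1 ≤ d := by
    have hle : vectorSpan ℝ B ≤ LinearMap.ker (f : Euc d →ₗ[ℝ] ℝ) := by
      rw [vectorSpan, Submodule.span_le]
      rintro _ ⟨x, hx, y, hy, rfl⟩
      simp [hBf x hx, hBf y hy]
    have hne : vectorSpan ℝ B ≠ ⊤ := by
      intro htop
      rw [htop] at hle
      have : f (γ t - p) = 0 := hle Submodule.mem_top
      rw [map_sub] at this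
      have := hf p hp
      linarith
    have := Submodule.finrank_lt hne
    rw [finrank_euclideanSpace_fin] at this
    omega
  by_cases hd : finrank ℝ (vectorSpan ℝ B) + 1 = d
  · let F : Facet P := ⟨B, ⟨_, htB⟩, hB, hd⟩
    have h1 := (hP.mem_facet_iff (F := F)).1 htB
    have h2 : inner ℝ (normal F) p < 1 := by
      refine lt_of_le_of_ne (hP.inner_normal_le F (interior_subset hp)) fun h => ?_
      have : p ∈ B := (hP.mem_facet_iff (F := F)).2 ⟨interior_subset hp, h⟩
      have h3 := hBf p this
      have h4 := hf p hp
      linarith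
    have h3 := h1.2
    simp only [γ, inner_add_right, inner_smul_right] at h3
    have h4 := hz F
    nlinarith
  · let G : K := ⟨B, hB, ⟨_, htB⟩, by omega⟩
    refine hpW G ?_
    have h1 : (1 - t) ≠ 0 := by linarith
    have : p - z = (1 - t)⁻¹ • (γ t - g G) + (1 - t)⁻¹ • (g G - z) := by
      have : (1 - t) • (p - z) = γ t - z := by simp only [γ]; module
      rw [← smul_add, sub_add_sub_cancel, ← this, smul_smul, inv_mul_cancel₀ h1, one_smul]
    rw [this]
    exact Submodule.add_mem_sup (Submodule.smul_mem _ _ (vsub_mem_vectorSpan ℝ htB (hg G)))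
      (Submodule.smul_mem _ _ (Submodule.mem_span_singleton_self _))

lemma mem_iff {z : Euc d} : z ∈ P ↔ ∀ F : Facet P, inner ℝ (normal F) z ≤ 1 :=
  ⟨fun h F => hP.inner_normal_le F h, hP.mem_of_forall_inner_normal_le⟩

lemma mem_frontier_iff {x : Euc d} : x ∈ frontier P ↔ x ∈ P ∧ (facetsAt P x).Nonempty := by
  have := hP.finite_facet
  rw [hP.isCompact.isClosed.frontier_eq, Set.mem_sdiff]
  refine and_congr_right fun hx => ⟨fun h => ?_, ?_⟩
  · by_contra hcon
    refine h (mem_interior_iff_mem_nhds.2 ?_)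
    have h1 (F : Facet P) : ∀ᶠ y in 𝓝 x, inner ℝ (normal F) y < 1 := by
      refine eventually_inner_lt (lt_of_le_of_ne (hP.inner_normal_le F hx) fun h => ?_)
      exact hcon ⟨F, hP.mem_facet_iff.2 ⟨hx, h⟩⟩
    filter_upwards [Filter.eventually_all.2 h1] with y hy
    exact hP.mem_of_forall_inner_normal_le fun F => (hy F).le
  · rintro ⟨F, hF⟩ hint
    have h1 := (hP.mem_facet_iff.1 hF).2
    have hc : Continuous fun e : ℝ => x + e • normal F := by fun_prop
    have : ∀ᶠ e in 𝓝[>] (0 : ℝ), x + e • normal F ∈ interior P := by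
      refine Filter.Eventually.filter_mono nhdsWithin_le_nhds ?_
      exact hc.continuousAt.eventually
        (isOpen_interior.mem_nhds (by simpa using hint))
    obtain ⟨e, he, he0⟩ := (this.and self_mem_nhdsWithin).exists
    have h2 := hP.inner_normal_le F (interior_subset he)
    rw [inner_add_right, inner_smul_right, h1] at h2
    have h3 : 0 < inner ℝ (normal F) (normal F) := by
      refine real_inner_self_pos.2 fun h => ?_
      simp [h] at h1
    nlinarith [mul_pos (show (0 : ℝ) < e from he0) h3]

end IsSymmPolytope
end

/-! ### Faces and the facets at a point -/

section

open Topology Module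
variable {d : ℕ}

lemma mem_span_orthogonal_iff {S : Set (Euc d)} {u : Euc d} :
    u ∈ (Submodule.span ℝ S)ᗮ ↔ ∀ a ∈ S, inner ℝ a u = 0 := by
  rw [Submodule.mem_orthogonal]
  refine ⟨fun h a ha => h a (Submodule.subset_span ha), fun h a ha => ?_⟩
  induction ha using Submodule.span_induction with
  | mem x hx => exact h x hx
  | zero => simp
  | add x y _ _ hx hy => rw [inner_add_left, hx, hy, add_zero]
  | smul r x _ hx => rw [real_inner_smul_left, hx, mul_zero]

/-- The codimension of the smallest face of `P` that contains `x`. -/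
def codimAt (P : Set (Euc d)) (x : Euc d) : ℕ :=
  finrank ℝ (Submodule.span ℝ (normal '' facetsAt P x))

/-- The normal vectors of the facets through `x`. -/
def localFan (P : Set (Euc d)) (x : Euc d) : facetsAt P x → Euc d := fun F => normal F.1

lemma self_mem_faceOf {P : Set (Euc d)} {x : Euc d} (hx : x ∈ P) : x ∈ faceOf P x :=
  ⟨hx, Set.Subset.rfl⟩

namespace IsSymmPolytope
variable {P : Set (Euc d)} (hP : IsSymmPolytope P)
include hP

lemma mem_facetsAt_iff {F : Facet P} {x : Euc d} (hx : x ∈ P) :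
    F ∈ facetsAt P x ↔ inner ℝ (normal F) x = 1 := by
  rw [facetsAt, Set.mem_ofPred_eq, hP.mem_facet_iff, and_iff_right hx]

lemma inner_lt_of_notMem {F : Facet P} {x : Euc d} (hx : x ∈ P) (hF : F ∉ facetsAt P x) :
    inner ℝ (normal F) x < 1 :=
  lt_of_le_of_ne (hP.inner_normal_le F hx) fun h => hF ((hP.mem_facetsAt_iff hx).2 h)

lemma eventually_inner_lt_of_notMem {x : Euc d} (hx : x ∈ P) :
    ∀ᶠ y in 𝓝 x, ∀ F : Facet P, F ∉ facetsAt P x → inner ℝ (normal F) y < 1 := by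
  have := hP.finite_facet
  refine Filter.eventually_all.2 fun F => ?_
  by_cases hF : F ∈ facetsAt P x
  · exact Filter.Eventually.of_forall fun y h => absurd hF h
  · filter_upwards [eventually_inner_lt (hP.inner_lt_of_notMem hx hF)] with y hy _ using hy

lemma isExposed_faceOf {x : Euc d} (hx : x ∈ P) : IsExposed ℝ P (faceOf P x) := by
  classical
  have := hP.finite_facet
  have := Fintype.ofFinite (Facet P)
  intro _
  let s : Finset (Facet P) := Finset.univ.filter fun F => F ∈ facetsAt P x
  let l : StrongDual ℝ (Euc d) := InnerProductSpace.toDual ℝ (Euc d) (∑ F ∈ s, normal F)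
  have hl (y : Euc d) : l y = ∑ F ∈ s, inner ℝ (normal F) y := by
    simp only [l, InnerProductSpace.toDual_apply_apply, sum_inner]
  have hlx : l x = ∑ F ∈ s, (1 : ℝ) := by
    rw [hl]
    refine Finset.sum_congr rfl fun F hF => ?_
    exact (hP.mem_facetsAt_iff hx).1 (Finset.mem_filter.1 hF).2
  have hle {y : Euc d} (hy : y ∈ P) : l y ≤ l x := by
    rw [hlx, hl]
    exact Finset.sum_le_sum fun F _ => hP.inner_normal_le F hy
  refine ⟨l, Set.ext fun y => and_congr_right fun hy => ⟨fun h z hz => ?_, fun h => ?_⟩⟩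
  · refine (hle hz).trans ?_
    rw [hlx, hl]
    refine Finset.sum_le_sum fun F hF => ?_
    rw [(hP.mem_facetsAt_iff hy).1 (h (Finset.mem_filter.1 hF).2)]
  · intro F hF
    have h1 := le_antisymm (hle hy) (h x hx)
    rw [hlx, hl] at h1
    have h2 := (Finset.sum_eq_sum_iff_of_le fun F _ => hP.inner_normal_le F hy).1 h1 F
      (Finset.mem_filter.2 ⟨Finset.mem_univ _, hF⟩)
    exact (hP.mem_facetsAt_iff hy).2 h2

lemma inner_eq_one_of_mem_faceOf {x y : Euc d} (hy : y ∈ faceOf P x) {F : Facet P}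
    (hF : F ∈ facetsAt P x) : inner ℝ (normal F) y = 1 :=
  (hP.mem_facetsAt_iff hy.1).1 (hy.2 hF)

lemma vectorSpan_faceOf {x : Euc d} (hx : x ∈ P) :
    vectorSpan ℝ (faceOf P x) = (Submodule.span ℝ (normal '' facetsAt P x))ᗮ := by
  refine le_antisymm (fun u hu => ?_) fun u hu => ?_
  · rw [mem_span_orthogonal_iff]
    rintro _ ⟨F, hF, rfl⟩
    exact inner_vectorSpan_eq_zero (fun y hy => hP.inner_eq_one_of_mem_faceOf hy hF) hu
  · rw [mem_span_orthogonal_iff] at hu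
    have hc : Continuous fun e : ℝ => x + e • u := by fun_prop
    have h0 : Filter.Tendsto (fun e : ℝ => x + e • u) (𝓝[>] 0) (𝓝 x) := by
      have := hc.tendsto 0
      simp only [zero_smul, add_zero] at this
      exact this.mono_left nhdsWithin_le_nhds
    obtain ⟨e, he, he0⟩ := ((h0.eventually (hP.eventually_inner_lt_of_notMem hx)).and
      self_mem_nhdsWithin).exists
    have h1 (F : Facet P) (hF : F ∈ facetsAt P x) : inner ℝ (normal F) (x + e • u) = 1 := by
      rw [inner_add_right, inner_smul_right, hu _ ⟨F, hF, rfl⟩, (hP.mem_facetsAt_iff hx).1 hF]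
      simp
    have hmem : x + e • u ∈ P := by
      rw [hP.mem_iff]
      intro F
      by_cases hF : F ∈ facetsAt P x
      · exact (h1 F hF).le
      · exact (he F hF).le
    have h2 : x + e • u ∈ faceOf P x :=
      ⟨hmem, fun F hF => (hP.mem_facetsAt_iff hmem).2 (h1 F hF)⟩
    have h3 : u = e⁻¹ • ((x + e • u) -ᵥ x) := by
      rw [vsub_eq_sub, add_sub_cancel_left, smul_smul, inv_mul_cancel₀ (ne_of_gt he0), one_smul]
    rw [h3]
    exact Submodule.smul_mem _ _ (vsub_mem_vectorSpan ℝ h2 (self_mem_faceOf hx))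

lemma mem_intrinsicInterior_faceOf {x : Euc d} (hx : x ∈ P) :
    x ∈ intrinsicInterior ℝ (faceOf P x) := by
  have hxG := self_mem_faceOf hx
  refine mem_intrinsicInterior.2 ⟨⟨x, subset_affineSpan ℝ _ hxG⟩, ?_, rfl⟩
  rw [mem_interior_iff_mem_nhds]
  filter_upwards [continuous_subtype_val.continuousAt.eventually
    (hP.eventually_inner_lt_of_notMem hx)] with z hz
  have h1 (F : Facet P) (hF : F ∈ facetsAt P x) : inner ℝ (normal F) (z : Euc d) = 1 := by
    have h2 : (z : Euc d) -ᵥ x ∈ vectorSpan ℝ (faceOf P x) := by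
      rw [← direction_affineSpan]
      exact AffineSubspace.vsub_mem_direction z.2 (subset_affineSpan ℝ _ hxG)
    rw [hP.vectorSpan_faceOf hx, mem_span_orthogonal_iff] at h2
    have h3 := h2 _ ⟨F, hF, rfl⟩
    rw [vsub_eq_sub, inner_sub_right, (hP.mem_facetsAt_iff hx).1 hF] at h3
    linarith
  have hmem : (z : Euc d) ∈ P := by
    rw [hP.mem_iff]
    intro F
    by_cases hF : F ∈ facetsAt P x
    · exact (h1 F hF).le
    · exact (hz F hF).le
  exact ⟨hmem, fun F hF => (hP.mem_facetsAt_iff hmem).2 (h1 F hF)⟩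

lemma facetsAt_subset_of_mem_intrinsicInterior {G : Set (Euc d)} (hG : G ⊆ P) {x y : Euc d}
    (hx : x ∈ intrinsicInterior ℝ G) (hy : y ∈ G) : facetsAt P x ⊆ facetsAt P y := by
  intro F hF
  have hxP := hG (intrinsicInterior_subset hx)
  exact (hP.mem_facetsAt_iff (hG hy)).2 (inner_eq_of_mem_intrinsicInterior
    (fun z hz => hP.inner_normal_le F (hG hz)) hx ((hP.mem_facetsAt_iff hxP).1 hF) hy)

lemma faceOf_subset {G : Set (Euc d)} (hG : IsExposed ℝ P G) {x : Euc d} (hx : x ∈ G) :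
    faceOf P x ⊆ G := by
  intro y hy
  obtain ⟨l, hl⟩ := hG ⟨x, hx⟩
  rw [hl] at hx ⊢
  obtain ⟨e, he, h⟩ := exists_add_smul_sub_mem (hP.mem_intrinsicInterior_faceOf hx.1) hy
  have h1 := hx.2 _ h.1
  rw [map_add, map_smul, map_sub, smul_eq_mul] at h1
  have h2 : l x ≤ l y := by
    by_contra! hlt
    nlinarith [mul_pos he (sub_pos.2 hlt)]
  exact ⟨hy.1, fun z hz => (hx.2 z hz).trans h2⟩

/-- Every face is the smallest face of each point of its relative interior. -/
lemma eq_faceOf {G : Set (Euc d)} (hG : IsExposed ℝ P G) {x : Euc d}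
    (hx : x ∈ intrinsicInterior ℝ G) : G = faceOf P x :=
  Set.Subset.antisymm (fun _ hy => ⟨hG.subset hy,
    hP.facetsAt_subset_of_mem_intrinsicInterior hG.subset hx hy⟩)
    (hP.faceOf_subset hG (intrinsicInterior_subset hx))

lemma mem_intrinsicInterior_faceOf_iff {x y : Euc d} (hx : x ∈ P) :
    y ∈ intrinsicInterior ℝ (faceOf P x) ↔ y ∈ P ∧ facetsAt P y = facetsAt P x := by
  constructor
  · intro hy
    have h1 := intrinsicInterior_subset hy
    exact ⟨h1.1, Set.Subset.antisymm (hP.facetsAt_subset_of_mem_intrinsicInterior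
      (fun _ h => h.1) hy (self_mem_faceOf hx)) h1.2⟩
  · rintro ⟨hy, h⟩
    have : faceOf P x = faceOf P y := by rw [faceOf, faceOf, h]
    rw [this]
    exact hP.mem_intrinsicInterior_faceOf hy

lemma isFaceOfCodim_faceOf_iff {x : Euc d} (hx : x ∈ P) {j : ℕ} :
    IsFaceOfCodim P j (faceOf P x) ↔ codimAt P x = j := by
  have h1 := (Submodule.span ℝ (normal '' facetsAt P x)).finrank_add_finrank_orthogonal
  rw [← hP.vectorSpan_faceOf hx, finrank_euclideanSpace_fin] at h1
  change codimAt P x + _ = d at h1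
  constructor
  · rintro ⟨-, -, h⟩
    omega
  · rintro rfl
    exact ⟨⟨x, self_mem_faceOf hx⟩, hP.isExposed_faceOf hx, by omega⟩

lemma intrinsicInterior_nonempty {j : ℕ} {G : Set (Euc d)} (hG : IsFaceOfCodim P j G) :
    (intrinsicInterior ℝ G).Nonempty :=
  hG.1.intrinsicInterior (hG.2.1.convex hP.convex)

lemma exists_eq_faceOf {j : ℕ} {G : Set (Euc d)} (hG : IsFaceOfCodim P j G) :
    ∃ x ∈ P, G = faceOf P x ∧ codimAt P x = j := by
  obtain ⟨x, hx⟩ := hP.intrinsicInterior_nonempty hG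
  have hxP := hG.2.1.subset (intrinsicInterior_subset hx)
  have h := hP.eq_faceOf hG.2.1 hx
  refine ⟨x, hxP, h, ?_⟩
  rw [h] at hG
  exact (hP.isFaceOfCodim_faceOf_iff hxP).1 hG

lemma normal_ne_zero (F : Facet P) : normal F ≠ 0 := by
  intro h
  obtain ⟨x, hx⟩ := F.2.1
  have := (hP.mem_facet_iff.1 hx).2
  simp [h] at this

lemma eq_of_codimAt_eq_one {x : Euc d} (hx : x ∈ P) (h : codimAt P x ≤ 1) {F F' : Facet P}
    (hF : F ∈ facetsAt P x) (hF' : F' ∈ facetsAt P x) : F = F' := by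
  have h1 : normal F' ∈ Submodule.span ℝ {normal F} := by
    have hle : Submodule.span ℝ {normal F} ≤ Submodule.span ℝ (normal '' facetsAt P x) := by
      rw [Submodule.span_singleton_le_iff_mem]
      exact Submodule.subset_span ⟨F, hF, rfl⟩
    rw [Submodule.eq_of_le_of_finrank_le hle
      (by rw [finrank_span_singleton (hP.normal_ne_zero F)]; exact h)]
    exact Submodule.subset_span ⟨F', hF', rfl⟩
  obtain ⟨c, hc⟩ := Submodule.mem_span_singleton.1 h1
  have h2 := (hP.mem_facetsAt_iff hx).1 hF
  have h3 := (hP.mem_facetsAt_iff hx).1 hF'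
  rw [← hc, real_inner_smul_left, h2, mul_one] at h3
  rw [h3, one_smul] at hc
  exact hP.eq_of_normal_eq hc

lemma mem_intrinsicInterior_facet_iff {F : Facet P} {y : Euc d} :
    y ∈ intrinsicInterior ℝ F.1 ↔ y ∈ P ∧ facetsAt P y = {F} := by
  obtain ⟨x, hx, hF, hc⟩ := hP.exists_eq_faceOf F.2
  have hFx : F ∈ facetsAt P x := by
    change x ∈ F.1
    rw [hF]
    exact self_mem_faceOf hx
  have h1 : facetsAt P x = {F} := Set.eq_singleton_iff_unique_mem.2
    ⟨hFx, fun F' hF' => hP.eq_of_codimAt_eq_one hx hc.le hF' hFx⟩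
  rw [hF, hP.mem_intrinsicInterior_faceOf_iff hx, h1]

lemma exists_facetsAt_eq_singleton (F : Facet P) : ∃ x ∈ P, facetsAt P x = {F} := by
  obtain ⟨x, hx⟩ := hP.intrinsicInterior_nonempty F.2
  exact ⟨x, hP.mem_intrinsicInterior_facet_iff.1 hx⟩

lemma mem_active_localFan_iff {x y : Euc d} (hy : y ∈ P)
    (h : (facetsAt P x ∩ facetsAt P y).Nonempty) {F : facetsAt P x} :
    F ∈ active (localFan P x) y ↔ F.1 ∈ facetsAt P y := by
  obtain ⟨F₀, hx₀, hy₀⟩ := h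
  rw [hP.mem_facetsAt_iff hy]
  constructor
  · intro hF
    have h1 := hF ⟨F₀, hx₀⟩
    exact le_antisymm (hP.inner_normal_le _ hy) (((hP.mem_facetsAt_iff hy).1 hy₀).symm.le.trans h1)
  · intro hF F'
    exact (hP.inner_normal_le _ hy).trans hF.symm.le

lemma irredundant_localFan (x : Euc d) : Irredundant (localFan P x) := by
  intro F
  obtain ⟨y, hy, h⟩ := hP.exists_facetsAt_eq_singleton F.1
  refine ⟨y, Set.ext fun F' => ?_⟩
  rw [hP.mem_active_localFan_iff hy ⟨F.1, F.2, by simp [h]⟩, h]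
  simp [Subtype.ext_iff]

/-- The fan of the facets at `x` describes the faces of `P` around `x`. -/
lemma exists_facetsAt_eq_image_active {x : Euc d} (hx : x ∈ P) (hne : (facetsAt P x).Nonempty)
    (z : Euc d) : ∃ y ∈ P, facetsAt P y = Subtype.val '' active (localFan P x) z := by
  have := hP.finite_facet
  have : Nonempty (facetsAt P x) := hne.to_subtype
  obtain ⟨F₀, hF₀⟩ := active_nonempty (a := localFan P x) z
  let m : ℝ → ℝ := fun e => 1 + e * inner ℝ (normal F₀.1) z
  have hm : ContinuousAt m 0 := by fun_prop
  have hm0 : m 0 = 1 := by simp [m]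
  have h1 : ∀ᶠ e in 𝓝[>] (0 : ℝ), 0 < m e ∧
      ∀ F : Facet P, F ∉ facetsAt P x → inner ℝ (normal F) (x + e • z) < m e := by
    refine Filter.Eventually.filter_mono nhdsWithin_le_nhds ?_
    refine (hm.eventually (lt_mem_nhds (by rw [hm0]; exact one_pos))).and
      (Filter.eventually_all.2 fun F => ?_)
    by_cases hF : F ∈ facetsAt P x
    · exact Filter.Eventually.of_forall fun y h => absurd hF h
    · have hc : ContinuousAt (fun e : ℝ => m e - inner ℝ (normal F) (x + e • z)) 0 := by
        fun_prop
      have h0 : 0 < m 0 - inner ℝ (normal F) (x + (0 : ℝ) • z) := by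
        rw [hm0, zero_smul, add_zero]
        exact sub_pos.2 (hP.inner_lt_of_notMem hx hF)
      filter_upwards [hc.eventually (lt_mem_nhds h0)] with e he _
      linarith
  obtain ⟨e, ⟨hme, he⟩, he0⟩ := (h1.and self_mem_nhdsWithin).exists
  replace he0 : 0 < e := he0
  have hval (F : facetsAt P x) : inner ℝ (normal F.1) (x + e • z) =
      1 + e * inner ℝ (normal F.1) z := by
    rw [inner_add_right, inner_smul_right, (hP.mem_facetsAt_iff hx).1 F.2]
  have hle (F : Facet P) : inner ℝ (normal F) (x + e • z) ≤ m e := by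
    by_cases hF : F ∈ facetsAt P x
    · rw [hval ⟨F, hF⟩]
      have := hF₀ ⟨F, hF⟩
      change inner ℝ (normal F) z ≤ inner ℝ (normal F₀.1) z at this
      simp only [m]
      gcongr
    · exact (he F hF).le
  have hy : (m e)⁻¹ • (x + e • z) ∈ P := by
    rw [hP.mem_iff]
    intro F
    rw [inner_smul_right, inv_mul_le_one₀ hme]
    exact hle F
  refine ⟨_, hy, Set.ext fun F => ?_⟩
  rw [hP.mem_facetsAt_iff hy, inner_smul_right, inv_mul_eq_one₀ hme.ne', Set.mem_image]
  constructor
  · intro h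
    by_cases hF : F ∈ facetsAt P x
    · refine ⟨⟨F, hF⟩, fun F' => ?_, rfl⟩
      have h2 := hle F'.1
      rw [h, hval ⟨F, hF⟩, hval F'] at h2
      exact le_of_mul_le_mul_left (show e * inner ℝ (normal F'.1) z ≤ e * inner ℝ (normal F) z by
        linarith) he0
    · exact absurd h (he F hF).ne'
  · rintro ⟨F, hF, rfl⟩
    rw [hval F]
    have : inner ℝ (normal F.1) z = inner ℝ (normal F₀.1) z :=
      active_eq_of_mem (a := localFan P x) hF hF₀
    rw [this]

end IsSymmPolytope
end

/-! ### Faces of codimension two and three -/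

section

open Topology Module
variable {d : ℕ}

lemma faceOf_eq_inter {P : Set (Euc d)} {x : Euc d} {F F' : Facet P} (h : facetsAt P x = {F, F'}) :
    faceOf P x = F.1 ∩ F'.1 := by
  ext y
  simp only [faceOf, h, Set.mem_ofPred_eq, Set.insert_subset_iff, Set.singleton_subset_iff]
  exact ⟨fun ⟨_, h1, h2⟩ => ⟨h1, h2⟩, fun ⟨h1, h2⟩ => ⟨F.subset h1, h1, h2⟩⟩

namespace IsSymmPolytope
variable {P : Set (Euc d)} (hP : IsSymmPolytope P)
include hP

lemma irredundant_normal : Irredundant (normal : Facet P → Euc d) := by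
  intro F
  obtain ⟨y, hy, h⟩ := hP.exists_facetsAt_eq_singleton F
  have hF := (hP.mem_facetsAt_iff hy (F := F)).1 (by simp [h])
  refine ⟨y, Set.eq_singleton_iff_unique_mem.2 ⟨fun F' => ?_, fun F' hF' => ?_⟩⟩
  · rw [hF]; exact hP.inner_normal_le F' hy
  · have h1 : F' ∈ facetsAt P y := (hP.mem_facetsAt_iff hy).2
      (le_antisymm (hP.inner_normal_le F' hy) (hF.symm.le.trans (hF' F)))
    rwa [h] at h1

lemma linearIndependent_pair {x : Euc d} (hx : x ∈ P) {F F' : Facet P} (hne : F ≠ F')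
    (hF : F ∈ facetsAt P x) (hF' : F' ∈ facetsAt P x) :
    LinearIndependent ℝ ![normal F, normal F'] := by
  rw [LinearIndependent.pair_iff]
  intro s t h
  have h1 := congrArg (fun v => inner ℝ v x) h
  simp only [inner_add_left, real_inner_smul_left, inner_zero_left,
    (hP.mem_facetsAt_iff hx).1 hF, (hP.mem_facetsAt_iff hx).1 hF'] at h1
  have h2 : s = -t := by linarith
  subst h2
  have h3 : t • (normal F' - normal F) = 0 := by rw [← h]; module
  rw [smul_eq_zero, or_iff_left (hP.irredundant_normal.sub_ne_zero hne)] at h3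
  simp [h3]

lemma finrank_span_pair {x : Euc d} (hx : x ∈ P) {F F' : Facet P} (hne : F ≠ F')
    (hF : F ∈ facetsAt P x) (hF' : F' ∈ facetsAt P x) :
    finrank ℝ (Submodule.span ℝ {normal F, normal F'}) = 2 := by
  have h2 := finrank_span_eq_card (hP.linearIndependent_pair hx hne hF hF')
  rwa [Matrix.range_cons, Matrix.range_cons, Matrix.range_empty, Set.union_empty,
      Set.singleton_union, Fintype.card_fin] at h2

/-- A point in a face of codimension at most two lies on at most two facets. -/
lemma eq_or_eq_of_codimAt_le_two {x : Euc d} (hx : x ∈ P) (h : codimAt P x ≤ 2)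
    {F F' F'' : Facet P} (hne : F ≠ F') (hF : F ∈ facetsAt P x) (hF' : F' ∈ facetsAt P x)
    (hF'' : F'' ∈ facetsAt P x) : F'' = F ∨ F'' = F' := by
  by_contra! hcon
  have h1 := finrank_span_eq_card
    (hP.irredundant_normal.linearIndependent hne hcon.1.symm hcon.2.symm)
  rw [Matrix.range_cons, Matrix.range_cons, Matrix.range_empty, Set.union_empty,
      Set.singleton_union, Fintype.card_fin] at h1
  have hmem {G : Facet P} (hG : G ∈ facetsAt P x) :
      normal G ∈ Submodule.span ℝ (normal '' facetsAt P x) := Submodule.subset_span ⟨G, hG, rfl⟩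
  have hle : Submodule.span ℝ {normal F' - normal F, normal F'' - normal F} ≤
      Submodule.span ℝ (normal '' facetsAt P x) := by
    rw [Submodule.span_le]
    rintro _ (rfl | rfl)
    · exact Submodule.sub_mem _ (hmem hF') (hmem hF)
    · exact Submodule.sub_mem _ (hmem hF'') (hmem hF)
  have h2 := hmem hF
  rw [← Submodule.eq_of_le_of_finrank_le hle (by rw [h1]; exact h)] at h2
  have h3 : inner ℝ (normal F) x = 0 := by
    have h4 : x ∈ (Submodule.span ℝ {normal F' - normal F, normal F'' - normal F})ᗮ := by
      rw [mem_span_orthogonal_iff]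
      rintro _ (rfl | rfl)
      · rw [inner_sub_left, (hP.mem_facetsAt_iff hx).1 hF', (hP.mem_facetsAt_iff hx).1 hF, sub_self]
      · rw [inner_sub_left, (hP.mem_facetsAt_iff hx).1 hF'', (hP.mem_facetsAt_iff hx).1 hF,
          sub_self]
    exact (Submodule.mem_orthogonal _ _).1 h4 _ h2
  rw [(hP.mem_facetsAt_iff hx).1 hF] at h3
  exact one_ne_zero h3

lemma isFaceOfCodim_two_inter {x : Euc d} (hx : x ∈ P) {F F' : Facet P} (hne : F ≠ F')
    (h : facetsAt P x = {F, F'}) : IsFaceOfCodim P 2 (F.1 ∩ F'.1) := by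
  rw [← faceOf_eq_inter h, hP.isFaceOfCodim_faceOf_iff hx, codimAt, h, Set.image_pair]
  exact hP.finrank_span_pair hx hne (by simp [h]) (by simp [h])

/-- Every face of codimension two is the intersection of two facets, and its relative interior
meets no other facet. -/
lemma exists_eq_inter {G : Set (Euc d)} (hG : IsFaceOfCodim P 2 G) : ∃ F F' : Facet P, F ≠ F' ∧
    G = F.1 ∩ F'.1 ∧ ∃ x ∈ P, facetsAt P x = {F, F'} := by
  obtain ⟨x, hx, rfl, hc⟩ := hP.exists_eq_faceOf hG
  have h1 : ∃ F ∈ facetsAt P x, ∃ F' ∈ facetsAt P x, F ≠ F' := by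
    by_contra! hcon
    have h2 : (normal '' facetsAt P x).Subsingleton := by
      rintro _ ⟨F, hF, rfl⟩ _ ⟨F', hF', rfl⟩
      rw [hcon F hF F' hF']
    have h3 : codimAt P x ≤ 1 := by
      rcases h2.eq_empty_or_singleton with h | ⟨v, h⟩
      · rw [codimAt, h, Submodule.span_empty, finrank_bot]; exact Nat.zero_le 1
      · rw [codimAt, h]
        exact (finrank_span_le_card _).trans (by simp)
    omega
  obtain ⟨F, hF, F', hF', hne⟩ := h1
  have h2 : facetsAt P x = {F, F'} := by
    refine Set.Subset.antisymm (fun F'' hF'' => ?_) ?_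
    · exact hP.eq_or_eq_of_codimAt_le_two hx hc.le hne hF hF' hF''
    · rintro _ (rfl | rfl) <;> assumption
  exact ⟨F, F', hne, faceOf_eq_inter h2, x, hx, h2⟩

lemma mem_intrinsicInterior_inter_iff {F F' : Facet P} (hne : F ≠ F')
    (h : IsFaceOfCodim P 2 (F.1 ∩ F'.1)) {y : Euc d} :
    y ∈ intrinsicInterior ℝ (F.1 ∩ F'.1) ↔ y ∈ P ∧ facetsAt P y = {F, F'} := by
  obtain ⟨G, G', hGne, hG, x, hx, hxG⟩ := hP.exists_eq_inter h
  have hx' : x ∈ F.1 ∩ F'.1 := by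
    rw [hG]
    have h1 : G ∈ facetsAt P x := by simp [hxG]
    have h2 : G' ∈ facetsAt P x := by simp [hxG]
    exact ⟨h1, h2⟩
  have hF : F ∈ facetsAt P x := hx'.1
  have hF' : F' ∈ facetsAt P x := hx'.2
  have h1 : facetsAt P x = {F, F'} := by
    rw [hxG] at hF hF' ⊢
    rcases hF with rfl | rfl <;> rcases hF' with rfl | rfl
    · exact absurd rfl hne
    · rfl
    · exact Set.pair_comm _ _
    · exact absurd rfl hne
  rw [← faceOf_eq_inter h1, hP.mem_intrinsicInterior_faceOf_iff hx, h1]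

lemma exists_facetsAt_eq_pair {F F' : Facet P} (hne : F ≠ F')
    (h : IsFaceOfCodim P 2 (F.1 ∩ F'.1)) : ∃ y ∈ P, facetsAt P y = {F, F'} := by
  obtain ⟨y, hy⟩ := hP.intrinsicInterior_nonempty h
  exact ⟨y, (hP.mem_intrinsicInterior_inter_iff hne h).1 hy⟩

lemma fanGraph_localFan_adj_iff {x : Euc d} (hx : x ∈ P) {F F' : facetsAt P x} :
    (fanGraph (localFan P x)).Adj F F' ↔ F ≠ F' ∧ IsFaceOfCodim P 2 (F.1.1 ∩ F'.1.1) := by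
  refine and_congr_right fun hne => ?_
  have hne' : F.1 ≠ F'.1 := fun h => hne (Subtype.ext h)
  constructor
  · rintro ⟨w, hw⟩
    obtain ⟨y, hy, h⟩ := hP.exists_facetsAt_eq_image_active hx ⟨F.1, F.2⟩ w
    rw [hw, Set.image_pair] at h
    exact hP.isFaceOfCodim_two_inter hy hne' h
  · intro h
    obtain ⟨y, hy, h1⟩ := hP.exists_facetsAt_eq_pair hne' h
    refine ⟨y, Set.ext fun F'' => ?_⟩
    rw [hP.mem_active_localFan_iff hy ⟨F.1, F.2, by simp [h1]⟩, h1]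
    simp [Subtype.ext_iff]

/-- The facets around a point are connected through faces of codimension two. -/
lemma facetsAt_connected {x : Euc d} (hx : x ∈ P) {β : Type*} (f : Facet P → β)
    (hf : ∀ F ∈ facetsAt P x, ∀ F' ∈ facetsAt P x, F ≠ F' → IsFaceOfCodim P 2 (F.1 ∩ F'.1) →
      f F = f F') {F F' : Facet P} (hF : F ∈ facetsAt P x) (hF' : F' ∈ facetsAt P x) :
    f F = f F' := by
  have := hP.finite_facet
  refine (hP.irredundant_localFan x).connected (fun G => f G.1) 0 (i := ⟨F, hF⟩) (j := ⟨F', hF'⟩)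
    (fun G _ G' _ h => ?_) (by simp) (by simp)
  rw [hP.fanGraph_localFan_adj_iff hx] at h
  exact hf _ G.2 _ G'.2 (fun h' => h.1 (Subtype.ext h')) h.2

/-- Around a point in a face of codimension three, every facet has at most two neighbours. -/
lemma eq_or_eq_of_codimAt_eq_three {x : Euc d} (hx : x ∈ P) (hc : codimAt P x = 3)
    {F F₁ F₂ F₃ : Facet P} (hF : F ∈ facetsAt P x) (hF₁ : F₁ ∈ facetsAt P x)
    (hF₂ : F₂ ∈ facetsAt P x) (hF₃ : F₃ ∈ facetsAt P x) (h₁ : F ≠ F₁) (h₂ : F ≠ F₂) (h₃ : F ≠ F₃)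
    (h₁' : IsFaceOfCodim P 2 (F.1 ∩ F₁.1)) (h₂' : IsFaceOfCodim P 2 (F.1 ∩ F₂.1))
    (h₃' : IsFaceOfCodim P 2 (F.1 ∩ F₃.1)) (hne : F₁ ≠ F₂) : F₃ = F₁ ∨ F₃ = F₂ := by
  let W : Submodule ℝ (Euc d) :=
    Submodule.span ℝ (normal '' facetsAt P x) ⊓ (Submodule.span ℝ {x})ᗮ
  have hW : finrank ℝ W ≤ 2 := by
    have h1 : W < Submodule.span ℝ (normal '' facetsAt P x) := by
      refine lt_of_le_of_ne inf_le_left fun h => ?_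
      have h2 : normal F ∈ W := by rw [h]; exact Submodule.subset_span ⟨F, hF, rfl⟩
      have h3 := h2.2
      rw [SetLike.mem_coe, Submodule.mem_orthogonal_singleton_iff_inner_left,
        (hP.mem_facetsAt_iff hx).1 hF] at h3
      exact one_ne_zero h3
    have h2 := Submodule.finrank_lt_finrank_of_lt h1
    change _ < codimAt P x at h2
    omega
  have hadj {G : Facet P} (hG : G ∈ facetsAt P x) (hFG : F ≠ G)
      (h : IsFaceOfCodim P 2 (F.1 ∩ G.1)) : (fanGraph (localFan P x)).Adj ⟨F, hF⟩ ⟨G, hG⟩ :=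
    (hP.fanGraph_localFan_adj_iff hx).2 ⟨fun h' => hFG (congrArg Subtype.val h'), h⟩
  have := fanGraph_adj_eq_of_finrank W hW (a := localFan P x) (fun G G' => by
      refine ⟨Submodule.sub_mem _ (Submodule.subset_span ⟨G.1, G.2, rfl⟩)
        (Submodule.subset_span ⟨G'.1, G'.2, rfl⟩), ?_⟩
      rw [SetLike.mem_coe, Submodule.mem_orthogonal_singleton_iff_inner_left, inner_sub_left]
      have h1 : inner ℝ (localFan P x G) x = 1 := (hP.mem_facetsAt_iff hx).1 G.2
      have h2 : inner ℝ (localFan P x G') x = 1 := (hP.mem_facetsAt_iff hx).1 G'.2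
      rw [h1, h2, sub_self])
    (hadj hF₁ h₁ h₁') (hadj hF₂ h₂ h₂') (hadj hF₃ h₃ h₃') (fun h => hne (congrArg Subtype.val h))
  simpa [Subtype.ext_iff] using this

/-- An alternating function on the pairs of adjacent facets that has a potential around every face
of codimension three has one around every point: the boundary of `P` is simply connected around
the faces of codimension at least four. -/
theorem exists_potential_facetsAt (w : Facet P → Facet P → ℚ) (hw : ∀ F F', w F' F = -w F F')
    (x : Euc d) (hx : x ∈ P)
    (h3 : ∀ y ∈ P, facetsAt P y ⊆ facetsAt P x → codimAt P y = 3 → ∃ φ : Facet P → ℚ,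
      ∀ F ∈ facetsAt P y, ∀ F' ∈ facetsAt P y, F ≠ F' → IsFaceOfCodim P 2 (F.1 ∩ F'.1) →
        w F F' = φ F' - φ F) :
    ∃ φ : Facet P → ℚ, ∀ F ∈ facetsAt P x, ∀ F' ∈ facetsAt P x, F ≠ F' →
      IsFaceOfCodim P 2 (F.1 ∩ F'.1) → w F F' = φ F' - φ F := by
  classical
  have hfin := hP.finite_facet
  induction hn : (facetsAt P x).ncard using Nat.strong_induction_on generalizing x with
  | _ n ih =>
  subst hn
  rcases lt_trichotomy (codimAt P x) 3 with hc | hc | hc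
  -- In codimension at most two there are at most two facets.
  · by_cases hex : ∃ F ∈ facetsAt P x, ∃ F' ∈ facetsAt P x, F ≠ F'
    · obtain ⟨F, hF, F', hF', hne⟩ := hex
      refine ⟨fun G => if G = F then 0 else w F F', fun G hG G' hG' hGG' _ => ?_⟩
      have h1 := hP.eq_or_eq_of_codimAt_le_two hx (by omega) hne hF hF' hG
      have h2 := hP.eq_or_eq_of_codimAt_le_two hx (by omega) hne hF hF' hG'
      rcases h1 with rfl | rfl <;> rcases h2 with rfl | rfl
      · exact absurd rfl hGG'
      · simp [hne.symm]
      · rw [hw]; simp [hne.symm]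
      · exact absurd rfl hGG'
    · push Not at hex
      exact ⟨fun _ => 0, fun G hG G' hG' hGG' => absurd (hex G hG G' hG') hGG'⟩
  · exact h3 x hx subset_rfl hc
  · have hne : (facetsAt P x).Nonempty := by
      by_contra hcon
      rw [Set.not_nonempty_iff_eq_empty] at hcon
      rw [codimAt, hcon, Set.image_empty, Submodule.span_empty, finrank_bot] at hc
      omega
    obtain ⟨F₀, hF₀⟩ := hne
    -- The orthogonal complement of `D` is the lineality space of the fan of the facets at `x`. The
    -- smaller sets of active facets belong to faces of smaller codimension.
    let D : Submodule ℝ (Euc d) :=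
      Submodule.span ℝ ((fun F => normal F - normal F₀) '' facetsAt P x)
    have hD : 3 ≤ finrank ℝ D := by
      have h1 := finrank_sup_span_singleton_le D (normal F₀)
      have h2 : Submodule.span ℝ (normal '' facetsAt P x) ≤ D ⊔ Submodule.span ℝ {normal F₀} := by
        rw [Submodule.span_le]
        rintro _ ⟨F, hF, rfl⟩
        have : normal F = (normal F - normal F₀) + normal F₀ := by simp
        rw [this]
        exact Submodule.add_mem_sup (Submodule.subset_span ⟨F, hF, rfl⟩)
          (Submodule.mem_span_singleton_self _)
      have h3 := Submodule.finrank_mono h2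
      change codimAt P x ≤ _ at h3
      omega
    have hDΛ := D.finrank_add_finrank_orthogonal
    obtain ⟨φ, hφ⟩ := (hP.irredundant_localFan x).exists_potential (fun F F' => w F.1 F'.1) Dᗮ
      (fun z => by
        rw [mem_span_orthogonal_iff]
        constructor
        · intro h
          have h1 (F : facetsAt P x) : inner ℝ (localFan P x F) z = inner ℝ (normal F₀) z := by
            have := h _ ⟨F.1, F.2, rfl⟩
            rw [inner_sub_left] at this
            exact sub_eq_zero.1 this
          refine Set.eq_univ_of_forall fun F F' => ?_
          rw [h1, h1]
        · rintro h _ ⟨F, hF, rfl⟩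
          have h1 : (⟨F, hF⟩ : facetsAt P x) ∈ active (localFan P x) z := by simp [h]
          have h2 : (⟨F₀, hF₀⟩ : facetsAt P x) ∈ active (localFan P x) z := by simp [h]
          rw [inner_sub_left]
          exact sub_eq_zero.2 (active_eq_of_mem (a := localFan P x) h1 h2)) (by omega)
      (fun z hz => by
        obtain ⟨y, hy, hyz⟩ := hP.exists_facetsAt_eq_image_active hx ⟨F₀, hF₀⟩ z
        have hsub : facetsAt P y ⊂ facetsAt P x := by
          refine (Set.ssubset_iff_subset_ne).2 ⟨?_, fun h => hz ?_⟩
          · rw [hyz]; rintro _ ⟨F, -, rfl⟩; exact F.2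
          · refine Set.eq_univ_of_forall fun F => ?_
            have h1 : F.1 ∈ facetsAt P y := by rw [h]; exact F.2
            rw [hyz] at h1
            obtain ⟨F', hF', h2⟩ := h1
            rwa [← Subtype.ext h2]
        obtain ⟨φ, hφ⟩ := ih _ (Set.ncard_lt_ncard hsub) y hy
          (fun y' hy' hsub' => h3 y' hy' (hsub'.trans hsub.subset)) rfl
        refine ⟨fun F => φ F.1, fun F hF F' hF' hadj => ?_⟩
        rw [hP.fanGraph_localFan_adj_iff hx] at hadj
        exact hφ _ (hyz ▸ ⟨F, hF, rfl⟩) _ (hyz ▸ ⟨F', hF', rfl⟩)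
          (fun h => hadj.1 (Subtype.ext h)) hadj.2)
    refine ⟨fun F => if h : F ∈ facetsAt P x then φ ⟨F, h⟩ else 0, fun F hF F' hF' hFF' h => ?_⟩
    simp only [dif_pos hF, dif_pos hF']
    exact hφ ⟨F, hF⟩ ⟨F', hF'⟩ ((hP.fanGraph_localFan_adj_iff hx).2
      ⟨fun h => hFF' (congrArg Subtype.val h), h⟩)

end IsSymmPolytope
end

/-! ### Translates and negatives of faces -/

section

open Topology Module
variable {d : ℕ}

lemma mem_vadd_iff {A : Set (Euc d)} {t x : Euc d} : x ∈ t +ᵥ A ↔ x - t ∈ A := by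
  rw [Set.mem_vadd_set_iff_neg_vadd_mem, vadd_eq_add, neg_add_eq_sub]

lemma isExposed_vadd {A B : Set (Euc d)} (t : Euc d) (h : IsExposed ℝ A B) :
    IsExposed ℝ (t +ᵥ A) (t +ᵥ B) := by
  rintro ⟨_, x, hx, rfl⟩
  obtain ⟨l, rfl⟩ := h ⟨x, hx⟩
  refine ⟨l, Set.ext fun y => ?_⟩
  simp only [mem_vadd_iff, Set.mem_ofPred_eq]
  refine and_congr_right fun _ => ⟨fun h z hz => ?_, fun h z hz => ?_⟩
  · have := h _ hz
    rw [map_sub, map_sub] at this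
    linarith
  · have := h (z + t) (by simpa using hz)
    rw [map_add] at this
    rw [map_sub]
    linarith

lemma isExposed_vadd_iff {A B : Set (Euc d)} {t : Euc d} :
    IsExposed ℝ (t +ᵥ A) B ↔ IsExposed ℝ A (-t +ᵥ B) := by
  constructor <;> intro h
  · simpa using isExposed_vadd (-t) h
  · simpa using isExposed_vadd t h

lemma isExposed_neg {A B : Set (Euc d)} (h : IsExposed ℝ A B) : IsExposed ℝ (-A) (-B) := by
  rintro ⟨x, hx⟩
  obtain ⟨l, rfl⟩ := h ⟨-x, hx⟩
  refine ⟨-l, Set.ext fun y => ?_⟩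
  simp only [Set.mem_neg, Set.mem_ofPred_eq]
  refine and_congr_right fun _ => ⟨fun h z hz => ?_, fun h z hz => ?_⟩
  · simpa using h (-z) hz
  · simpa using h (-z) (by simpa)

lemma vectorSpan_neg (A : Set (Euc d)) : vectorSpan ℝ (-A) = vectorSpan ℝ A := by
  have (B : Set (Euc d)) : vectorSpan ℝ B ≤ vectorSpan ℝ (-B) := by
    rw [vectorSpan, Submodule.span_le]
    rintro _ ⟨x, hx, y, hy, rfl⟩
    have := vsub_mem_vectorSpan ℝ (show -y ∈ -B by simpa) (show -x ∈ -B by simpa)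
    convert! this using 1
    simp only [vsub_eq_sub]
    abel
  exact le_antisymm (by simpa using this (-A)) (this A)

/-- A bounded nonempty set determines its translates. -/
lemma eq_of_vadd_eq {A : Set (Euc d)} (hA : Bornology.IsBounded A) (hne : A.Nonempty) {s t : Euc d}
    (h : s +ᵥ A = t +ᵥ A) : s = t := by
  by_contra hst
  have h1 (x : Euc d) (hx : x ∈ A) : x + (s - t) ∈ A := by
    have : s + x ∈ t +ᵥ A := by rw [← h]; exact Set.vadd_mem_vadd_set hx
    rw [mem_vadd_iff] at this
    convert! this using 1
    abel
  obtain ⟨x, hx⟩ := hne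
  have h2 (n : ℕ) : x + (n : ℝ) • (s - t) ∈ A := by
    induction n with
    | zero => simpa
    | succ n ih =>
      have := h1 _ ih
      push_cast
      rwa [add_smul, one_smul, ← add_assoc]
  obtain ⟨R, hR⟩ := hA.exists_norm_le
  have h3 : 0 < ‖s - t‖ := norm_pos_iff.2 (sub_ne_zero.2 hst)
  obtain ⟨n, hn⟩ := exists_nat_gt ((R + ‖x‖) / ‖s - t‖)
  rw [div_lt_iff₀ h3] at hn
  have h4 := hR _ (h2 n)
  have h5 := norm_sub_le (x + (n : ℝ) • (s - t)) x
  rw [add_sub_cancel_left, norm_smul, Real.norm_natCast] at h5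
  linarith

lemma faceOf_eq_self {P : Set (Euc d)} {x : Euc d} (h : facetsAt P x = ∅) : faceOf P x = P := by
  ext y
  simp [faceOf, h]

namespace IsSymmPolytope
variable {P : Set (Euc d)} (hP : IsSymmPolytope P)
include hP

lemma isFaceOfCodim_neg {j : ℕ} {G : Set (Euc d)} (hG : IsFaceOfCodim P j G) :
    IsFaceOfCodim P j (-G) := by
  refine ⟨hG.1.neg, ?_, ?_⟩
  · have := isExposed_neg hG.2.1
    rwa [hP.centered] at this
  · rw [vectorSpan_neg]
    exact hG.2.2

lemma neg_vadd (v : Euc d) : -(v +ᵥ P) = -v +ᵥ P := by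
  ext x
  rw [Set.mem_neg, mem_vadd_iff, mem_vadd_iff, ← hP.centered, Set.mem_neg, hP.centered]
  simp [sub_eq_add_neg, add_comm]

/-- The facet opposite to `F`. -/
def opp (F : Facet P) : Facet P := ⟨-F.1, hP.isFaceOfCodim_neg F.2⟩

lemma opp_val (F : Facet P) : (hP.opp F).1 = -F.1 := rfl

lemma opp_opp (F : Facet P) : hP.opp (hP.opp F) = F := Subtype.ext (neg_neg F.1)

lemma mem_facetsAt_neg_iff {F : Facet P} {x : Euc d} :
    F ∈ facetsAt P (-x) ↔ hP.opp F ∈ facetsAt P x := Iff.rfl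

lemma vectorSpan_facet (F : Facet P) : vectorSpan ℝ F.1 = (Submodule.span ℝ {normal F})ᗮ := by
  obtain ⟨x, hx, h⟩ := hP.exists_facetsAt_eq_singleton F
  have h1 := hP.eq_faceOf F.2.2.1 (hP.mem_intrinsicInterior_facet_iff.2 ⟨hx, h⟩)
  conv_lhs => rw [h1]
  rw [hP.vectorSpan_faceOf hx, h, Set.image_singleton]

/-- A facet is determined by its linear direction up to sign. -/
lemma eq_or_eq_opp {F F' : Facet P} (h : vectorSpan ℝ F.1 = vectorSpan ℝ F'.1) :
    F' = F ∨ F' = hP.opp F := by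
  rw [hP.vectorSpan_facet, hP.vectorSpan_facet] at h
  have h1 : normal F' ∈ Submodule.span ℝ {normal F} := by
    rw [← Submodule.orthogonal_orthogonal (Submodule.span ℝ {normal F}), h,
      Submodule.orthogonal_orthogonal]
    exact Submodule.mem_span_singleton_self _
  obtain ⟨c, hc⟩ := Submodule.mem_span_singleton.1 h1
  obtain ⟨x, hx, hxF⟩ := hP.exists_facetsAt_eq_singleton F
  obtain ⟨x', hx', hxF'⟩ := hP.exists_facetsAt_eq_singleton F'
  have e1 : inner ℝ (normal F) x = 1 := (hP.mem_facetsAt_iff hx).1 (by simp [hxF])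
  have e2 : inner ℝ (normal F') x' = 1 := (hP.mem_facetsAt_iff hx').1 (by simp [hxF'])
  have b1 := hP.inner_normal_le F' hx
  have b2 := hP.inner_normal_le F' (hP.neg_mem hx)
  have b3 := hP.inner_normal_le F hx'
  have b4 := hP.inner_normal_le F (hP.neg_mem hx')
  rw [← hc, real_inner_smul_left] at b1 b2 e2
  rw [inner_neg_right] at b2 b4
  rw [e1] at b1 b2
  rcases le_total 0 c with h0 | h0
  · left
    have : c = 1 := by nlinarith
    rw [this, one_smul] at hc
    exact (hP.eq_of_normal_eq hc).symm
  · right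
    have : inner ℝ (normal F) x' = -1 := by nlinarith
    have h2 : hP.opp F ∈ facetsAt P x' := by
      rw [← hP.mem_facetsAt_neg_iff, hP.mem_facetsAt_iff (hP.neg_mem hx'), inner_neg_right, this,
        neg_neg]
    rw [hxF'] at h2
    exact h2.symm

lemma inner_normal_opp (F : Facet P) (x : Euc d) :
    inner ℝ (normal (hP.opp F)) x = -inner ℝ (normal F) x := by
  have h : vectorSpan ℝ F.1 = vectorSpan ℝ (hP.opp F).1 := (vectorSpan_neg F.1).symm
  rw [hP.vectorSpan_facet, hP.vectorSpan_facet] at h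
  have h1 : normal (hP.opp F) ∈ Submodule.span ℝ {normal F} := by
    rw [← Submodule.orthogonal_orthogonal (Submodule.span ℝ {normal F}), h,
      Submodule.orthogonal_orthogonal]
    exact Submodule.mem_span_singleton_self _
  obtain ⟨c, hc⟩ := Submodule.mem_span_singleton.1 h1
  obtain ⟨y, hy, hyF⟩ := hP.exists_facetsAt_eq_singleton F
  have e1 : F ∈ facetsAt P y := by simp [hyF]
  have e2 : hP.opp F ∈ facetsAt P (-y) := by rwa [hP.mem_facetsAt_neg_iff, hP.opp_opp]
  rw [hP.mem_facetsAt_iff hy] at e1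
  rw [hP.mem_facetsAt_iff (hP.neg_mem hy), ← hc, inner_neg_right, real_inner_smul_left, e1] at e2
  rw [← hc, real_inner_smul_left, show c = -1 by linarith]
  ring

lemma opp_notMem_facetsAt {F : Facet P} {x : Euc d} (hx : x ∈ P) (hF : F ∈ facetsAt P x) :
    hP.opp F ∉ facetsAt P x := by
  rw [hP.mem_facetsAt_iff hx, hP.inner_normal_opp, (hP.mem_facetsAt_iff hx).1 hF]
  norm_num

lemma pair_opp (F : Facet P) : (hP.opp F).pair = F.pair := by
  apply Subtype.ext
  change ({-F.1, - -F.1} : Set (Set (Euc d))) = {F.1, -F.1}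
  rw [neg_neg, Set.pair_comm]

lemma pair_eq_pair_iff {F F' : Facet P} : F.pair = F'.pair ↔ F = F' ∨ F = hP.opp F' := by
  constructor
  · intro h
    have h1 : F.1 ∈ F'.pair.1 := by rw [← h]; exact Set.mem_insert _ _
    rcases h1 with h1 | h1
    · exact Or.inl (Subtype.ext h1)
    · exact Or.inr (Subtype.ext h1)
  · rintro (rfl | rfl)
    · rfl
    · exact hP.pair_opp F'

end IsSymmPolytope
end

/-! ### Tilings by translates -/

section

open Topology Module
variable {d : ℕ}

namespace IsTiling
variable {P T : Set (Euc d)} (hT : IsTiling P T)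
include hT

/-- Only finitely many tiles meet a bounded set. -/
lemma finite_inter {K : Set (Euc d)} (hK : Bornology.IsBounded K) : (K ∩ T).Finite := by
  have h0 := hT.isSymmPolytope.zero_mem_interior
  obtain ⟨r, hr, hball⟩ := Metric.isOpen_iff.1 isOpen_interior _ h0
  have hsep : T.Pairwise fun x y => r ≤ dist x y := by
    intro s hs t ht hst
    by_contra! hlt
    refine (hT.disjoint_interior s hs t ht hst).ne_of_mem (a := s) (b := s) ?_ ?_ rfl
    · rw [interior_vadd, mem_vadd_iff, sub_self]
      exact h0
    · rw [interior_vadd, mem_vadd_iff]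
      refine hball ?_
      rwa [mem_ball_zero_iff, ← dist_eq_norm]
  have hd : DiscreteTopology T := by
    refine DiscreteTopology.of_forall_le_dist hr fun x y hxy => ?_
    exact hsep x.2 y.2 fun h => hxy (Subtype.ext h)
  exact Metric.finite_isBounded_inter_isClosed ⟨hd⟩ hK (Metric.isClosed_of_pairwise_le_dist hr hsep)

/-- The tiles that meet a small neighbourhood of a point contain the point. -/
lemma eventually_mem (y : Euc d) : ∀ᶠ z in 𝓝 y, ∀ t ∈ T, z - t ∈ P → y - t ∈ P := by
  have hP := hT.isSymmPolytope
  obtain ⟨R, hR⟩ := hP.isCompact.isBounded.exists_norm_le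
  have hfin : (Metric.ball y (R + 1) ∩ T).Finite := hT.finite_inter Metric.isBounded_ball
  have h1 : ∀ᶠ z in 𝓝 y, ∀ t ∈ Metric.ball y (R + 1) ∩ T, z - t ∈ P → y - t ∈ P := by
    refine (Filter.eventually_all_finite hfin).2 fun t _ => ?_
    by_cases h : y - t ∈ P
    · exact Filter.Eventually.of_forall fun _ _ => h
    · have hc : ContinuousAt (fun z : Euc d => z - t) y := by fun_prop
      filter_upwards [hc.eventually (hP.isCompact.isClosed.isOpen_compl.mem_nhds h)] with z hz hz'
      exact absurd hz' hz
  filter_upwards [h1, Metric.ball_mem_nhds y one_pos] with z hz hzy t ht hzt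
  refine hz t ⟨?_, ht⟩ hzt
  have h2 := hR _ hzt
  rw [Metric.mem_ball, dist_eq_norm] at hzy ⊢
  have h3 : t - y = (z - y) - (z - t) := by abel
  rw [h3]
  exact (norm_sub_le _ _).trans_lt (by linarith)

lemma exists_mem (x : Euc d) : ∃ t ∈ T, x - t ∈ P := by
  have : x ∈ ⋃ t ∈ T, (t +ᵥ P) := by rw [hT.cover]; trivial
  simp only [Set.mem_iUnion, mem_vadd_iff] at this
  obtain ⟨t, ht, h⟩ := this
  exact ⟨t, ht, h⟩

lemma vadd {s : Euc d} (hs : s ∈ T) : IsTiling P (-s +ᵥ T) where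
  polytope := hT.polytope
  full_dim := hT.full_dim
  centered := hT.centered
  zero_mem := by rw [mem_vadd_iff]; simpa
  cover := by
    refine Set.eq_univ_of_forall fun x => ?_
    obtain ⟨t, ht, h⟩ := hT.exists_mem (x + s)
    simp only [Set.mem_iUnion, mem_vadd_iff]
    exact ⟨t - s, by simpa, by convert! h using 1; abel⟩
  disjoint_interior := by
    intro t ht u hu htu
    rw [mem_vadd_iff] at ht hu
    have := hT.disjoint_interior _ ht _ hu (by simpa)
    rw [interior_vadd, interior_vadd, Set.disjoint_left] at this ⊢
    intro x hx hx'
    rw [mem_vadd_iff] at hx hx'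
    refine this (a := x + s) ?_ ?_ <;> rw [mem_vadd_iff]
    · convert! hx using 1; abel
    · convert! hx' using 1; abel
  face_to_face := by
    intro t ht u hu
    rw [mem_vadd_iff] at ht hu
    have := hT.face_to_face _ ht _ hu
    have h1 := isExposed_vadd (-s) this.1
    have h2 := isExposed_vadd (-s) this.2
    rw [Set.vadd_set_inter, vadd_vadd, vadd_vadd] at h1 h2
    simp only [sub_neg_eq_add, neg_add_cancel_comm_assoc] at h1 h2
    exact ⟨h1, h2⟩

lemma neg : IsTiling P (-T) where
  polytope := hT.polytope
  full_dim := hT.full_dim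
  centered := hT.centered
  zero_mem := by simpa using hT.zero_mem
  cover := by
    refine Set.eq_univ_of_forall fun x => ?_
    obtain ⟨t, ht, h⟩ := hT.exists_mem (-x)
    simp only [Set.mem_iUnion, mem_vadd_iff]
    exact ⟨-t, by simpa, by convert! hT.isSymmPolytope.neg_mem h using 1; abel⟩
  disjoint_interior := by
    intro t ht u hu htu
    have := hT.disjoint_interior _ ht _ hu (by simpa)
    have hneg (z : Euc d) (hz : z ∈ interior P) : -z ∈ interior P := by
      rw [← hT.centered]
      have h1 := (Homeomorph.neg (Euc d)).image_interior P
      rw [Homeomorph.coe_neg, Set.image_neg_eq_neg, Set.image_neg_eq_neg] at h1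
      rw [← h1]
      simpa using hz
    rw [interior_vadd, interior_vadd, Set.disjoint_left] at this ⊢
    intro x hx hx'
    rw [mem_vadd_iff] at hx hx'
    refine this (a := -x) ?_ ?_ <;> rw [mem_vadd_iff]
    · convert! hneg _ hx using 1; abel
    · convert! hneg _ hx' using 1; abel
  face_to_face := by
    intro t ht u hu
    have := hT.face_to_face _ ht _ hu
    have key (v : Euc d) : -(-v +ᵥ P) = v +ᵥ P := by rw [hT.isSymmPolytope.neg_vadd, neg_neg]
    have h1 := isExposed_neg this.1
    have h2 := isExposed_neg this.2
    rw [Set.inter_neg, key, key] at h1 h2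
    exact ⟨h1, h2⟩

/-- A tile that meets `P` in a point of the relative interior of a facet `F` is the translate of `P`
that takes `-F` to `F`. -/
lemma of_mem_facet {y : Euc d} (hy : y ∈ P) {F : Facet P} (hyF : facetsAt P y = {F}) {t : Euc d}
    (ht : t ∈ T) (h0 : t ≠ 0) (hyt : y - t ∈ P) : t +ᵥ (-F.1) = F.1 := by
  have hP := hT.isSymmPolytope
  have h1 := hT.face_to_face 0 hT.zero_mem t ht
  rw [zero_vadd] at h1
  set E := P ∩ (t +ᵥ P) with hE
  have hyE : y ∈ E := ⟨hy, mem_vadd_iff.2 hyt⟩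
  have hF : F.1 = faceOf P y :=
    hP.eq_faceOf F.2.2.1 (hP.mem_intrinsicInterior_facet_iff.2 ⟨hy, hyF⟩)
  have hFE : F.1 = E := by
    obtain ⟨x, hx⟩ := (show E.Nonempty from ⟨y, hyE⟩).intrinsicInterior (h1.1.convex hP.convex)
    have hxP : x ∈ P := (intrinsicInterior_subset hx).1
    have hEx := hP.eq_faceOf h1.1 hx
    have hsub : facetsAt P x ⊆ {F} := by
      rw [← hyF]
      rw [hEx] at hyE
      exact hyE.2
    rcases Set.subset_singleton_iff_eq.1 hsub with h | h
    · rw [faceOf_eq_self h] at hEx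
      have h2 : P ⊆ t +ᵥ P := Set.inter_eq_left.1 hEx
      have h3 := hT.disjoint_interior 0 hT.zero_mem t ht h0.symm
      rw [zero_vadd] at h3
      have h4 := hP.zero_mem_interior
      exact absurd rfl (h3.ne_of_mem h4 (interior_mono h2 h4))
    · rw [hEx, hF, faceOf, faceOf, h, hyF]
  have h2 : IsExposed ℝ P (-t +ᵥ F.1) := by
    rw [hFE, ← isExposed_vadd_iff]
    exact h1.2
  let F' : Facet P := ⟨-t +ᵥ F.1, F.2.1.vadd_set, h2, by rw [vectorSpan_vadd]; exact F.2.2.2⟩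
  rcases hP.eq_or_eq_opp (F := F) (F' := F') (vectorSpan_vadd _ _ _).symm with h | h
  · exfalso
    have h3 : -t +ᵥ F.1 = (0 : Euc d) +ᵥ F.1 := by
      rw [zero_vadd]; exact congrArg Subtype.val h
    have := eq_of_vadd_eq (hP.isCompact.isBounded.subset F.subset) F.2.1 h3
    exact h0 (neg_eq_zero.1 this)
  · have h3 : -t +ᵥ F.1 = -F.1 := congrArg Subtype.val h
    rw [← h3, vadd_neg_vadd]

lemma exists_neighbour {y : Euc d} (hy : y ∈ P) {F : Facet P} (hyF : facetsAt P y = {F}) :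
    ∃ t ∈ T, t ≠ 0 ∧ y - t ∈ P ∧ t +ᵥ (-F.1) = F.1 := by
  have hP := hT.isSymmPolytope
  have hF : inner ℝ (normal F) y = 1 := (hP.mem_facetsAt_iff hy).1 (by simp [hyF])
  have hc : Filter.Tendsto (fun e : ℝ => y + e • normal F) (𝓝[>] 0) (𝓝 y) := by
    have : Continuous fun e : ℝ => y + e • normal F := by fun_prop
    have := this.tendsto 0
    simp only [zero_smul, add_zero] at this
    exact this.mono_left nhdsWithin_le_nhds
  obtain ⟨e, he, he0⟩ := ((hc.eventually (hT.eventually_mem y)).and self_mem_nhdsWithin).exists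
  obtain ⟨t, ht, h⟩ := hT.exists_mem (y + e • normal F)
  have h0 : t ≠ 0 := by
    rintro rfl
    rw [sub_zero] at h
    have h1 := hP.inner_normal_le F h
    rw [inner_add_right, inner_smul_right, hF] at h1
    have h2 : 0 < inner ℝ (normal F) (normal F) := real_inner_self_pos.2 (hP.normal_ne_zero F)
    nlinarith [mul_pos (show (0 : ℝ) < e from he0) h2]
  exact ⟨t, ht, h0, he t ht h, hT.of_mem_facet hy hyF ht h0 (he t ht h)⟩

/-- A parallelohedron has at most one face-to-face tiling that contains it: two tilings that share a
tile share its neighbours across facets, and any two tiles are joined by a segment that avoids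
the faces of codimension two. -/
lemma subset_of_isTiling {T' : Set (Euc d)} (hT' : IsTiling P T') : T' ⊆ T := by
  intro q hq
  have hP := hT.isSymmPolytope
  obtain ⟨R, hR⟩ := hP.isCompact.isBounded.exists_norm_le
  have hR0 : 0 ≤ R := by simpa using hR 0 (interior_subset hP.zero_mem_interior)
  have hfin : (Metric.closedBall 0 (R + ‖q‖ + R) ∩ T).Finite :=
    hT.finite_inter Metric.isBounded_closedBall
  let K := {G : Set (Euc d) // IsExposed ℝ P G ∧ G.Nonempty ∧ finrank ℝ (vectorSpan ℝ G) + 2 ≤ d}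
  have : Finite K := (hP.finite_isExposed.subset fun _ h => h.1).to_subtype
  have := hfin.to_subtype
  choose g hg using fun G : K => G.2.2.1
  -- `p` is chosen so that the segment from `p` to `q` avoids all faces of codimension at least two
  -- of the tiles near it.
  let W : K × ↥(Metric.closedBall 0 (R + ‖q‖ + R) ∩ T) → Submodule ℝ (Euc d) :=
    fun k => vectorSpan ℝ k.1.1 ⊔ Submodule.span ℝ {g k.1 + k.2 - q}
  have hW (k) : W k ≠ ⊤ := by
    apply ne_top_of_finrank_lt
    have h1 := finrank_sup_span_singleton_le (vectorSpan ℝ k.1.1) (g k.1 + k.2 - q)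
    have h2 := k.1.2.2.2
    rw [finrank_euclideanSpace_fin]
    change finrank ℝ (W k) ≤ _ at h1
    omega
  obtain ⟨p, hp, hpW⟩ := exists_mem_open_forall_sub_notMem W hW (fun _ => q) isOpen_interior
    hP.full_dim
  let γ : ℝ → Euc d := fun t => (1 - t) • p + t • q
  have hγ : Continuous γ := by fun_prop
  -- the times at which the segment is in a tile that belongs to both tilings
  let A : Set ℝ := {u | ∃ s ∈ T ∩ T', γ u - s ∈ P}
  have hA : IsClosed A := by
    refine isClosed_iff_clusterPt.2 fun u hu => ?_
    have h1 : ∃ᶠ v in 𝓝 u, v ∈ A := clusterPt_principal_iff_frequently.1 hu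
    obtain ⟨v, ⟨s, hs, h⟩, hv⟩ :=
      (h1.and_eventually (hγ.continuousAt.eventually (hT.eventually_mem (γ u)))).exists
    exact ⟨s, hs, hv s hs.1 h⟩
  have h0 : (0 : ℝ) ∈ A := ⟨0, ⟨hT.zero_mem, hT'.zero_mem⟩, by simpa [γ] using interior_subset hp⟩
  have h1 : (1 : ℝ) ∈ A := by
    refine (hA.inter isClosed_Icc).Icc_subset_of_forall_mem_nhdsWithin h0 ?_
      (Set.right_mem_Icc.2 zero_le_one)
    rintro u ⟨⟨s, hs, hus⟩, hu0, hu1⟩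
    have hcodim : codimAt P (γ u - s) ≤ 1 := by
      by_contra! hcon
      have hface := (hP.isFaceOfCodim_faceOf_iff hus).2 rfl
      let G : K := ⟨faceOf P (γ u - s), hface.2.1, hface.1, by have := hface.2.2; omega⟩
      have hsball : s ∈ Metric.closedBall (0 : Euc d) (R + ‖q‖ + R) ∩ T := by
        refine ⟨?_, hs.1⟩
        rw [mem_closedBall_zero_iff]
        have e1 : ‖γ u‖ ≤ R + ‖q‖ := by
          refine (norm_add_le _ _).trans ?_
          rw [norm_smul, norm_smul, Real.norm_of_nonneg hu0, Real.norm_of_nonneg (by linarith)]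
          have := hR p (interior_subset hp)
          have := norm_nonneg q
          nlinarith [norm_nonneg p]
        have e2 := hR _ hus
        have e3 : s = γ u - (γ u - s) := by abel
        rw [e3]
        exact (norm_sub_le _ _).trans (by linarith)
      refine hpW (G, ⟨s, hsball⟩) ?_
      have h1 : (1 - u) ≠ 0 := by linarith
      have : p - q = (1 - u)⁻¹ • ((γ u - s) - g G) + (1 - u)⁻¹ • (g G + s - q) := by
        have : (1 - u) • (p - q) = γ u - q := by simp only [γ]; module
        rw [← smul_add, show γ u - s - g G + (g G + s - q) = γ u - q by abel, ← this, smul_smul,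
          inv_mul_cancel₀ h1, one_smul]
      rw [this]
      exact Submodule.add_mem_sup
        (Submodule.smul_mem _ _ (vsub_mem_vectorSpan ℝ (self_mem_faceOf hus) (hg G)))
        (Submodule.smul_mem _ _ (Submodule.mem_span_singleton_self _))
    refine mem_nhdsWithin_of_mem_nhds ?_
    filter_upwards [hγ.continuousAt.eventually (hT.eventually_mem (γ u))] with v hv
    obtain ⟨t, ht, hvt⟩ := hT.exists_mem (γ v)
    refine ⟨t, ⟨ht, ?_⟩, hvt⟩
    by_cases hts : t = s
    · rw [hts]; exact hs.2
    have hTs := hT.vadd hs.1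
    have hut := hv t ht hvt
    have hts' : t - s ∈ -s +ᵥ T := by rw [mem_vadd_iff]; simpa
    have hus' : γ u - s - (t - s) ∈ P := by rwa [sub_sub_sub_cancel_right]
    -- the tiles at `s` and `t` share a facet since `γ u` is in no face of codimension two
    have hne : (facetsAt P (γ u - s)).Nonempty := by
      by_contra hcon
      have h2 : γ u - s ∈ interior P := by
        by_contra hint
        have : γ u - s ∈ frontier P := ⟨subset_closure hus, hint⟩
        exact hcon (hP.mem_frontier_iff.1 this).2
      have h3 := hTs.disjoint_interior 0 hTs.zero_mem (t - s) hts'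
        (fun h => hts (sub_eq_zero.1 h.symm))
      have h4 : γ u - s ∈ closure (interior ((t - s) +ᵥ P)) := by
        rw [interior_vadd, closure_vadd,
          hP.convex.closure_interior_eq_closure_of_nonempty_interior hP.full_dim, mem_vadd_iff]
        exact subset_closure hus'
      rw [zero_vadd] at h3
      obtain ⟨z, hz, hz'⟩ := mem_closure_iff.1 h4 _ isOpen_interior h2
      exact Set.disjoint_left.1 h3 hz hz'
    obtain ⟨F, hF⟩ := hne
    have hF' : facetsAt P (γ u - s) = {F} := Set.eq_singleton_iff_unique_mem.2
      ⟨hF, fun F' hF' => hP.eq_of_codimAt_eq_one hus hcodim hF' hF⟩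
    have e1 := hTs.of_mem_facet hus hF' hts' (sub_ne_zero.2 hts) hus'
    -- the neighbours across `F` in both tilings coincide
    obtain ⟨t', ht', -, -, e2⟩ := (hT'.vadd hs.2).exists_neighbour hus hF'
    have e3 : t - s = t' := eq_of_vadd_eq (hP.isCompact.isBounded.subset (hP.opp F).subset)
      F.2.1.neg (e1.trans e2.symm)
    rw [← e3, mem_vadd_iff] at ht'
    simpa using ht'
  obtain ⟨s, hs, h⟩ := h1
  have hsq : s = q := by
    by_contra hne
    have h3 := hT'.disjoint_interior s hs.2 q hq hne
    have h4 : q ∈ closure (interior (s +ᵥ P)) := by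
      rw [interior_vadd, closure_vadd,
        hP.convex.closure_interior_eq_closure_of_nonempty_interior hP.full_dim, mem_vadd_iff]
      exact subset_closure (by simpa [γ] using h)
    obtain ⟨z, hz, hz'⟩ := mem_closure_iff.1 h4 (interior (q +ᵥ P)) isOpen_interior (by
      rw [interior_vadd, mem_vadd_iff, sub_self]; exact hP.zero_mem_interior)
    exact Set.disjoint_left.1 h3 hz' hz
  exact hsq ▸ hs.1

lemma neg_eq : -T = T :=
  Set.Subset.antisymm (hT.subset_of_isTiling hT.neg) (hT.neg.subset_of_isTiling hT)

lemma isPrimitive_neg {G : Set (Euc d)} (hG : IsPrimitive P T G) : IsPrimitive P T (-G) := by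
  refine ⟨hT.isSymmPolytope.isFaceOfCodim_neg hG.1, ?_⟩
  have key (v : Euc d) : -(-v +ᵥ P) = v +ᵥ P := by rw [hT.isSymmPolytope.neg_vadd, neg_neg]
  rw [← hG.2, ← Set.ncard_image_of_injective _ neg_injective]
  congr 1
  ext t
  simp only [Set.mem_image, Set.mem_ofPred_eq]
  constructor
  · rintro ⟨s, ⟨hs, h⟩, rfl⟩
    refine ⟨by rw [← hT.neg_eq]; simpa, ?_⟩
    have := isExposed_neg h
    rwa [neg_neg, ← key, neg_neg] at this
  · rintro ⟨ht, h⟩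
    refine ⟨-t, ⟨by rw [← hT.neg_eq]; simpa, ?_⟩, neg_neg t⟩
    have := isExposed_neg h
    rwa [← key, neg_neg] at this

end IsTiling
end

/-! ### A facet is not adjacent to both facets of an opposite pair -/

section

open Topology Module
variable {d : ℕ}

namespace IsSymmPolytope
variable {P : Set (Euc d)} (hP : IsSymmPolytope P)
include hP

/-- If `F` meets both `F'` and `-F'`, then `±F`, `±F'` are the only facets parallel to the
intersection of the hyperplanes of `F` and `F'`. -/
lemma eq_of_normal_mem_span_pair {F F' H : Facet P} (h1 : (F.1 ∩ F'.1).Nonempty)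
    (h2 : (F.1 ∩ (hP.opp F').1).Nonempty)
    (hH : normal H ∈ Submodule.span ℝ {normal F, normal F'}) :
    (H = F ∨ H = hP.opp F) ∨ (H = F' ∨ H = hP.opp F') := by
  obtain ⟨y₁, h1⟩ := h1
  obtain ⟨y₂, h2⟩ := h2
  have hy₁ := F.subset h1.1
  have hy₂ := F.subset h2.1
  obtain ⟨α, β, hαβ⟩ := Submodule.mem_span_pair.1 hH
  have hval (x : Euc d) : inner ℝ (normal H) x =
      α * inner ℝ (normal F) x + β * inner ℝ (normal F') x := by
    rw [← hαβ, inner_add_left, real_inner_smul_left, real_inner_smul_left]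
  have e1 := (hP.mem_facet_iff.1 h1.1).2
  have e2 := (hP.mem_facet_iff.1 h1.2).2
  have e3 := (hP.mem_facet_iff.1 h2.1).2
  have e4 := (hP.mem_facet_iff.1 h2.2).2
  rw [hP.inner_normal_opp] at e4
  have b1 := hP.inner_normal_le H hy₁
  have b2 := hP.inner_normal_le H (hP.neg_mem hy₁)
  have b3 := hP.inner_normal_le H hy₂
  have b4 := hP.inner_normal_le H (hP.neg_mem hy₂)
  rw [inner_neg_right] at b2 b4
  rw [hval] at b1 b2 b3 b4
  rw [e1, e2] at b1 b2
  rw [e3, neg_eq_iff_eq_neg.1 e4] at b3 b4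
  obtain ⟨x, hx, hxH⟩ := hP.exists_facetsAt_eq_singleton H
  have e5 : inner ℝ (normal H) x = 1 := (hP.mem_facetsAt_iff hx).1 (by simp [hxH])
  rw [hval] at e5
  have key (G : Facet P) (hG : inner ℝ (normal G) x = 1 ∨ inner ℝ (normal G) x = -1) :
      H = G ∨ H = hP.opp G := by
    rcases hG with h | h
    · left
      have : G ∈ facetsAt P x := (hP.mem_facetsAt_iff hx).2 h
      rw [hxH] at this
      exact this.symm
    · right
      have : hP.opp G ∈ facetsAt P x := (hP.mem_facetsAt_iff hx).2 (by
        rw [hP.inner_normal_opp, h, neg_neg])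
      rw [hxH] at this
      exact this.symm
  have c1 := hP.inner_normal_le F hx
  have c2 := hP.inner_normal_le F (hP.neg_mem hx)
  have c3 := hP.inner_normal_le F' hx
  have c4 := hP.inner_normal_le F' (hP.neg_mem hx)
  rw [inner_neg_right] at c2 c4
  set u := inner ℝ (normal F) x
  set v := inner ℝ (normal F') x
  -- `|α| + |β| ≤ 1 = α u + β v` and `|u|, |v| ≤ 1`
  rcases lt_trichotomy α 0 with hα | hα | hα
  · refine Or.inl (key F (Or.inr ?_))
    rcases le_total 0 β with hβ | hβ <;> nlinarith
  · refine Or.inr (key F' ?_)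
    subst hα
    rcases le_total 0 β with hβ | hβ
    · left; nlinarith
    · right; nlinarith
  · refine Or.inl (key F (Or.inl ?_))
    rcases le_total 0 β with hβ | hβ <;> nlinarith

end IsSymmPolytope

namespace IsTiling
variable {P T : Set (Euc d)} (hT : IsTiling P T)
include hT

/-- A tile that contains a point of the relative interior of a face has this face as a face. -/
lemma vadd_faceOf_eq {y t : Euc d} (hy : y ∈ P) (ht : t ∈ T) (hyt : y - t ∈ P) :
    t +ᵥ faceOf P (y - t) = faceOf P y := by
  have hP := hT.isSymmPolytope
  have h1 := hT.face_to_face 0 hT.zero_mem t ht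
  rw [zero_vadd] at h1
  have hyE : y ∈ P ∩ (t +ᵥ P) := ⟨hy, mem_vadd_iff.2 hyt⟩
  have hsub : faceOf P y ⊆ P ∩ (t +ᵥ P) := hP.faceOf_subset h1.1 hyE
  have hsub' : faceOf P (y - t) ⊆ -t +ᵥ (P ∩ (t +ᵥ P)) := by
    refine hP.faceOf_subset (isExposed_vadd_iff.1 h1.2) ?_
    rw [mem_vadd_iff]
    simpa using hyE
  -- both faces contain `y` in their relative interiors and lie in both tiles
  refine Set.Subset.antisymm (fun z hz => ?_) fun z hz => ?_
  · rw [mem_vadd_iff] at hz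
    have hzP : z ∈ P := by
      have := (hsub' hz)
      rw [mem_vadd_iff, sub_neg_eq_add, sub_add_cancel] at this
      exact this.1
    obtain ⟨e, he, h⟩ := exists_add_smul_sub_mem (hP.mem_intrinsicInterior_faceOf hyt) hz
    have h2 : y + e • (y - z) ∈ P := by
      have := hsub' h
      rw [mem_vadd_iff] at this
      convert! this.1 using 1
      module
    refine ⟨hzP, fun F hF => (hP.mem_facetsAt_iff hzP).2
      (le_antisymm (hP.inner_normal_le F hzP) ?_)⟩
    have h3 := hP.inner_normal_le F h2
    rw [inner_add_right, inner_smul_right, inner_sub_right, (hP.mem_facetsAt_iff hy).1 hF] at h3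
    by_contra! hlt
    nlinarith [mul_pos he (sub_pos.2 hlt)]
  · rw [mem_vadd_iff]
    have hzP : z - t ∈ P := mem_vadd_iff.1 (hsub hz).2
    obtain ⟨e, he, h⟩ := exists_add_smul_sub_mem (hP.mem_intrinsicInterior_faceOf hy) hz
    have h2 : (y - t) + e • ((y - t) - (z - t)) ∈ P := by
      have := mem_vadd_iff.1 (hsub h).2
      convert! this using 1
      module
    refine ⟨hzP, fun F hF => (hP.mem_facetsAt_iff hzP).2
      (le_antisymm (hP.inner_normal_le F hzP) ?_)⟩
    have h3 := hP.inner_normal_le F h2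
    rw [inner_add_right, inner_smul_right, inner_sub_right _ (y - t) (z - t),
      (hP.mem_facetsAt_iff hyt).1 hF] at h3
    by_contra! hlt
    nlinarith [mul_pos he (sub_pos.2 hlt)]

/-- If the facets `F` and `F'` meet in a face of codimension two and `F` meets `-F'` as well, then
`±F` and `±F'` are the only facets parallel to `F ∩ F'`; the tiles at `F ∩ F'` fill four quadrants,
so this face is not primitive. -/
lemma not_isPrimitive_of_inter_opp {F F' : Facet P}
    (h1 : IsPrimitive P T (F.1 ∩ F'.1)) (h2 : (F.1 ∩ (hT.isSymmPolytope.opp F').1).Nonempty)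
    (hne : F ≠ F') : False := by
  have hP := hT.isSymmPolytope
  obtain ⟨y, hy, hyF⟩ := hP.exists_facetsAt_eq_pair hne h1.1
  obtain ⟨y₂, hy₂⟩ := h2
  have hF : F ∈ facetsAt P y := by simp [hyF]
  have hF' : F' ∈ facetsAt P y := by simp [hyF]
  have e1 := (hP.mem_facetsAt_iff hy).1 hF
  have e2 := (hP.mem_facetsAt_iff hy).1 hF'
  have e3 := (hP.mem_facet_iff.1 hy₂.1).2
  have e4 := (hP.mem_facet_iff.1 hy₂.2).2
  rw [hP.inner_normal_opp, neg_eq_iff_eq_neg] at e4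
  -- the four quadrants are indexed by pairs of signs
  let sgn : Bool → Facet P → Facet P := fun b G => if b then G else hP.opp G
  have hu (p : Bool × Bool) : ∃ u : Euc d, inner ℝ (normal (sgn p.1 F)) u < 0 ∧
      inner ℝ (normal (sgn p.2 F')) u < 0 := by
    rcases p with ⟨_ | _, _ | _⟩
    · exact ⟨y, by simp [sgn, hP.inner_normal_opp, e1], by simp [sgn, hP.inner_normal_opp, e2]⟩
    · exact ⟨y₂, by simp [sgn, hP.inner_normal_opp, e3], by simp [sgn, e4]⟩
    · exact ⟨-y₂, by simp [sgn, e3], by simp [sgn, hP.inner_normal_opp, e4]⟩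
    · exact ⟨-y, by simp [sgn, e1], by simp [sgn, e2]⟩
  -- the tiles that have `F ∩ F'` as a face
  let S := {t ∈ T | IsExposed ℝ (t +ᵥ P) (F.1 ∩ F'.1)}
  have hS {t : Euc d} (ht : t ∈ T) (hyt : y - t ∈ P) : t ∈ S := by
    refine ⟨ht, ?_⟩
    rw [← faceOf_eq_inter hyF, ← hT.vadd_faceOf_eq hy ht hyt]
    exact isExposed_vadd t (hP.isExposed_faceOf hyt)
  -- Each tile at `y` has a face of codimension two there, with the same normal plane.
  have hspan {t : Euc d} (ht : t ∈ T) (hyt : y - t ∈ P) :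
      Submodule.span ℝ (normal '' facetsAt P (y - t)) =
        Submodule.span ℝ {normal F, normal F'} := by
    have := congrArg (vectorSpan ℝ) (hT.vadd_faceOf_eq hy ht hyt)
    rw [vectorSpan_vadd, hP.vectorSpan_faceOf hyt, hP.vectorSpan_faceOf hy, hyF,
      Set.image_pair] at this
    rw [← Submodule.orthogonal_orthogonal (Submodule.span ℝ (normal '' facetsAt P (y - t))), this,
      Submodule.orthogonal_orthogonal]
  -- A tile that contains points of the quadrant `p` near `y` has at `y` the two facets with the
  -- signs `p`, because all its facets at `y` are among `±F`, `±F'`.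
  have hex (p : Bool × Bool) : ∃ t ∈ S, y - t ∈ P ∧ sgn p.1 F ∈ facetsAt P (y - t) ∧
      sgn p.2 F' ∈ facetsAt P (y - t) := by
    obtain ⟨u, hu1, hu2⟩ := hu p
    have hc : Filter.Tendsto (fun e : ℝ => y + e • u) (𝓝[>] 0) (𝓝 y) := by
      have : Continuous fun e : ℝ => y + e • u := by fun_prop
      have := this.tendsto 0
      simp only [zero_smul, add_zero] at this
      exact this.mono_left nhdsWithin_le_nhds
    obtain ⟨e, he, he0⟩ := ((hc.eventually (hT.eventually_mem y)).and self_mem_nhdsWithin).exists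
    replace he0 : 0 < e := he0
    obtain ⟨t, ht, h⟩ := hT.exists_mem (y + e • u)
    have hyt := he t ht h
    refine ⟨t, hS ht hyt, hyt, ?_⟩
    have hsp := hspan ht hyt
    have hle {H : Facet P} (hH : H ∈ facetsAt P (y - t)) : inner ℝ (normal H) u ≤ 0 := by
      have h3 := hP.inner_normal_le H h
      rw [show y + e • u - t = (y - t) + e • u by abel, inner_add_right, inner_smul_right,
        (hP.mem_facetsAt_iff hyt).1 hH] at h3
      by_contra! hlt
      nlinarith [mul_pos he0 hlt]
    have hcase {H : Facet P} (hH : H ∈ facetsAt P (y - t)) : H = sgn p.1 F ∨ H = sgn p.2 F' := by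
      have h4 : normal H ∈ Submodule.span ℝ {normal F, normal F'} := by
        rw [← hsp]; exact Submodule.subset_span ⟨H, hH, rfl⟩
      have key (b : Bool) (G : Facet P) (hG : inner ℝ (normal (sgn b G)) u < 0)
          (h5 : H = G ∨ H = hP.opp G) : H = sgn b G := by
        have h6 := hle hH
        rcases h5 with rfl | rfl <;> rcases b with _ | _ <;>
          simp only [sgn, if_true, Bool.false_eq_true, if_false, hP.inner_normal_opp] at hG h6 ⊢ <;>
          linarith
      rcases hP.eq_of_normal_mem_span_pair ⟨y, hF, hF'⟩ ⟨y₂, hy₂⟩ h4 with h5 | h5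
      · exact Or.inl (key _ _ hu1 h5)
      · exact Or.inr (key _ _ hu2 h5)
    have hcd : codimAt P (y - t) = 2 := by
      rw [codimAt, hsp, hP.finrank_span_pair hy hne hF hF']
    have h5 := (hP.isFaceOfCodim_faceOf_iff hyt).2 hcd
    obtain ⟨G, G', hGne, hG, -⟩ := hP.exists_eq_inter h5
    have h6 := self_mem_faceOf hyt
    rw [hG] at h6
    have hG1 : G ∈ facetsAt P (y - t) := h6.1
    have hG2 : G' ∈ facetsAt P (y - t) := h6.2
    rcases hcase hG1 with h7 | h7 <;> rcases hcase hG2 with h8 | h8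
    · exact absurd (h7.trans h8.symm) hGne
    · exact ⟨h7 ▸ hG1, h8 ▸ hG2⟩
    · exact ⟨h8 ▸ hG2, h7 ▸ hG1⟩
    · exact absurd (h7.trans h8.symm) hGne
  choose f hf hfP hf1 hf2 using hex
  have hsgn {b b' : Bool} {G : Facet P} {x : Euc d} (hx : x ∈ P) (hb : sgn b G ∈ facetsAt P x)
      (hb' : sgn b' G ∈ facetsAt P x) : b = b' := by
    rcases b with _ | _ <;> rcases b' with _ | _ <;> simp only [sgn, if_true, Bool.false_eq_true,
      if_false] at hb hb' ⊢
    · exact absurd hb (hP.opp_notMem_facetsAt hx hb')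
    · exact absurd hb' (hP.opp_notMem_facetsAt hx hb)
  have hinj : Function.Injective f := by
    intro p q hpq
    have h3 := hf1 q
    have h4 := hf2 q
    rw [← hpq] at h3 h4
    exact Prod.ext (hsgn (hfP p) (hf1 p) h3) (hsgn (hfP p) (hf2 p) h4)
  have hcard : S.ncard = 3 := h1.2
  have hfin : S.Finite := Set.finite_of_ncard_ne_zero (by omega)
  have h3 := Set.ncard_le_ncard (Set.range_subset_iff.2 hf) hfin
  rw [← Set.image_univ, Set.ncard_image_of_injective _ hinj, Set.ncard_univ,
    Nat.card_eq_fintype_card, Fintype.card_prod, Fintype.card_bool, hcard] at h3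
  omega

end IsTiling
end

/-! ### The `δ`-surface and its quotient -/

section

open Topology Module
variable {d : ℕ}

namespace IsSymmPolytope
variable {P : Set (Euc d)} (hP : IsSymmPolytope P)
include hP

lemma facetsAt_segment_subset {x y : Euc d} (hx : x ∈ P) (hy : y ∈ P)
    (h : facetsAt P y ⊆ facetsAt P x) {s : ℝ} (h0 : 0 ≤ s) (h1 : s ≤ 1) :
    facetsAt P ((1 - s) • x + s • y) ⊆ facetsAt P x := by
  intro F hF
  have hmem : (1 - s) • x + s • y ∈ P :=
    hP.convex hx hy (by linarith) h0 (by ring)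
  rw [hP.mem_facetsAt_iff hmem, inner_add_right, inner_smul_right, inner_smul_right] at hF
  by_contra hcon
  have h2 := hP.inner_lt_of_notMem hx hcon
  have h3 := hP.inner_lt_of_notMem hy fun h' => hcon (h h')
  rcases h0.eq_or_lt with rfl | h0
  · linarith
  · nlinarith

lemma facetsAt_segment_eq {x y : Euc d} (hx : x ∈ P) (hy : y ∈ P) {s : ℝ} (h0 : 0 < s)
    (h1 : s < 1) : facetsAt P ((1 - s) • x + s • y) = facetsAt P x ∩ facetsAt P y := by
  have hmem : (1 - s) • x + s • y ∈ P :=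
    hP.convex hx hy (by linarith) h0.le (by ring)
  ext F
  rw [Set.mem_inter_iff, hP.mem_facetsAt_iff hmem, hP.mem_facetsAt_iff hx, hP.mem_facetsAt_iff hy,
    inner_add_right, inner_smul_right, inner_smul_right]
  have h2 := hP.inner_normal_le F hx
  have h3 := hP.inner_normal_le F hy
  constructor
  · intro h
    constructor <;> nlinarith
  · rintro ⟨e1, e2⟩
    rw [e1, e2]; ring

lemma eventually_facetsAt_subset {x : Euc d} (hx : x ∈ P) :
    ∀ᶠ y in 𝓝 x, facetsAt P y ⊆ facetsAt P x := by
  filter_upwards [hP.eventually_inner_lt_of_notMem hx] with y hy F hF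
  by_contra hcon
  exact (hy F hcon).ne (hP.mem_facet_iff.1 hF).2

/-- A choice of points in the relative interiors of the facets that respects the symmetry. -/
lemma exists_center : ∃ c : Facet P → Euc d, (∀ F, c F ∈ P ∧ facetsAt P (c F) = {F}) ∧
    ∀ F, c (hP.opp F) = -c F := by
  choose p hp hpF using hP.exists_facetsAt_eq_singleton
  refine ⟨fun F => (1 - (1 / 2 : ℝ)) • p F + (1 / 2 : ℝ) • -p (hP.opp F), fun F => ⟨?_, ?_⟩,
    fun F => ?_⟩
  · exact hP.convex (hp F) (hP.neg_mem (hp _)) (by norm_num) (by norm_num) (by norm_num)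
  · rw [hP.facetsAt_segment_eq (hp F) (hP.neg_mem (hp _)) (by norm_num) (by norm_num), hpF]
    refine Set.inter_eq_left.2 (Set.singleton_subset_iff.2 ?_)
    rw [hP.mem_facetsAt_neg_iff, hpF]
    rfl
  · simp only [hP.opp_opp]
    module

end IsSymmPolytope

namespace IsTiling
variable {P T : Set (Euc d)} (hT : IsTiling P T)
include hT

lemma mem_deltaSurface_iff {x : Euc d} : x ∈ deltaSurface P T ↔ x ∈ P ∧ (facetsAt P x).Nonempty ∧
    ∀ F ∈ facetsAt P x, ∀ F' ∈ facetsAt P x, F ≠ F' → IsFaceOfCodim P 2 (F.1 ∩ F'.1) →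
      IsPrimitive P T (F.1 ∩ F'.1) := by
  have hP := hT.isSymmPolytope
  rw [deltaSurface, Set.mem_sdiff, hP.mem_frontier_iff, and_assoc]
  refine and_congr_right fun hx => and_congr_right fun _ => ⟨fun h F hF F' hF' _ hc => ?_, ?_⟩
  · by_contra hcon
    exact h ⟨_, ⟨hc, hcon⟩, hF, hF'⟩
  · rintro h ⟨G, ⟨hG, hGp⟩, hxG⟩
    obtain ⟨F, F', hne, rfl, -⟩ := hP.exists_eq_inter hG
    exact hGp (h F hxG.1 F' hxG.2 hne hG)

lemma mem_deltaSurface_of_subset {x y : Euc d} (hx : x ∈ deltaSurface P T) (hy : y ∈ P)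
    (hne : (facetsAt P y).Nonempty) (h : facetsAt P y ⊆ facetsAt P x) : y ∈ deltaSurface P T := by
  rw [hT.mem_deltaSurface_iff] at hx ⊢
  exact ⟨hy, hne, fun F hF F' hF' => hx.2.2 F (h hF) F' (h hF')⟩

lemma mem_deltaSurface_of_eq_singleton {x : Euc d} (hx : x ∈ P) {F : Facet P}
    (h : facetsAt P x = {F}) : x ∈ deltaSurface P T := by
  rw [hT.mem_deltaSurface_iff, h]
  refine ⟨hx, Set.singleton_nonempty F, ?_⟩
  rintro _ rfl _ rfl hne
  exact absurd rfl hne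

lemma mem_deltaSurface_of_eq_pair {x : Euc d} (hx : x ∈ P) {F F' : Facet P}
    (h : facetsAt P x = {F, F'}) (hp : IsPrimitive P T (F.1 ∩ F'.1)) : x ∈ deltaSurface P T := by
  rw [hT.mem_deltaSurface_iff, h]
  refine ⟨hx, ⟨F, by simp⟩, ?_⟩
  rintro _ (rfl | rfl) _ (rfl | rfl) hne
  · exact absurd rfl hne
  · exact fun _ => hp
  · exact fun _ => by rwa [Set.inter_comm]
  · exact absurd rfl hne

lemma mem (x : deltaSurface P T) : (x : Euc d) ∈ P := (hT.mem_deltaSurface_iff.1 x.2).1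

lemma nonempty (x : deltaSurface P T) : (facetsAt P (x : Euc d)).Nonempty :=
  (hT.mem_deltaSurface_iff.1 x.2).2.1

lemma neg_mem_deltaSurface {x : Euc d} (hx : x ∈ deltaSurface P T) : -x ∈ deltaSurface P T := by
  have hP := hT.isSymmPolytope
  rw [hT.mem_deltaSurface_iff] at hx ⊢
  obtain ⟨hxP, ⟨F, hF⟩, h⟩ := hx
  refine ⟨hP.neg_mem hxP, ⟨hP.opp F, ?_⟩, fun F hF F' hF' hne hc => ?_⟩
  · rwa [hP.mem_facetsAt_neg_iff, hP.opp_opp]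
  · rw [hP.mem_facetsAt_neg_iff] at hF hF'
    have := h _ hF _ hF' (fun h => hne (by rw [← hP.opp_opp F, h, hP.opp_opp]))
      (by have := hP.isFaceOfCodim_neg hc; rwa [Set.inter_neg] at this)
    have := hT.isPrimitive_neg this
    rwa [Set.inter_neg, hP.opp_val, hP.opp_val, neg_neg, neg_neg] at this

/-- The antipodal map of the `δ`-surface. -/
def negMap : C(deltaSurface P T, deltaSurface P T) where
  toFun x := ⟨-x, hT.neg_mem_deltaSurface x.2⟩
  continuous_toFun := by fun_prop

@[simp] lemma coe_negMap (x : deltaSurface P T) : (hT.negMap x : Euc d) = -(x : Euc d) := rfl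

@[simp] lemma negMap_negMap (x : deltaSurface P T) : hT.negMap (hT.negMap x) = x :=
  Subtype.ext (neg_neg _)

lemma mem_facetsAt_negMap {x : deltaSurface P T} {F : Facet P} :
    F ∈ facetsAt P (hT.negMap x : Euc d) ↔ hT.isSymmPolytope.opp F ∈ facetsAt P (x : Euc d) :=
  Iff.rfl

end IsTiling

variable {P T : Set (Euc d)}

/-- The projection of the `δ`-surface to the `π`-surface. -/
def proj (P T : Set (Euc d)) : C(deltaSurface P T, PiSurface P T) :=
  ⟨Quotient.mk _, continuous_quotient_mk'⟩

lemma proj_eq_iff {x y : deltaSurface P T} :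
    proj P T x = proj P T y ↔ (x : Euc d) = y ∨ (x : Euc d) = -(y : Euc d) := Quotient.eq

lemma proj_surjective : Function.Surjective (proj P T) := Quotient.mk_surjective

/-- The open star of the face of `x` in the `δ`-surface. -/
def openStar (x : deltaSurface P T) : Set (deltaSurface P T) :=
  {y | facetsAt P (y : Euc d) ⊆ facetsAt P (x : Euc d)}

lemma self_mem_openStar (x : deltaSurface P T) : x ∈ openStar x := Set.Subset.rfl

lemma openStar_subset {x y : deltaSurface P T} (h : y ∈ openStar x) : openStar y ⊆ openStar x :=
  fun _ hz => Set.Subset.trans hz h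

namespace IsTiling
variable (hT : IsTiling P T)
include hT

lemma proj_eq_iff' {x y : deltaSurface P T} :
    proj P T x = proj P T y ↔ x = y ∨ x = hT.negMap y := by
  rw [proj_eq_iff, Subtype.ext_iff, Subtype.ext_iff]
  rfl

@[simp] lemma proj_negMap (x : deltaSurface P T) : proj P T (hT.negMap x) = proj P T x :=
  hT.proj_eq_iff'.2 (Or.inr rfl)

lemma isOpen_openStar (x : deltaSurface P T) : IsOpen (openStar x) := by
  rw [isOpen_iff_mem_nhds]
  intro y hy
  filter_upwards [continuous_subtype_val.continuousAt.eventually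
    (hT.isSymmPolytope.eventually_facetsAt_subset (hT.mem y))] with z hz
  exact hz.trans hy

lemma isOpenMap_proj : IsOpenMap (proj P T) := by
  intro U hU
  refine (isQuotientMap_quotient_mk' (s := antipodal P T)).isOpen_preimage.1 ?_
  have : Quotient.mk' (s := antipodal P T) ⁻¹' (proj P T '' U) = U ∪ hT.negMap ⁻¹' U := by
    ext x
    constructor
    · rintro ⟨y, hy, h⟩
      rcases hT.proj_eq_iff'.1 h with rfl | rfl
      · exact Or.inl hy
      · exact Or.inr hy
    · rintro (h | h)
      · exact ⟨x, h, rfl⟩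
      · exact ⟨_, h, hT.proj_negMap x⟩
  rw [this]
  exact hU.union (hU.preimage hT.negMap.continuous)

lemma negMap_notMem_openStar {x y : deltaSurface P T} (hy : y ∈ openStar x) :
    hT.negMap y ∉ openStar x := by
  have hP := hT.isSymmPolytope
  intro h
  obtain ⟨F, hF⟩ := hT.nonempty y
  exact hP.opp_notMem_facetsAt (hT.mem x) (hy hF) (h (by rwa [hT.mem_facetsAt_negMap, hP.opp_opp]))

lemma injOn_proj (x : deltaSurface P T) : Set.InjOn (proj P T) (openStar x) := by
  intro y hy z hz h
  rcases hT.proj_eq_iff'.1 h with h | rfl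
  · exact h
  · exact absurd hy (hT.negMap_notMem_openStar hz)

/-- A path in the image of an open star lifts to the open star. -/
lemma exists_lift {x : deltaSurface P T} {γ : C(I, PiSurface P T)}
    (hγ : ∀ t, γ t ∈ proj P T '' openStar x) : ∃ γ' : C(I, deltaSurface P T),
      (∀ t, γ' t ∈ openStar x) ∧ (proj P T).comp γ' = γ := by
  let f : openStar x → PiSurface P T := fun y => proj P T y
  have hf : IsOpenEmbedding f := by
    refine .of_continuous_injective_isOpenMap (by fun_prop) (hT.injOn_proj x).injective ?_
    exact hT.isOpenMap_proj.comp (hT.isOpen_openStar x).isOpenMap_subtype_val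
  choose s hs hs' using hγ
  have hc : Continuous fun t => (⟨s t, hs t⟩ : openStar x) := by
    rw [hf.continuous_iff]
    convert! γ.continuous using 1
    exact funext hs'
  exact ⟨⟨s, continuous_subtype_val.comp hc⟩, hs, ContinuousMap.ext hs'⟩

/-- The open stars are star-shaped. -/
lemma segment_mem {x y : deltaSurface P T} (hy : y ∈ openStar x) (s : I) :
    (1 - (s : ℝ)) • (x : Euc d) + (s : ℝ) • (y : Euc d) ∈ deltaSurface P T ∧
      facetsAt P ((1 - (s : ℝ)) • (x : Euc d) + (s : ℝ) • (y : Euc d)) ⊆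
        facetsAt P (x : Euc d) := by
  have hP := hT.isSymmPolytope
  have hmem : (1 - (s : ℝ)) • (x : Euc d) + (s : ℝ) • (y : Euc d) ∈ P :=
    hP.convex (hT.mem x) (hT.mem y) (by linarith [s.2.2]) s.2.1 (by ring)
  have hsub := hP.facetsAt_segment_subset (hT.mem x) (hT.mem y) hy s.2.1 s.2.2
  refine ⟨hT.mem_deltaSurface_of_subset x.2 hmem ?_ hsub, hsub⟩
  obtain ⟨F, hF⟩ := hT.nonempty y
  refine ⟨F, (hP.mem_facetsAt_iff hmem).2 ?_⟩
  rw [inner_add_right, inner_smul_right, inner_smul_right,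
    (hP.mem_facetsAt_iff (hT.mem x)).1 (hy hF),
    (hP.mem_facetsAt_iff (hT.mem y)).1 hF]
  ring

open Classical in
/-- The segment from `x` to a point `y` of its open star, as a path on the `π`-surface. -/
def segmentPath (x y : deltaSurface P T) : C(I, PiSurface P T) :=
  if h : y ∈ openStar x then
    (proj P T).comp ⟨fun s => ⟨_, (hT.segment_mem h s).1⟩, by fun_prop⟩
  else .const _ (proj P T x)

lemma segmentPath_negMap {x y : deltaSurface P T} (hy : y ∈ openStar x) :
    hT.segmentPath (hT.negMap x) (hT.negMap y) = hT.segmentPath x y := by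
  have hy' : hT.negMap y ∈ openStar (hT.negMap x) := fun F hF =>
    hT.mem_facetsAt_negMap.2 (hy (hT.mem_facetsAt_negMap.1 hF))
  rw [segmentPath, segmentPath, dif_pos hy, dif_pos hy']
  ext s
  refine proj_eq_iff.2 (Or.inr ?_)
  simp only [ContinuousMap.coe_mk, coe_negMap]
  module

/-- A path cocycle on the `π`-surface has a potential on every open star. -/
lemma eq_sub_of_mem_openStar {g : C(I, PiSurface P T) → ℚ} (hg : IsPathCocycle g)
    {x : deltaSurface P T} (γ : C(I, deltaSurface P T)) (hγ : ∀ t, γ t ∈ openStar x) :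
    g ((proj P T).comp γ) = g (hT.segmentPath x (γ 1)) - g (hT.segmentPath x (γ 0)) := by
  let K : C(I × I, PiSurface P T) :=
    (proj P T).comp ⟨fun p => ⟨_, (hT.segment_mem (hγ p.2) p.1).1⟩, by fun_prop⟩
  have := hg.cone K (x := proj P T x) (fun t => congrArg (proj P T) (Subtype.ext (by simp)))
  have e1 : K.comp (squarePath (1, 0) (1, 1)) = (proj P T).comp γ := by
    ext t
    exact congrArg (proj P T) (Subtype.ext (by simp [squarePath]))
  have e2 (r : I) : K.comp (squarePath (0, r) (1, r)) = hT.segmentPath x (γ r) := by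
    rw [segmentPath, dif_pos (hγ r)]
    ext t
    exact congrArg (proj P T) (Subtype.ext (by simp [squarePath]))
  rwa [e1, e2, e2] at this

/-- The potentials on open stars are compatible with each other. -/
lemma segmentPath_sub_eq {g : C(I, PiSurface P T) → ℚ} (hg : IsPathCocycle g)
    {x x' y z : deltaSurface P T} (hx : x ∈ openStar x') (hy : y ∈ openStar x)
    (hz : z ∈ openStar x) :
    g (hT.segmentPath x' y) - g (hT.segmentPath x' z) =
      g (hT.segmentPath x y) - g (hT.segmentPath x z) := by
  have key {y : deltaSurface P T} (hy : y ∈ openStar x) :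
      g (hT.segmentPath x' y) - g (hT.segmentPath x' x) = g (hT.segmentPath x y) := by
    have h := hT.eq_sub_of_mem_openStar hg (x := x')
      ⟨fun s => ⟨_, (hT.segment_mem hy s).1⟩, by fun_prop⟩
      fun s => openStar_subset hx (hT.segment_mem hy s).2
    rw [show hT.segmentPath x y = _ from dif_pos hy, h]
    congr 3
    · exact Subtype.ext (by simp)
    · exact Subtype.ext (by simp)
  linarith [key hy, key hz]

end IsTiling
end

/-! ### Realisation of sequences of facets by generic paths -/

section

open Topology Module
variable {d : ℕ}

/-- The polygonal line with vertices `w 0, …, w n`, which is at `w j` at time `j`. -/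
def polyline (w : ℕ → Euc d) (n : ℕ) (s : ℝ) : Euc d :=
  w 0 + ∑ j ∈ Finset.range n, max 0 (min 1 (s - j)) • (w (j + 1) - w j)

lemma continuous_polyline (w : ℕ → Euc d) (n : ℕ) : Continuous (polyline w n) := by
  unfold polyline
  fun_prop

lemma polyline_eq (w : ℕ → Euc d) {n j : ℕ} (hj : j < n) {s : ℝ} (h0 : j ≤ s) (h1 : s ≤ j + 1) :
    polyline w n s = (1 - (s - j)) • w j + (s - j) • w (j + 1) := by
  have e1 : ∑ i ∈ Finset.range n, max 0 (min 1 (s - i)) • (w (i + 1) - w i) =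
      ∑ i ∈ Finset.range (j + 1), max 0 (min 1 (s - i)) • (w (i + 1) - w i) := by
    symm
    refine Finset.sum_subset (Finset.range_subset_range.2 hj) fun i _ hi => ?_
    have h2 : (j + 1 : ℝ) ≤ i := by
      rw [Finset.mem_range, not_lt] at hi
      exact_mod_cast hi
    rw [max_eq_left ((min_le_right _ _).trans (by linarith)), zero_smul]
  have e2 : ∑ i ∈ Finset.range j, max 0 (min 1 (s - i)) • (w (i + 1) - w i) = w j - w 0 := by
    rw [← Finset.sum_range_sub]
    refine Finset.sum_congr rfl fun i hi => ?_
    have h2 : (i + 1 : ℝ) ≤ j := by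
      rw [Finset.mem_range] at hi
      exact_mod_cast hi
    rw [min_eq_left (by linarith), max_eq_right zero_le_one, one_smul]
  rw [polyline, e1, Finset.sum_range_succ, e2, min_eq_right (by linarith),
    max_eq_right (by linarith)]
  module

lemma isPiecewiseLinear_polyline (w : ℕ → Euc d) {n : ℕ} (hn : 0 < n) :
    IsPiecewiseLinear fun t : I => polyline w n (n * t) := by
  classical
  have hn' : (0 : ℝ) < n := by exact_mod_cast hn
  refine ⟨(Finset.range (n + 1)).image fun j : ℕ => Set.projIcc (0 : ℝ) 1 zero_le_one (j / n),
    fun a t b hat htb hS => ?_⟩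
  have hat' : (a : ℝ) ≤ t := hat
  have htb' : (t : ℝ) ≤ b := htb
  rcases (hat.trans htb).eq_or_lt with rfl | hab
  · rw [show (t : ℝ) = a from le_antisymm htb' hat']
    simp
  have hab' : (a : ℝ) < b := hab
  have ha0 : 0 ≤ n * (a : ℝ) := mul_nonneg hn'.le a.2.1
  obtain ⟨j, hj⟩ : ∃ j, j = ⌊n * (a : ℝ)⌋₊ := ⟨_, rfl⟩
  have hj0 : (j : ℝ) ≤ n * a := by rw [hj]; exact Nat.floor_le ha0
  have hj1 : n * (a : ℝ) < j + 1 := by rw [hj]; exact Nat.lt_floor_add_one _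
  have hjn : j < n := by
    have h1 : (a : ℝ) < 1 := hab'.trans_le b.2.2
    have : (j : ℝ) < n := by nlinarith
    exact_mod_cast this
  have hjn' : (j + 1 : ℝ) ≤ n := by exact_mod_cast hjn
  have hb : n * (b : ℝ) ≤ j + 1 := by
    by_contra! hlt
    refine hS _ (Finset.mem_image.2 ⟨j + 1, Finset.mem_range.2 (by omega), rfl⟩) ?_
    have e : (Set.projIcc (0 : ℝ) 1 zero_le_one ((j + 1 : ℕ) / n) : ℝ) = (j + 1) / n := by
      rw [Set.projIcc_of_mem zero_le_one (x := ((j + 1 : ℕ) : ℝ) / n)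
        ⟨by positivity, by push_cast; rw [div_le_one hn']; exact hjn'⟩]
      push_cast; rfl
    rw [← Subtype.coe_lt_coe, ← Subtype.coe_lt_coe, e, lt_div_iff₀ hn', div_lt_iff₀ hn']
    constructor <;> linarith
  have h1 : n * (a : ℝ) ≤ n * t := by gcongr
  have h2 : n * (t : ℝ) ≤ n * b := by gcongr
  simp only
  rw [polyline_eq w hjn (s := n * a) hj0 hj1.le, polyline_eq w hjn (s := n * t) (by linarith)
    (by linarith), polyline_eq w hjn (s := n * b) (by linarith) hb]
  module

lemma lt_of_projIcc_lt {a : ℝ} {t : I} (h : Set.projIcc (0 : ℝ) 1 zero_le_one a < t) :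
    a < t := by
  rw [← Subtype.coe_lt_coe, Set.coe_projIcc, max_lt_iff, min_lt_iff] at h
  exact h.2.resolve_left (not_lt.2 t.2.2)

lemma lt_of_lt_projIcc {a : ℝ} {t : I} (h : t < Set.projIcc (0 : ℝ) 1 zero_le_one a) :
    t < a := by
  rw [← Subtype.coe_lt_coe, Set.coe_projIcc, lt_max_iff, lt_min_iff] at h
  exact (h.resolve_left (not_lt.2 t.2.1)).2

namespace IsTiling
variable {P T : Set (Euc d)} (hT : IsTiling P T)
include hT

/-- Every sequence of facets such that consecutive ones meet in a primitive face of codimension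
two is the sequence of facets of a generic path with given end points. -/
theorem exists_isGenericPath {k : ℕ} (hk : 0 < k) (F : Fin (k + 1) → Facet P)
    (hF : ∀ i : Fin k, F i.castSucc ≠ F i.succ ∧
      IsPrimitive P T ((F i.castSucc).1 ∩ (F i.succ).1)) {p q : Euc d}
    (hp : p ∈ P) (hpF : facetsAt P p = {F 0}) (hq : q ∈ P)
    (hqF : facetsAt P q = {F (Fin.last k)}) :
    ∃ γ : C(I, deltaSurface P T), IsGenericPath γ F ∧ (γ 0 : Euc d) = p ∧ (γ 1 : Euc d) = q := by
  have hP := hT.isSymmPolytope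
  let H : ℕ → Facet P := fun n => F ⟨min n k, by omega⟩
  have hH (i : Fin (k + 1)) : H i = F i := congrArg F (Fin.ext (min_eq_left (by omega)))
  have hH0 (i : Fin k) : H i = F i.castSucc := hH i.castSucc
  have hH1 (i : Fin k) : H (i + 1) = F i.succ := hH i.succ
  have hHk : H k = F (Fin.last k) := hH (Fin.last k)
  have hm (n : ℕ) : ∃ x : Euc d, n < k → x ∈ P ∧ facetsAt P x = {H n, H (n + 1)} := by
    by_cases hn : n < k
    · obtain ⟨h1, h2⟩ := hF ⟨n, hn⟩
      obtain ⟨x, hx⟩ := hP.exists_facetsAt_eq_pair h1 h2.1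
      exact ⟨x, fun _ => by rw [hH0 ⟨n, hn⟩, hH1 ⟨n, hn⟩]; exact hx⟩
    · exact ⟨0, fun h => absurd h hn⟩
  choose m hm using hm
  have hc (n : ℕ) : ∃ x : Euc d, x ∈ P ∧ facetsAt P x = {H n} ∧ (n = 0 → x = p) ∧
      (n = k → x = q) := by
    by_cases h0 : n = 0
    · exact ⟨p, hp, by rw [hpF, h0]; exact congrArg _ (hH 0).symm, fun _ => rfl, by omega⟩
    by_cases h1 : n = k
    · exact ⟨q, hq, by rw [hqF, h1, hHk], by omega, fun _ => rfl⟩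
    obtain ⟨x, hx, h⟩ := hP.exists_facetsAt_eq_singleton (H n)
    exact ⟨x, hx, h, by omega, by omega⟩
  -- The path alternates between points `c` in facets and points `m` in faces of codimension two.
  choose c hcP hcF hc0 hck using hc
  let w : ℕ → Euc d := fun j => if Even j then c (j / 2) else m (j / 2)
  have hw0 (n : ℕ) : w (2 * n) = c n := by simp [w]
  have hw1 (n : ℕ) : w (2 * n + 1) = m n := by
    have h1 : ¬ Even (2 * n + 1) := by simp
    have h2 : (2 * n + 1) / 2 = n := by omega
    simp only [w, if_neg h1, h2]
  have hn : 0 < 2 * k := by omega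
  have hend : polyline w (2 * k) (2 * k) = q := by
    rw [polyline_eq w (j := 2 * k - 1) (by omega)
      (by rw [Nat.cast_sub (by omega)]; push_cast; linarith)
      (by rw [Nat.cast_sub (by omega)]; push_cast; linarith), Nat.cast_sub (by omega),
      show 2 * k - 1 + 1 = 2 * k by omega, hw0, hck k rfl]
    push_cast
    module
  have hstart : polyline w (2 * k) 0 = p := by
    rw [polyline_eq w (j := 0) hn (by simp) (by simp), ← hc0 0 rfl, ← hw0 0]
    simp
  -- the points inside of the facet `H i`
  have hA (i : ℕ) (hi : i ≤ k) (s : ℝ) (hs0 : 0 ≤ s) (hs1 : s ≤ 2 * k) (h1 : 2 * i - 1 < s)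
      (h2 : s < 2 * i + 1) :
      polyline w (2 * k) s ∈ P ∧ facetsAt P (polyline w (2 * k) s) = {H i} := by
    rcases le_or_gt (2 * i : ℝ) s with h | h
    · rcases hi.eq_or_lt with rfl | hi
      · rw [show s = 2 * i by linarith, hend, hHk]
        exact ⟨hq, hqF⟩
      · rw [polyline_eq w (j := 2 * i) (by omega) (by push_cast; exact h) (by push_cast; linarith),
          hw0, hw1]
        push_cast
        refine ⟨hP.convex (hcP i) (hm i hi).1 (by linarith) (by linarith) (by ring), ?_⟩
        rcases h.eq_or_lt with h | h
        · rw [← h]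
          simp [hcF]
        · rw [hP.facetsAt_segment_eq (hcP i) (hm i hi).1 (by linarith) (by linarith), hcF,
            (hm i hi).2]
          simp
    · have hi0 : 0 < i := by
        rcases Nat.eq_zero_or_pos i with rfl | h
        · simp at h; linarith
        · exact h
      obtain ⟨i, rfl⟩ := Nat.exists_eq_add_of_lt hi0
      rw [zero_add] at *
      push_cast at h h1
      rw [polyline_eq w (j := 2 * i + 1) (by omega) (by push_cast; linarith)
        (by push_cast; linarith), hw1, show 2 * i + 1 + 1 = 2 * (i + 1) by ring, hw0]
      push_cast
      have hmi := hm i (by omega)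
      refine ⟨hP.convex hmi.1 (hcP _) (by linarith) (by linarith) (by ring), ?_⟩
      rw [hP.facetsAt_segment_eq hmi.1 (hcP _) (by linarith) (by linarith), hcF, hmi.2]
      simp
  have hB (i : ℕ) (hi : i < k) : polyline w (2 * k) (2 * i + 1) = m i := by
    rw [polyline_eq w (j := 2 * i) (by omega) (by push_cast; linarith)
      (by push_cast; linarith), hw1]
    push_cast
    module
  have hmem (t : I) : polyline w (2 * k) ((2 * k : ℕ) * t) ∈ deltaSurface P T := by
    have ht0 : 0 ≤ ((2 * k : ℕ) : ℝ) * t := mul_nonneg (Nat.cast_nonneg _) t.2.1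
    have ht1 : ((2 * k : ℕ) : ℝ) * t ≤ 2 * k := by
      have := mul_le_mul_of_nonneg_left t.2.2 (Nat.cast_nonneg (α := ℝ) (2 * k))
      push_cast at this ⊢
      linarith
    set s := ((2 * k : ℕ) : ℝ) * t
    obtain ⟨i, hi⟩ : ∃ i, i = ⌊(s + 1) / 2⌋₊ := ⟨_, rfl⟩
    have hi0 : (i : ℝ) ≤ (s + 1) / 2 := by rw [hi]; exact Nat.floor_le (by linarith)
    have hi1 : (s + 1) / 2 < i + 1 := by rw [hi]; exact Nat.lt_floor_add_one _
    have hik : i ≤ k := by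
      have : (i : ℝ) < k + 1 := by linarith
      exact Nat.lt_succ_iff.1 (by exact_mod_cast this)
    rcases (show (2 * i - 1 : ℝ) ≤ s by linarith).eq_or_lt with h | h
    · have hi0 : 0 < i := by
        rcases Nat.eq_zero_or_pos i with h' | h'
        · rw [h'] at h; simp at h; linarith
        · exact h'
      obtain ⟨i, rfl⟩ := Nat.exists_eq_add_of_lt hi0
      rw [show s = 2 * ((i : ℕ) : ℝ) + 1 by rw [← h]; push_cast; ring, hB i (by omega)]
      have hmi := hm i (by omega)
      refine hT.mem_deltaSurface_of_eq_pair hmi.1 hmi.2 ?_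
      rw [hH0 ⟨i, by omega⟩, hH1 ⟨i, by omega⟩]
      exact (hF _).2
    · obtain ⟨h1, h2⟩ := hA i hik s ht0 ht1 h (by linarith)
      exact hT.mem_deltaSurface_of_eq_singleton h1 h2
  have hc' := continuous_polyline w (2 * k)
  have hk' : (0 : ℝ) < k := by exact_mod_cast hk
  -- `c i` is at time `2 i / 2 k` and `m i` at time `(2 i + 1) / 2 k`; the projection to the unit
  -- interval makes the first and the last time equal to `0` and `1`.
  let τ : Fin (k + 2) → I := fun i => Set.projIcc 0 1 zero_le_one ((2 * (i : ℕ) - 1 : ℝ) / (2 * k))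
  refine ⟨⟨fun t => ⟨_, hmem t⟩, by fun_prop⟩, ⟨isPiecewiseLinear_polyline w hn, ?_, ?_, τ, ?_, ?_,
    ?_, fun i t h1 h2 => ?_, fun i => ⟨(hF i).1, (hF i).2, ?_⟩⟩, ?_, ?_⟩
  · refine hP.mem_intrinsicInterior_facet_iff.2 ?_
    simp only [ContinuousMap.coe_mk, Set.Icc.coe_zero, mul_zero, hstart]
    exact ⟨hp, hpF⟩
  · refine hP.mem_intrinsicInterior_facet_iff.2 ?_
    simp only [ContinuousMap.coe_mk, Set.Icc.coe_one, mul_one, Nat.cast_mul, Nat.cast_ofNat, hend]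
    exact ⟨hq, hqF⟩
  · intro i j hij
    have hij' : ((i : ℕ) : ℝ) + 1 ≤ (j : ℕ) := by exact_mod_cast hij
    have hj' : ((j : ℕ) : ℝ) ≤ k + 1 := by exact_mod_cast Nat.lt_succ_iff.1 j.2
    have hi' : (0 : ℝ) ≤ ((i : ℕ) : ℝ) := Nat.cast_nonneg _
    have h1 : (2 * ((i : ℕ) : ℝ) - 1) / (2 * k) < 1 := by
      rw [div_lt_one (by positivity)]; linarith
    have h2 : 0 < (2 * ((j : ℕ) : ℝ) - 1) / (2 * k) := div_pos (by linarith) (by positivity)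
    have h3 : (2 * ((i : ℕ) : ℝ) - 1) / (2 * k) < (2 * ((j : ℕ) : ℝ) - 1) / (2 * k) := by
      gcongr
      exact hij
    rw [← Subtype.coe_lt_coe, Set.coe_projIcc, Set.coe_projIcc]
    exact max_lt (lt_max_of_lt_right (lt_min one_pos h2))
      (lt_max_of_lt_right (lt_min (min_lt_of_right_lt h1) (min_lt_of_right_lt h3)))
  · refine Set.projIcc_of_le_left zero_le_one ?_
    exact div_nonpos_of_nonpos_of_nonneg (by simp) (by positivity)
  · refine Set.projIcc_of_right_le zero_le_one ?_
    rw [Fin.val_last, one_le_div (by positivity)]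
    push_cast
    linarith
  · refine hP.mem_intrinsicInterior_facet_iff.2 ?_
    have h1 := lt_of_projIcc_lt h1
    have h2 := lt_of_lt_projIcc h2
    rw [div_lt_iff₀ (by positivity), Fin.val_castSucc] at h1
    rw [lt_div_iff₀ (by positivity), Fin.val_succ] at h2
    push_cast at h2
    rw [← hH i]
    have := mul_le_mul_of_nonneg_left t.2.2 (show (0 : ℝ) ≤ 2 * k by positivity)
    have := mul_nonneg (show (0 : ℝ) ≤ 2 * k by positivity) t.2.1
    exact hA i (by omega) _ (by push_cast; linarith) (by push_cast; linarith)
      (by push_cast; linarith) (by push_cast; linarith)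
  · rw [hP.mem_intrinsicInterior_inter_iff (hF i).1 (hF i).2.1, ← hH0, ← hH1]
    have e : ((2 * k : ℕ) : ℝ) * (τ i.castSucc.succ : ℝ) = 2 * (i : ℕ) + 1 := by
      have hi' : ((i : ℕ) : ℝ) + 1 ≤ k := by exact_mod_cast i.2
      have hi0 : (0 : ℝ) ≤ ((i : ℕ) : ℝ) := Nat.cast_nonneg _
      simp only [τ]
      rw [Set.projIcc_of_mem zero_le_one ⟨div_nonneg (by simp; linarith) (by positivity), by
        rw [div_le_one (by positivity)]; simp; linarith⟩]
      simp only [Fin.val_succ, Fin.val_castSucc]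
      push_cast
      rw [mul_div_cancel₀ _ (by positivity)]
      ring
    simp only [ContinuousMap.coe_mk]
    rw [e, hB i i.2]
    exact hm i i.2
  · simp only [ContinuousMap.coe_mk, Set.Icc.coe_zero, mul_zero, hstart]
  · simp only [ContinuousMap.coe_mk, Set.Icc.coe_one, mul_one, Nat.cast_mul, Nat.cast_ofNat, hend]

end IsTiling
end

/-! ### Values of path cocycles on generic paths -/

section

open Topology Module
variable {d : ℕ}

/-- A subdivision of `I` evaluates a path cocycle as a sum. -/
lemma IsPathCocycle.eq_sum {X : Type} [TopologicalSpace X] {g : C(I, X) → ℚ} (hg : IsPathCocycle g)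
    (γ : C(I, X)) {k : ℕ} (u : Fin (k + 1) → I) : g γ = g (subpath γ 0 (u 0)) +
      ∑ i : Fin k, g (subpath γ (u i.castSucc) (u i.succ)) + g (subpath γ (u (Fin.last k)) 1) := by
  have h (a b : I) : g (subpath γ a b) = g (subpath γ 0 b) - g (subpath γ 0 a) := by
    rw [hg.subpath_trans γ 0 a b]; ring
  have h1 := Fin.sum_univ_succ fun i => g (subpath γ 0 (u i))
  rw [Fin.sum_univ_castSucc] at h1
  rw [Finset.sum_congr rfl fun i _ => h (u i.castSucc) (u i.succ), h (u (Fin.last k)) 1,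
    Finset.sum_sub_distrib, subpath_zero_one]
  linarith

/-- The value of a path cocycle on a generic path is determined by its values on the paths inside
of a facet and on the paths that cross a single face of codimension two. -/
theorem IsGenericPath.eq_sum {P T : Set (Euc d)} (hP : IsSymmPolytope P)
    {γ : C(I, deltaSurface P T)} {k : ℕ} {F : Fin (k + 1) → Facet P} (hγ : IsGenericPath γ F)
    {g : C(I, PiSurface P T) → ℚ} (hg : IsPathCocycle g) (B : deltaSurface P T → ℚ)
    (w : Facet P → Facet P → ℚ)
    (hB : ∀ (F : Facet P) (s : C(I, deltaSurface P T)), (∀ t, facetsAt P (s t : Euc d) = {F}) →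
      g ((proj P T).comp s) = B (s 1) - B (s 0))
    (hw : ∀ F F' : Facet P, F ≠ F' → IsPrimitive P T (F.1 ∩ F'.1) →
      ∀ s : C(I, deltaSurface P T), (∀ t, facetsAt P (s t : Euc d) ⊆ {F, F'}) →
      facetsAt P (s 0 : Euc d) = {F} → facetsAt P (s 1 : Euc d) = {F'} →
      g ((proj P T).comp s) = B (s 1) - B (s 0) + w F F') :
    g ((proj P T).comp γ) = B (γ 1) - B (γ 0) + ∑ i : Fin k, w (F i.castSucc) (F i.succ) := by
  obtain ⟨-, h0, h1, τ, hτ, hτ0, hτ1, hin, hcross⟩ := hγ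
  have hmem {t : I} {G : Facet P} (h : (γ t : Euc d) ∈ intrinsicInterior ℝ G.1) :
      facetsAt P (γ t : Euc d) = {G} := (hP.mem_intrinsicInterior_facet_iff.1 h).2
  have hu (i : Fin (k + 1)) : ∃ u : I, τ i.castSucc < u ∧ u < τ i.succ :=
    exists_between (hτ i.castSucc_lt_succ)
  choose u hu0 hu1 using hu
  have hsub (a b : I) : subpath ((proj P T).comp γ) a b = (proj P T).comp (subpath γ a b) := rfl
  have hstart : g (subpath ((proj P T).comp γ) 0 (u 0)) = B (γ (u 0)) - B (γ 0) := by
    rw [hsub, hB (F 0), subpath_one, subpath_zero]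
    intro t
    obtain ⟨h2, h3⟩ := affinePath_mem_Icc (a := 0) (b := u 0) (Subtype.coe_le_coe.1 (u 0).2.1) t
    change facetsAt P (γ (affinePath 0 (u 0) t) : Euc d) = _
    rcases h2.eq_or_lt with h2 | h2
    · rw [← h2]; exact hmem h0
    · exact hmem (hin 0 _ (by rw [Fin.castSucc_zero, hτ0]; exact h2) (h3.trans_lt (hu1 0)))
  have hend : g (subpath ((proj P T).comp γ) (u (Fin.last k)) 1) =
      B (γ 1) - B (γ (u (Fin.last k))) := by
    rw [hsub, hB (F (Fin.last k)), subpath_one, subpath_zero]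
    intro t
    obtain ⟨h2, h3⟩ := affinePath_mem_Icc (a := u (Fin.last k)) (b := 1)
      (Subtype.coe_le_coe.1 (u _).2.2) t
    change facetsAt P (γ (affinePath (u (Fin.last k)) 1 t) : Euc d) = _
    rcases h3.eq_or_lt with h3 | h3
    · rw [h3]; exact hmem h1
    · exact hmem (hin (Fin.last k) _ ((hu0 _).trans_le h2) (by
        rw [Fin.succ_last, hτ1]; exact h3))
  have hmid (i : Fin k) : g (subpath ((proj P T).comp γ) (u i.castSucc) (u i.succ)) =
      B (γ (u i.succ)) - B (γ (u i.castSucc)) + w (F i.castSucc) (F i.succ) := by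
    obtain ⟨hne, hprim, hx⟩ := hcross i
    rw [hsub, hw _ _ hne hprim, subpath_one, subpath_zero]
    · intro t
      have hlt : u i.castSucc < u i.succ := (hu1 i.castSucc).trans (by
        rw [Fin.succ_castSucc]; exact hu0 i.succ)
      obtain ⟨h2, h3⟩ := affinePath_mem_Icc hlt.le t
      change facetsAt P (γ (affinePath (u i.castSucc) (u i.succ) t) : Euc d) ⊆ _
      rcases lt_trichotomy (affinePath (u i.castSucc) (u i.succ) t)
        (τ i.castSucc.succ) with h | h | h
      · rw [hmem (hin i.castSucc _ ((hu0 _).trans_le h2) h)]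
        simp
      · rw [h, ((hP.mem_intrinsicInterior_inter_iff hne hprim.1).1 hx).2]
      · rw [hmem (hin i.succ _ (by rwa [← Fin.succ_castSucc]) (h3.trans_lt (hu1 _)))]
        simp
    · rw [subpath_zero]; exact hmem (hin _ _ (hu0 _) (hu1 _))
    · rw [subpath_one]; exact hmem (hin _ _ (hu0 _) (hu1 _))
  rw [hg.eq_sum _ u, hstart, hend, Finset.sum_congr rfl fun i _ => hmid i,
    Finset.sum_add_distrib, Finset.sum_sub_distrib]
  have h2 := Fin.sum_univ_succ fun i => B (γ (u i))
  rw [Fin.sum_univ_castSucc] at h2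
  linarith

end

/-! ### The facet graph and its quotient, the red Venkov graph -/

section

open Topology Module
variable {d : ℕ} {P T : Set (Euc d)}

/-- The graph on the facets, in which two facets are adjacent if they meet in a primitive face of
codimension two. It is a covering of the red Venkov graph. -/
def facetGraph (P T : Set (Euc d)) : SimpleGraph (Facet P) where
  Adj F F' := F ≠ F' ∧ IsPrimitive P T (F.1 ∩ F'.1)
  symm := ⟨fun F F' h => ⟨h.1.symm, by rw [Set.inter_comm]; exact h.2⟩⟩
  loopless := ⟨fun _ h => h.1 rfl⟩

namespace IsTiling
variable (hT : IsTiling P T)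
include hT

lemma facetGraph_adj_opp {F F' : Facet P} (h : (facetGraph P T).Adj F F') :
    (facetGraph P T).Adj (hT.isSymmPolytope.opp F) (hT.isSymmPolytope.opp F') := by
  have hP := hT.isSymmPolytope
  refine ⟨fun h' => h.1 (by rw [← hP.opp_opp F, h', hP.opp_opp]), ?_⟩
  have := hT.isPrimitive_neg h.2
  rwa [Set.inter_neg] at this

lemma not_facetGraph_adj_opp {F F' : Facet P} (h : (facetGraph P T).Adj F F') :
    ¬ (facetGraph P T).Adj F (hT.isSymmPolytope.opp F') :=
  fun h' => hT.not_isPrimitive_of_inter_opp h.2 h'.2.1.1 h.1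

lemma pair_adj {F F' : Facet P} (h : (facetGraph P T).Adj F F') :
    (redVenkovGraph P T).Adj F.pair F'.pair := by
  have hP := hT.isSymmPolytope
  refine ⟨fun h' => ?_, F.1, Set.mem_insert _ _, F'.1, Set.mem_insert _ _, h.2⟩
  rcases hP.pair_eq_pair_iff.1 h' with rfl | rfl
  · exact h.1 rfl
  · obtain ⟨x, hx, hx'⟩ := h.2.1.1
    exact hP.opp_notMem_facetsAt (F'.subset hx') (F := F') hx' hx

lemma exists_facetGraph_adj {v v' : FacetPair P} (h : (redVenkovGraph P T).Adj v v') {F : Facet P}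
    (hF : F.pair = v) : ∃ F' : Facet P, F'.pair = v' ∧ (facetGraph P T).Adj F F' := by
  have hP := hT.isSymmPolytope
  obtain ⟨hne, A, hA, B, hB, hAB⟩ := h
  have key {A : Set (Euc d)} {v : FacetPair P} (hA : A ∈ v.1) :
      ∃ F : Facet P, F.1 = A ∧ F.pair = v := by
    obtain ⟨s, F, rfl⟩ := v
    rcases hA with rfl | rfl
    · exact ⟨F, rfl, rfl⟩
    · exact ⟨hP.opp F, rfl, hP.pair_opp F⟩
  obtain ⟨F₁, rfl, h1⟩ := key hA
  obtain ⟨F₂, rfl, h2⟩ := key hB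
  have hadj : (facetGraph P T).Adj F₁ F₂ :=
    ⟨fun h => hne (by rw [← h1, ← h2, h]), hAB⟩
  rcases hP.pair_eq_pair_iff.1 (hF.trans h1.symm) with rfl | rfl
  · exact ⟨F₂, h2, hadj⟩
  · exact ⟨hP.opp F₂, (hP.pair_opp F₂).trans h2, hT.facetGraph_adj_opp hadj⟩

lemma exists_walk_lift {v v' : FacetPair P} (p : (redVenkovGraph P T).Walk v v') {F : Facet P}
    (hF : F.pair = v) : ∃ (F' : Facet P) (q : (facetGraph P T).Walk F F'), F'.pair = v' ∧
      walkSum edgeChain p = walkSum (fun G G' => edgeChain G.pair G'.pair) q := by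
  induction p generalizing F with
  | nil => exact ⟨F, .nil, hF, rfl⟩
  | cons h p ih =>
    obtain ⟨F₁, h1, hadj⟩ := hT.exists_facetGraph_adj h hF
    obtain ⟨F', q, h2, h3⟩ := ih h1
    refine ⟨F', .cons hadj q, h2, ?_⟩
    rw [walkSum_cons, walkSum_cons, h3, hF, h1]

end IsTiling

lemma IsGenericLoop.eq_comp {γ : C(I, PiSurface P T)} {k : ℕ} {F : Fin (k + 1) → Facet P}
    (h : IsGenericLoop γ F) :
    ∃ γ' : C(I, deltaSurface P T), γ = (proj P T).comp γ' ∧ IsGenericPath γ' F ∧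
      proj P T (γ' 0) = proj P T (γ' 1) := by
  obtain ⟨h0, γ', hγ', hF⟩ := h
  have e : γ = (proj P T).comp γ' := ContinuousMap.ext fun t => (hγ' t).symm
  exact ⟨γ', e, hF, by rw [e] at h0; exact h0⟩

lemma IsGenericPath.adj {γ : C(I, deltaSurface P T)} {k : ℕ} {F : Fin (k + 1) → Facet P}
    (h : IsGenericPath γ F) (i : Fin k) : (facetGraph P T).Adj (F i.castSucc) (F i.succ) := by
  obtain ⟨-, -, -, τ, -, -, -, -, h⟩ := h
  exact ⟨(h i).1, (h i).2.1⟩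

lemma IsGenericPath.facetsAt_zero (hP : IsSymmPolytope P) {γ : C(I, deltaSurface P T)} {k : ℕ}
    {F : Fin (k + 1) → Facet P} (h : IsGenericPath γ F) : facetsAt P (γ 0 : Euc d) = {F 0} :=
  (hP.mem_intrinsicInterior_facet_iff.1 h.2.1).2

lemma IsGenericPath.facetsAt_one (hP : IsSymmPolytope P) {γ : C(I, deltaSurface P T)} {k : ℕ}
    {F : Fin (k + 1) → Facet P} (h : IsGenericPath γ F) :
    facetsAt P (γ 1 : Euc d) = {F (Fin.last k)} :=
  (hP.mem_intrinsicInterior_facet_iff.1 h.2.2.1).2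

namespace IsTiling
variable (hT : IsTiling P T)
include hT

lemma pair_last_eq {γ : C(I, PiSurface P T)} {k : ℕ} {F : Fin (k + 1) → Facet P}
    (h : IsGenericLoop γ F) : (F (Fin.last k)).pair = (F 0).pair := by
  have hP := hT.isSymmPolytope
  obtain ⟨γ', -, hF, h01⟩ := h.eq_comp
  rw [hP.pair_eq_pair_iff]
  have h0 := hF.facetsAt_zero hP
  have h1 := hF.facetsAt_one hP
  rcases hT.proj_eq_iff'.1 h01 with h | h
  · left
    rw [h, h1] at h0
    exact Set.singleton_injective h0
  · right
    have h2 : F 0 ∈ facetsAt P (γ' 0 : Euc d) := by simp [h0]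
    rw [h, hT.mem_facetsAt_negMap, h1] at h2
    rw [← Set.mem_singleton_iff.1 h2]

lemma exists_isGenericLoop {k : ℕ} (hk : 0 < k) (F : Fin (k + 1) → Facet P)
    (hF : ∀ i : Fin k, (facetGraph P T).Adj (F i.castSucc) (F i.succ))
    (h : (F (Fin.last k)).pair = (F 0).pair) : ∃ γ : C(I, PiSurface P T), IsGenericLoop γ F := by
  have hP := hT.isSymmPolytope
  obtain ⟨p, hp, hpF⟩ := hP.exists_facetsAt_eq_singleton (F 0)
  obtain ⟨q, hq, hqF, hpq⟩ : ∃ q ∈ P, facetsAt P q = {F (Fin.last k)} ∧ (p = q ∨ p = -q) := by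
    rcases hP.pair_eq_pair_iff.1 h with h | h
    · exact ⟨p, hp, by rw [hpF, h], Or.inl rfl⟩
    · refine ⟨-p, hP.neg_mem hp, ?_, Or.inr (neg_neg p).symm⟩
      ext G
      rw [hP.mem_facetsAt_neg_iff, hpF, h, Set.mem_singleton_iff, Set.mem_singleton_iff]
      exact ⟨fun h => by rw [← h, hP.opp_opp], fun h => by rw [h, hP.opp_opp]⟩
  obtain ⟨γ, hγ, h0, h1⟩ := hT.exists_isGenericPath hk F hF hp hpF hq hqF
  refine ⟨(proj P T).comp γ, ?_, γ, fun _ => rfl, hγ⟩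
  refine proj_eq_iff.2 ?_
  rwa [h0, h1]

lemma mem_cycleSpace_of_isIdentifiedWith {γ : C(I, PiSurface P T)}
    {c : FacetPair P × FacetPair P →₀ ℚ} (h : IsIdentifiedWith γ c) :
    c ∈ cycleSpace (redVenkovGraph P T) := by
  obtain ⟨k, F, hF, rfl⟩ := h
  obtain ⟨γ', -, hγ', -⟩ := hF.eq_comp
  refine mem_cycleSpace_iff.2 ⟨sum_mem fun i _ => edgeChain_mem (hT.pair_adj (hγ'.adj i)), ?_⟩
  rw [map_sum]
  simp only [boundary_edgeChain, Finset.sum_sub_distrib]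
  have h1 := Fin.sum_univ_succ fun i => Finsupp.single (F i).pair (1 : ℚ)
  rw [Fin.sum_univ_castSucc, hT.pair_last_eq hF, add_comm] at h1
  rw [add_left_cancel h1, sub_self]

/-- A choice of a facet through every point of the `δ`-surface that respects the symmetry. -/
lemma exists_selection : ∃ f : deltaSurface P T → Facet P,
    (∀ y : deltaSurface P T, f y ∈ facetsAt P (y : Euc d)) ∧
      ∀ y, f (hT.negMap y) = hT.isSymmPolytope.opp (f y) := by
  classical
  have hP := hT.isSymmPolytope
  choose s hs using hT.nonempty
  choose r hr using proj_surjective (P := P) (T := T)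
  have hne (y) : y ≠ hT.negMap y := fun h =>
    hT.negMap_notMem_openStar (self_mem_openStar y) (h ▸ self_mem_openStar y)
  refine ⟨fun y => if y = r (proj P T y) then s y else hP.opp (s (hT.negMap y)), fun y => ?_,
    fun y => ?_⟩
  · dsimp only
    split_ifs with h
    · exact hs y
    · have := hs (hT.negMap y)
      rwa [hT.mem_facetsAt_negMap] at this
  · simp only [hT.proj_negMap, hT.negMap_negMap]
    rcases hT.proj_eq_iff'.1 (hr (proj P T y)) with h | h
    · rw [h, if_pos rfl, if_neg (hne y).symm]
    · rw [h, if_pos rfl, if_neg (hne y), hP.opp_opp]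

end IsTiling
end

/-! ### Basic cycles span if half-belt cycles generate homology -/

section

open Topology Module
variable {d : ℕ} {P T : Set (Euc d)}

/-- `φ` is a potential at `x` of the function `w` on pairs of facets: `w` is the difference of the
values of `φ` whenever two facets at `x` meet in a face of codimension two. -/
def IsPotentialAt (w : Facet P → Facet P → ℚ) (φ : Facet P → ℚ) (x : Euc d) : Prop :=
  ∀ F ∈ facetsAt P x, ∀ F' ∈ facetsAt P x, F ≠ F' → IsFaceOfCodim P 2 (F.1 ∩ F'.1) →
    w F F' = φ F' - φ F

lemma IsPotentialAt.mono {w : Facet P → Facet P → ℚ} {φ : Facet P → ℚ} {x y : Euc d}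
    (h : IsPotentialAt w φ x) (hy : facetsAt P y ⊆ facetsAt P x) : IsPotentialAt w φ y :=
  fun F hF F' hF' => h F (hy hF) F' (hy hF')

/-- Two potentials at `x` differ by a constant. -/
lemma IsPotentialAt.sub_eq (hP : IsSymmPolytope P) {w : Facet P → Facet P → ℚ}
    {φ φ' : Facet P → ℚ} {x : Euc d} (hx : x ∈ P) (h : IsPotentialAt w φ x)
    (h' : IsPotentialAt w φ' x) {F F' : Facet P} (hF : F ∈ facetsAt P x)
    (hF' : F' ∈ facetsAt P x) : φ F - φ' F = φ F' - φ' F' :=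
  hP.facetsAt_connected hx (fun F => φ F - φ' F) (fun G hG G' hG' hne hc => by
    have h1 := h G hG G' hG' hne hc
    have h2 := h' G hG G' hG' hne hc
    linarith) hF hF'

namespace IsTiling
variable (hT : IsTiling P T)
include hT

/-- A functional on chains that vanishes on the basic cycles has a potential at every point of the
`δ`-surface: around a face of codimension three, it vanishes on the closed walks because of the
trivially contractible cycles. -/
lemma exists_isPotentialAt (L : (FacetPair P × FacetPair P →₀ ℚ) →ₗ[ℚ] ℚ)
    (hL : ∀ c ∈ basicCycles P T, L c = 0) (x : deltaSurface P T) :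
    ∃ φ, IsPotentialAt (fun F F' => L (edgeChain F.pair F'.pair)) φ (x : Euc d) := by
  have hP := hT.isSymmPolytope
  have hw (F F' : Facet P) : L (edgeChain F'.pair F.pair) = -L (edgeChain F.pair F'.pair) := by
    rw [edgeChain_symm, map_neg]
  refine hP.exists_potential_facetsAt _ hw x (hT.mem x) fun y hy hyx hc => ?_
  let Γ : SimpleGraph (Facet P) :=
    { Adj := fun F F' => F ∈ facetsAt P y ∧ F' ∈ facetsAt P y ∧ (facetGraph P T).Adj F F'
      symm := ⟨fun F F' h => ⟨h.2.1, h.1, h.2.2.symm⟩⟩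
      loopless := ⟨fun _ h => h.2.2.1 rfl⟩ }
  obtain ⟨φ, hφ⟩ := exists_potential (G := Γ) (fun F F' => L (edgeChain F.pair F'.pair)) hw
    (walkSum_closed_eq_zero _ fun F F' hadj p hp => by
      let q : Γ.Walk F F := .cons hadj p
      let H : Fin (q.length + 1) → Facet P := fun i => q.getVert i
      have hadj' (i : Fin q.length) : Γ.Adj (H i.castSucc) (H i.succ) :=
        q.adj_getVert_succ i.2
      have hlast : H (Fin.last q.length) = H 0 := q.getVert_length.trans q.getVert_zero.symm
      have hlen : q.length = p.length + 1 := rfl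
      obtain ⟨γ, hγ⟩ := hT.exists_isGenericLoop (k := q.length) (by omega) H
        (fun i => (hadj' i).2.2) (by rw [hlast])
      have hinj : Function.Injective fun i : Fin q.length => H i.castSucc := by
        -- a vertex of `q` before the last one is the last vertex of `p` or an earlier one
        have h0 (i : Fin q.length) : ∃ j, j ≤ p.length ∧ H i.castSucc = p.getVert j ∧
            (j + 1 = i ∨ (i : ℕ) = 0 ∧ j = p.length) := by
          rcases i with ⟨_ | i, hi⟩
          · exact ⟨p.length, le_rfl, p.getVert_length.symm, Or.inr ⟨rfl, rfl⟩⟩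
          · exact ⟨i, by omega, rfl, Or.inl rfl⟩
        intro i i' hii'
        obtain ⟨j, hj, h1, h2⟩ := h0 i
        obtain ⟨j', hj', h1', h2'⟩ := h0 i'
        have h3 : j = j' := hp.getVert_injOn hj hj' (h1.symm.trans (hii'.trans h1'))
        have := i.2
        have := i'.2
        exact Fin.ext (by omega)
      have hmem (i : Fin (q.length + 1)) : H i ∈ facetsAt P y := by
        induction i using Fin.lastCases with
        | last => rw [hlast]; exact (hadj' ⟨0, by omega⟩).1
        | cast i => exact (hadj' i).1
      have h1 : IsTriviallyContractible γ :=
        ⟨q.length, H, by omega, hγ, hlast, hinj, faceOf P y,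
          (hP.isFaceOfCodim_faceOf_iff hy).2 hc, fun i z hz => hz.2 (hmem i)⟩
      have h2 := hL _ ⟨γ, Or.inr h1, _, H, hγ, rfl⟩
      rw [map_sum] at h2
      have h3 := walkSum_eq_sum (fun F F' : Facet P => L (edgeChain F.pair F'.pair)) q
      rw [walkSum_cons] at h3
      rw [h3, ← h2]
      rfl)
  refine ⟨φ, fun F hF F' hF' hne hc2 => hφ F F' ⟨hF, hF', hne, ?_⟩⟩
  exact (hT.mem_deltaSurface_iff.1 x.2).2.2 F (hyx hF) F' (hyx hF') hne hc2

/-- Potentials at all points of the `δ`-surface define a path cocycle on the `π`-surface. -/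
theorem exists_isPathCocycle_of_potential (w : Facet P → Facet P → ℚ)
    (hopp : ∀ F F', w (hT.isSymmPolytope.opp F) (hT.isSymmPolytope.opp F') = w F F')
    (hpot : ∀ x : deltaSurface P T, ∃ φ, IsPotentialAt w φ (x : Euc d)) :
    ∃ g : C(I, PiSurface P T) → ℚ, IsPathCocycle g ∧ ∀ (γ : C(I, deltaSurface P T)) (k : ℕ)
      (F : Fin (k + 1) → Facet P), IsGenericPath γ F →
        g ((proj P T).comp γ) = ∑ i : Fin k, w (F i.castSucc) (F i.succ) := by
  classical
  have hP := hT.isSymmPolytope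
  choose φ hφ using hpot
  obtain ⟨f, hf, hf_neg⟩ := hT.exists_selection
  let ψ : deltaSurface P T → PiSurface P T → ℚ := fun x η =>
    if h : ∃ y ∈ openStar x, proj P T y = η then φ x (f h.choose) else 0
  have hψ {x y : deltaSurface P T} (hy : y ∈ openStar x) : ψ x (proj P T y) = φ x (f y) := by
    have h : ∃ z ∈ openStar x, proj P T z = proj P T y := ⟨y, hy, rfl⟩
    simp only [ψ, dif_pos h]
    rw [hT.injOn_proj x h.choose_spec.1 hy h.choose_spec.2]
  -- A preimage of a point of the `π`-surface is determined up to sign, and `φ` becomes a potential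
  -- at `-x` by symmetry.
  have hloc {x y : deltaSurface P T} (h : proj P T y ∈ proj P T '' openStar x) :
      ∃ θ, IsPotentialAt w θ (y : Euc d) ∧ ∀ z ∈ openStar y, ψ x (proj P T z) = θ (f z) := by
    obtain ⟨y', hy', h⟩ := h
    rcases hT.proj_eq_iff'.1 h with rfl | rfl
    · exact ⟨φ x, (hφ x).mono hy', fun z hz => hψ (openStar_subset hy' hz)⟩
    · have hmem {F : Facet P} (hF : F ∈ facetsAt P (y : Euc d)) :
          hP.opp F ∈ facetsAt P (x : Euc d) :=
        hy' (by rwa [hT.mem_facetsAt_negMap, hP.opp_opp])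
      refine ⟨fun F => φ x (hP.opp F), fun F hF F' hF' hne hc => ?_, fun z hz => ?_⟩
      · rw [← hopp]
        refine hφ x _ (hmem hF) _ (hmem hF') (fun h => hne ?_) ?_
        · rw [← hP.opp_opp F, h, hP.opp_opp]
        · have := hP.isFaceOfCodim_neg hc
          rwa [Set.inter_neg] at this
      · beta_reduce
        rw [← hf_neg, ← hψ, hT.proj_negMap]
        exact fun F hF => hy' (hT.mem_facetsAt_negMap.2 (hz (hT.mem_facetsAt_negMap.1 hF)))
  obtain ⟨g, hg, hgψ⟩ := exists_pathCocycle (fun x : deltaSurface P T => proj P T '' openStar x)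
    (fun x => hT.isOpenMap_proj _ (hT.isOpen_openStar x))
    (fun η => by
      obtain ⟨y, rfl⟩ := proj_surjective η
      exact ⟨y, y, self_mem_openStar y, rfl⟩) ψ
    (fun x x' η hη => by
      obtain ⟨y, rfl⟩ := proj_surjective η
      obtain ⟨θ, hθ, h1⟩ := hloc hη.1
      obtain ⟨θ', hθ', h2⟩ := hloc hη.2
      filter_upwards [hT.isOpenMap_proj.image_mem_nhds
        ((hT.isOpen_openStar y).mem_nhds (self_mem_openStar y))]
      rintro _ ⟨z, hz, rfl⟩
      rw [h1 z hz, h2 z hz, h1 y (self_mem_openStar y), h2 y (self_mem_openStar y)]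
      exact hθ.sub_eq hP (hT.mem y) hθ' (hz (hf z)) (hf y))
  refine ⟨g, hg, fun γ k F hγ => ?_⟩
  have hval (x : deltaSurface P T) (s : C(I, deltaSurface P T)) (hs : ∀ t, s t ∈ openStar x) :
      g ((proj P T).comp s) = φ x (f (s 1)) - φ x (f (s 0)) := by
    rw [hgψ x _ fun t => ⟨_, hs t, rfl⟩, ← hψ (hs 1), ← hψ (hs 0)]
    rfl
  have hsel {y : deltaSurface P T} {F : Facet P} (h : facetsAt P (y : Euc d) = {F}) : f y = F := by
    have := hf y
    rwa [h] at this
  have := hγ.eq_sum hP hg (fun _ => 0) w (fun G s hs => ?_) fun G G' hne hG s hs h0 h1 => ?_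
  · rw [this, sub_self, zero_add]
  · rw [hval (s 0) s fun t => by rw [openStar, Set.mem_ofPred_eq, hs, hs], hsel (hs 0), hsel (hs 1),
      sub_self, sub_self]
  · obtain ⟨m, hm, hmG⟩ := hP.exists_facetsAt_eq_pair hne hG.1
    let x : deltaSurface P T := ⟨m, hT.mem_deltaSurface_of_eq_pair hm hmG hG⟩
    rw [hval x s fun t => by rw [openStar, Set.mem_ofPred_eq, hmG]; exact hs t, hsel h0, hsel h1,
      ← hφ x G (by simp [x, hmG]) G' (by simp [x, hmG]) hne hG.1]
    ring

/-- If the half-belt cycles generate the homology of the `π`-surface, then the basic cycles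
generate the group of cycles of the red Venkov graph. -/
theorem span_basicCycles_eq (h : Submodule.span ℚ {h : H1 (PiSurface P T) |
    ∃ γ : C(I, PiSurface P T), IsHalfBelt γ ∧ IsClassOf γ h} = ⊤) :
    Submodule.span ℚ (basicCycles P T) = cycleSpace (redVenkovGraph P T) := by
  have hP := hT.isSymmPolytope
  refine le_antisymm (Submodule.span_le.2 ?_) fun c hc => ?_
  · rintro c ⟨γ, -, hγ⟩
    exact hT.mem_cycleSpace_of_isIdentifiedWith hγ
  · by_contra hcon
    obtain ⟨L, hLc, hL⟩ := Submodule.exists_le_ker_of_notMem hcon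
    have hL' (b) (hb : b ∈ basicCycles P T) : L b = 0 := hL (Submodule.subset_span hb)
    obtain ⟨g, hg, hgen⟩ := hT.exists_isPathCocycle_of_potential
      (fun F F' => L (edgeChain F.pair F'.pair)) (fun F F' => by rw [hP.pair_opp, hP.pair_opp])
      (hT.exists_isPotentialAt L hL')
    obtain ⟨l, hl⟩ := hg.exists_functional
    have hl0 : l = 0 := by
      have h1 : (⊤ : Submodule ℚ (H1 (PiSurface P T))) ≤ LinearMap.ker l := by
        rw [← h, Submodule.span_le]
        rintro a ⟨γ, hγ, ha⟩
        have hγ' := hγ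
        obtain ⟨F, hF, -⟩ := hγ'
        obtain ⟨γ', rfl, hγF, -⟩ := hF.eq_comp
        rw [SetLike.mem_coe, LinearMap.mem_ker, hl _ _ ha, hgen _ _ _ hγF, ← map_sum]
        exact hL' _ ⟨_, Or.inl hγ, _, F, hF, rfl⟩
      exact LinearMap.ext fun a => h1 Submodule.mem_top
    refine hLc (eq_zero_of_mem_cycleSpace L (fun v p => ?_) hc)
    obtain ⟨F, hF⟩ : ∃ F : Facet P, F.pair = v := by
      obtain ⟨s, F, rfl⟩ := v
      exact ⟨F, rfl⟩
    obtain ⟨F', q, hF', hq⟩ := hT.exists_walk_lift p hF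
    rw [hq, walkSum_eq_sum]
    rcases Nat.eq_zero_or_pos q.length with h0 | h0
    · have : IsEmpty (Fin q.length) := by rw [h0]; infer_instance
      simp
    let H : Fin (q.length + 1) → Facet P := fun i => q.getVert i
    obtain ⟨γ, hγ⟩ := hT.exists_isGenericLoop h0 H (fun i => q.adj_getVert_succ i.2) (by
      simp only [H, Fin.val_last, SimpleGraph.Walk.getVert_length, Fin.val_zero,
        SimpleGraph.Walk.getVert_zero]
      rw [hF, hF'])
    obtain ⟨a, ha⟩ := exists_isClassOf hγ.1
    have h1 := hl γ a ha
    obtain ⟨γ', rfl, hγF, -⟩ := hγ.eq_comp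
    rw [hl0, LinearMap.zero_apply, hgen _ _ _ hγF, ← map_sum] at h1
    exact h1.symm

end IsTiling
end

/-! ### Half-belt cycles generate homology if basic cycles span -/

section

open Topology Module
variable {d : ℕ} {P T : Set (Euc d)}

namespace IsTiling
variable (hT : IsTiling P T)
include hT

/-- Around a face of codimension three, a cyclic sequence of distinct facets whose consecutive
members meet in primitive faces consists of all facets, so the face belongs to the `δ`-surface. -/
lemma mem_deltaSurface_of_cycle {x : Euc d} (hx : x ∈ P) (hc : codimAt P x = 3) {k : ℕ} (hk : 3 ≤ k)
    (F : Fin (k + 1) → Facet P) (hF : ∀ i : Fin k, (facetGraph P T).Adj (F i.castSucc) (F i.succ))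
    (hlast : F (Fin.last k) = F 0) (hinj : Function.Injective fun i : Fin k => F i.castSucc)
    (hxF : ∀ i, F i ∈ facetsAt P x) : x ∈ deltaSurface P T := by
  have hP := hT.isSymmPolytope
  -- the periodic extension of the sequence
  let H : ℕ → Facet P := fun n => F (Fin.castSucc ⟨n % k, Nat.mod_lt _ (by omega)⟩)
  have hHx (n : ℕ) : H n ∈ facetsAt P x := hxF _
  have hadj (n : ℕ) : (facetGraph P T).Adj (H n) (H (n + 1)) := by
    have h1 := hF ⟨n % k, Nat.mod_lt _ (by omega)⟩
    have h2 : F (Fin.succ ⟨n % k, Nat.mod_lt _ (by omega)⟩) = H (n + 1) := by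
      have hlt : n % k < k := Nat.mod_lt _ (by omega)
      rcases (Nat.succ_le_iff.2 hlt).eq_or_lt with h | h
      · have e1 : (⟨n % k, Nat.mod_lt _ (by omega)⟩ : Fin k).succ = Fin.last k :=
          Fin.ext h
        have e2 : (n + 1) % k = 0 := by
          rw [Nat.add_mod, Nat.mod_eq_of_lt (show 1 < k by omega), show n % k + 1 = k from h,
            Nat.mod_self]
        rw [e1, hlast]
        exact congrArg F (Fin.ext e2.symm)
      · refine congrArg F (Fin.ext ?_)
        change n % k + 1 = (n + 1) % k
        rw [Nat.add_mod, Nat.mod_eq_of_lt (show 1 < k by omega), Nat.mod_eq_of_lt h]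
    rwa [h2] at h1
  have hne (n : ℕ) : H n ≠ H (n + 2) := by
    intro h
    have h1 : n % k = (n + 2) % k := congrArg Fin.val (hinj h)
    have h2 : n + 0 ≡ n + 2 [MOD k] := h1
    have h3 := Nat.ModEq.add_left_cancel' n h2
    rw [Nat.ModEq, Nat.zero_mod, Nat.mod_eq_of_lt (by omega : 2 < k)] at h3
    omega
  have hper (n : ℕ) : H (n + k) = H n :=
    congrArg F (Fin.ext (Nat.add_mod_right n k))
  -- The predecessor and the successor of a facet are two neighbours of it, hence the only ones.
  have key (n : ℕ) {G : Facet P} (hG : G ∈ facetsAt P x) (hGne : H n ≠ G)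
      (hcod : IsFaceOfCodim P 2 ((H n).1 ∩ G.1)) :
      (∃ m, G = H m) ∧ (facetGraph P T).Adj (H n) G := by
    obtain ⟨m, hm⟩ : ∃ m, n + k = m + 1 := ⟨n + k - 1, by omega⟩
    rw [← hper, hm] at hGne hcod ⊢
    have h1 := (hadj m).symm
    have h2 := hadj (m + 1)
    rcases hP.eq_or_eq_of_codimAt_eq_three hx hc (hHx (m + 1)) (hHx m) (hHx (m + 1 + 1))
      hG h1.1 h2.1
      hGne h1.2.1 h2.2.1 hcod (hne m) with rfl | rfl
    · exact ⟨⟨m, rfl⟩, h1⟩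
    · exact ⟨⟨_, rfl⟩, h2⟩
  have hall {G : Facet P} (hG : G ∈ facetsAt P x) : ∃ m, G = H m := by
    have h := hP.facetsAt_connected hx (fun G => ∃ m, G = H m) (fun G hG G' hG' hGG' hcod => by
      refine propext ⟨?_, ?_⟩
      · rintro ⟨m, rfl⟩
        exact (key m hG' hGG' hcod).1
      · rintro ⟨m, rfl⟩
        rw [Set.inter_comm] at hcod
        exact (key m hG hGG'.symm hcod).1) hG (hHx 0)
    rw [h]
    exact ⟨0, rfl⟩
  refine hT.mem_deltaSurface_iff.2 ⟨hx, ⟨_, hHx 0⟩, fun G hG G' hG' hGG' hcod => ?_⟩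
  obtain ⟨m, rfl⟩ := hall hG
  exact (key m hG' hGG' hcod).2.2

/-- A path cocycle on the `π`-surface takes a generic path to the sum of a function `w` over the
edges of the red Venkov graph that the path traverses. -/
theorem exists_edge_function {g : C(I, PiSurface P T) → ℚ} (hg : IsPathCocycle g) :
    ∃ (w : Facet P → Facet P → ℚ) (B : PiSurface P T → ℚ)
      (W : (FacetPair P × FacetPair P →₀ ℚ) →ₗ[ℚ] ℚ) (f : PiSurface P T → FacetPair P),
      (∀ F F' : Facet P, (facetGraph P T).Adj F F' → w F' F = -w F F') ∧
      (∀ x : deltaSurface P T, ∃ φ : Facet P → ℚ, ∀ F ∈ facetsAt P (x : Euc d),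
        ∀ F' ∈ facetsAt P (x : Euc d), (facetGraph P T).Adj F F' → w F F' = φ F' - φ F) ∧
      (∀ F F' : Facet P, (facetGraph P T).Adj F F' → W (edgeChain F.pair F'.pair) = w F F') ∧
      (∀ (γ : C(I, deltaSurface P T)) (k : ℕ) (F : Fin (k + 1) → Facet P), IsGenericPath γ F →
        g ((proj P T).comp γ) = B (proj P T (γ 1)) - B (proj P T (γ 0)) +
          ∑ i : Fin k, w (F i.castSucc) (F i.succ)) ∧
      ∀ γ : C(I, PiSurface P T), ∃ K ∈ graphChains (redVenkovGraph P T),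
        boundary _ K = Finsupp.single (f (γ 1)) 1 - Finsupp.single (f (γ 0)) 1 ∧
        g γ = B (γ 1) - B (γ 0) + W K := by
  classical
  have hP := hT.isSymmPolytope
  obtain ⟨f, hf, hf_neg⟩ := hT.exists_selection
  obtain ⟨c, hc, hc_neg⟩ := hP.exists_center
  let c' : Facet P → deltaSurface P T := fun F =>
    ⟨c F, hT.mem_deltaSurface_of_eq_singleton (hc F).1 (hc F).2⟩
  have hc' (F : Facet P) : facetsAt P (c' F : Euc d) = {F} := (hc F).2
  have hc'_neg (F : Facet P) : c' (hP.opp F) = hT.negMap (c' F) := Subtype.ext (hc_neg F)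
  have hcmem {F : Facet P} {x : deltaSurface P T} (h : F ∈ facetsAt P (x : Euc d)) :
      c' F ∈ openStar x := by
    rw [openStar, Set.mem_ofPred_eq, hc']
    exact Set.singleton_subset_iff.2 h
  -- `b x` is the potential of `g` on the open star of `x`, normalised by `b x x = 0`.
  let b : deltaSurface P T → deltaSurface P T → ℚ := fun x y => g (hT.segmentPath x y)
  have hb {x x' y z : deltaSurface P T} (hx : x ∈ openStar x') (hy : y ∈ openStar x)
      (hz : z ∈ openStar x) : b x' y - b x' z = b x y - b x z :=
    hT.segmentPath_sub_eq hg hx hy hz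
  have hb_neg {x y : deltaSurface P T} (hy : y ∈ openStar x) :
      b (hT.negMap x) (hT.negMap y) = b x y := congrArg g (hT.segmentPath_negMap hy)
  have hm (F F' : Facet P) : ∃ m : deltaSurface P T, (facetGraph P T).Adj F F' →
      facetsAt P (m : Euc d) = {F, F'} := by
    by_cases h : (facetGraph P T).Adj F F'
    · obtain ⟨m, hm, hmF⟩ := hP.exists_facetsAt_eq_pair h.1 h.2.1
      exact ⟨⟨m, hT.mem_deltaSurface_of_eq_pair hm hmF h.2⟩, fun _ => hmF⟩
    · exact ⟨c' F, fun h' => absurd h' h⟩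
  choose m hm using hm
  let w : Facet P → Facet P → ℚ := fun F F' => b (m F F') (c' F') - b (m F F') (c' F)
  -- `w` can be computed in the open star of any point on `F` and `F'`
  have hw {F F' : Facet P} (h : (facetGraph P T).Adj F F') {x : deltaSurface P T}
      (hF : F ∈ facetsAt P (x : Euc d)) (hF' : F' ∈ facetsAt P (x : Euc d)) :
      w F F' = b x (c' F') - b x (c' F) := by
    refine (hb ?_ (hcmem ?_) (hcmem ?_)).symm
    · rw [openStar, Set.mem_ofPred_eq, hm F F' h]
      rintro _ (rfl | rfl) <;> assumption
    · simp [hm F F' h]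
    · simp [hm F F' h]
  have hw_symm {F F' : Facet P} (h : (facetGraph P T).Adj F F') : w F' F = -w F F' := by
    rw [hw h.symm (x := m F F') (by simp [hm F F' h]) (by simp [hm F F' h])]
    simp only [w]
    ring
  have hw_opp {F F' : Facet P} (h : (facetGraph P T).Adj F F') :
      w (hP.opp F) (hP.opp F') = w F F' := by
    have h1 : F ∈ facetsAt P (m F F' : Euc d) := by simp [hm F F' h]
    have h2 : F' ∈ facetsAt P (m F F' : Euc d) := by simp [hm F F' h]
    rw [hw (hT.facetGraph_adj_opp h) (x := hT.negMap (m F F'))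
      (by rwa [hT.mem_facetsAt_negMap, hP.opp_opp]) (by rwa [hT.mem_facetsAt_negMap, hP.opp_opp]),
      hc'_neg, hc'_neg, hb_neg (hcmem h1), hb_neg (hcmem h2)]
  -- the integral of `g` from the centre of the facet selected at `y` to `y`
  let β : deltaSurface P T → ℚ := fun y => b y y - b y (c' (f y))
  have hβ {x y : deltaSurface P T} (hy : y ∈ openStar x) : β y = b x y - b x (c' (f y)) :=
    (hb hy (self_mem_openStar y) (hcmem (hf y))).symm
  have hβ_neg (y : deltaSurface P T) : β (hT.negMap y) = β y := by
    simp only [β]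
    rw [hf_neg, hc'_neg, hb_neg (self_mem_openStar y), hb_neg (hcmem (hf y))]
  choose r hr using proj_surjective (P := P) (T := T)
  let B : PiSurface P T → ℚ := fun η => β (r η)
  have hB (y : deltaSurface P T) : B (proj P T y) = β y := by
    rcases hT.proj_eq_iff'.1 (hr (proj P T y)) with h | h
    · exact congrArg β h
    · exact (congrArg β h).trans (hβ_neg y)
  let f' : PiSurface P T → FacetPair P := fun η => (f (r η)).pair
  have hf' (y : deltaSurface P T) : f' (proj P T y) = (f y).pair := by
    rcases hT.proj_eq_iff'.1 (hr (proj P T y)) with h | h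
    · exact congrArg (fun y => (f y).pair) h
    · refine (congrArg (fun y => (f y).pair) h).trans ?_
      rw [hf_neg, hP.pair_opp]
  let w' : FacetPair P → FacetPair P → ℚ := fun v v' =>
    if h : ∃ p : Facet P × Facet P, p.1.pair = v ∧ p.2.pair = v' ∧ (facetGraph P T).Adj p.1 p.2
    then w h.choose.1 h.choose.2 else 0
  -- two facets and the opposite ones are the only choices, since there are no double edges
  have hw' {F F' : Facet P} (h : (facetGraph P T).Adj F F') : w' F.pair F'.pair = w F F' := by
    have hex : ∃ p : Facet P × Facet P, p.1.pair = F.pair ∧ p.2.pair = F'.pair ∧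
      (facetGraph P T).Adj p.1 p.2 := ⟨(F, F'), rfl, rfl, h⟩
    simp only [w', dif_pos hex]
    obtain ⟨h1, h2, h3⟩ := hex.choose_spec
    rcases hP.pair_eq_pair_iff.1 h1 with e1 | e1 <;>
    rcases hP.pair_eq_pair_iff.1 h2 with e2 | e2 <;>
      rw [e1, e2] at h3 ⊢
    · exact absurd h3 (hT.not_facetGraph_adj_opp h)
    · refine absurd (hT.facetGraph_adj_opp h3) ?_
      rw [hP.opp_opp]
      exact hT.not_facetGraph_adj_opp h
    · exact hw_opp h
  let W : (FacetPair P × FacetPair P →₀ ℚ) →ₗ[ℚ] ℚ :=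
    Finsupp.linearCombination ℚ fun e => w' e.1 e.2 / 2
  have hW {F F' : Facet P} (h : (facetGraph P T).Adj F F') :
      W (edgeChain F.pair F'.pair) = w F F' := by
    simp only [W, edgeChain, map_sub, Finsupp.linearCombination_single, hw' h, hw' h.symm,
      hw_symm h, one_smul]
    ring
  have hpath {x : deltaSurface P T} (s : C(I, deltaSurface P T)) (hs : ∀ t, s t ∈ openStar x) :
      g ((proj P T).comp s) = β (s 1) - β (s 0) + (b x (c' (f (s 1))) - b x (c' (f (s 0)))) := by
    rw [hT.eq_sub_of_mem_openStar hg s hs, hβ (hs 1), hβ (hs 0)]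
    simp only [b]
    ring
  have hsel {y : deltaSurface P T} {F : Facet P} (h : facetsAt P (y : Euc d) = {F}) : f y = F := by
    have := hf y
    rwa [h] at this
  refine ⟨w, B, W, f', fun F F' h => hw_symm h,
    fun x => ⟨fun F => b x (c' F), fun F hF F' hF' h => hw h hF hF'⟩, fun F F' h => hW h,
    fun γ k F hγ => ?_,
    fun γ => ?_⟩
  · rw [hB, hB]
    refine hγ.eq_sum hP hg β w (fun G s hs => ?_) fun G G' hne hG s hs h0 h1 => ?_
    · rw [hpath (x := s 0) s fun t => by rw [openStar, Set.mem_ofPred_eq, hs, hs], hsel (hs 0),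
        hsel (hs 1)]
      ring
    · have hadj : (facetGraph P T).Adj G G' := ⟨hne, hG⟩
      rw [hpath (x := m G G') s fun t => by
        rw [openStar, Set.mem_ofPred_eq, hm G G' hadj]; exact hs t, hsel h0, hsel h1]
  · -- potentials on an open star change by `W` along chains of facets
    have hchain (x : deltaSurface P T) {F F' : Facet P} (hF : F ∈ facetsAt P (x : Euc d))
        (hF' : F' ∈ facetsAt P (x : Euc d)) : ∃ K ∈ graphChains (redVenkovGraph P T),
          boundary _ K = Finsupp.single F'.pair 1 - Finsupp.single F.pair 1 ∧
          W K = b x (c' F') - b x (c' F) := by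
      let R : Facet P → Set (Facet P) := fun F => {F' | ∃ K ∈ graphChains (redVenkovGraph P T),
          boundary _ K = Finsupp.single F'.pair 1 - Finsupp.single F.pair 1 ∧
          W K = b x (c' F') - b x (c' F)}
      have htrans {F G H : Facet P} (h1 : G ∈ R F) (h2 : H ∈ R G) : H ∈ R F := by
        obtain ⟨K, hK, e1, e2⟩ := h1
        obtain ⟨K', hK', e1', e2'⟩ := h2
        exact ⟨K + K', add_mem hK hK', by rw [map_add, e1, e1']; abel,
          by rw [map_add, e2, e2']; ring⟩
      have hrefl (F : Facet P) : F ∈ R F := ⟨0, Submodule.zero_mem _, by simp, by simp⟩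
      have hstep {G G' : Facet P} (hG : G ∈ facetsAt P (x : Euc d))
          (hG' : G' ∈ facetsAt P (x : Euc d)) (hne : G ≠ G')
          (hcod : IsFaceOfCodim P 2 (G.1 ∩ G'.1)) : G' ∈ R G := by
        have hadj : (facetGraph P T).Adj G G' :=
          ⟨hne, (hT.mem_deltaSurface_iff.1 x.2).2.2 G hG G' hG' hne hcod⟩
        exact ⟨edgeChain G.pair G'.pair, edgeChain_mem (hT.pair_adj hadj),
          boundary_edgeChain _ _, by rw [hW hadj, hw hadj hG hG']⟩
      have h := hP.facetsAt_connected (hT.mem x) R (fun G hG G' hG' hne hcod => by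
        refine Set.Subset.antisymm (fun H hH => htrans (hstep hG' hG hne.symm ?_) hH)
          fun H hH => htrans (hstep hG hG' hne hcod) hH
        rwa [Set.inter_comm]) hF hF'
      change F' ∈ R F
      rw [h]
      exact hrefl F'
    have key := unitInterval_induction (Q := fun s t => ∃ K ∈ graphChains (redVenkovGraph P T),
        boundary _ K = Finsupp.single (f' (γ t)) 1 - Finsupp.single (f' (γ s)) 1 ∧
        g (subpath γ s t) = B (γ t) - B (γ s) + W K) ?_ ?_
    · simpa using key
    · rintro s t u ⟨K, hK, e1, e2⟩ ⟨K', hK', e1', e2'⟩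
      refine ⟨K + K', add_mem hK hK', by rw [map_add, e1, e1']; abel, ?_⟩
      rw [hg.subpath_trans γ s t u, e2, e2', map_add]
      ring
    · intro t
      obtain ⟨x, hx⟩ := proj_surjective (γ t)
      refine ⟨γ ⁻¹' (proj P T '' openStar x),
        (hT.isOpenMap_proj _ (hT.isOpen_openStar x)).preimage γ.continuous,
        ⟨x, self_mem_openStar x, hx⟩, fun s u hsu hsub => ?_⟩
      obtain ⟨γ', hγ', e⟩ := hT.exists_lift (x := x) (γ := subpath γ s u)
        fun v => hsub (affinePath_mem_Icc hsu v)
      have e0 : γ s = proj P T (γ' 0) := by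
        rw [← subpath_zero γ s u, ← e]; rfl
      have e1 : γ u = proj P T (γ' 1) := by
        rw [← subpath_one γ s u, ← e]; rfl
      obtain ⟨K, hK, h1, h2⟩ := hchain x (hγ' 0 (hf (γ' 0))) (hγ' 1 (hf (γ' 1)))
      refine ⟨K, hK, ?_, ?_⟩
      · rw [e0, e1, hf', hf', h1]
      · rw [e0, e1, hB, hB, ← e, hpath γ' hγ', h2]

/-- If the basic cycles generate the group of cycles of the red Venkov graph, then the half-belt
cycles generate the homology of the `π`-surface. -/
theorem span_halfBelt_eq
    (h : Submodule.span ℚ (basicCycles P T) = cycleSpace (redVenkovGraph P T)) :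
    Submodule.span ℚ {h : H1 (PiSurface P T) |
      ∃ γ : C(I, PiSurface P T), IsHalfBelt γ ∧ IsClassOf γ h} = ⊤ := by
  have hP := hT.isSymmPolytope
  by_contra hcon
  obtain ⟨l, hl0, hl⟩ := Submodule.exists_le_ker_of_lt_top _ (lt_top_iff_ne_top.2 hcon)
  obtain ⟨ω, hg, hω⟩ := exists_isPathCocycle l
  obtain ⟨w, B, W, f, hw, hpot, hW, hgen, hK⟩ := hT.exists_edge_function hg
  choose K hKmem hKb hKg using hK
  have hloop (γ : C(I, PiSurface P T)) {k : ℕ} {F : Fin (k + 1) → Facet P}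
      (hF : IsGenericLoop γ F) : ω (pathChain γ) = ∑ i : Fin k, w (F i.castSucc) (F i.succ) := by
    obtain ⟨γ', rfl, hγ', h01⟩ := hF.eq_comp
    rw [hgen γ' k F hγ', h01, sub_self, zero_add]
  have hWbasic : Submodule.span ℚ (basicCycles P T) ≤ LinearMap.ker W := by
    rw [Submodule.span_le]
    rintro _ ⟨γ, hγ, k, F, hF, rfl⟩
    have hWc : W (∑ i : Fin k, edgeChain (F i.castSucc).pair (F i.succ).pair) =
        ω (pathChain γ) := by
      obtain ⟨γ', -, hγ', -⟩ := hF.eq_comp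
      rw [hloop γ hF, map_sum]
      exact Finset.sum_congr rfl fun i _ => hW _ _ (hγ'.adj i)
    rw [SetLike.mem_coe, LinearMap.mem_ker, hWc]
    rcases hγ with hγ | ⟨k, F, hk, hF, hlast, hinj, G, hG, hGF⟩
    · obtain ⟨a, ha⟩ := exists_isClassOf (hF.1)
      have h1 := hl (Submodule.subset_span ⟨γ, hγ, ha⟩)
      obtain ⟨z, hz, rfl⟩ := ha
      rw [← hz, hω]
      exact h1
    · have hF' := hF
      obtain ⟨γ', e, hγ', h01⟩ := hF'.eq_comp
      have hadj := hγ'.adj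
      rcases (show k = 1 ∨ k = 2 ∨ 3 ≤ k by omega) with rfl | rfl | hk3
      · exact absurd hlast.symm (hadj 0).1
      · rw [hloop γ hF, Fin.sum_univ_two]
        have h1 : F (Fin.succ 1) = F (Fin.castSucc 0) := hlast
        have h2 : (Fin.castSucc 1 : Fin 3) = Fin.succ 0 := rfl
        rw [h1, h2, hw _ _ (hadj 0)]
        ring
      · obtain ⟨x, hx, rfl, hc⟩ := hP.exists_eq_faceOf hG
        have hxF (i) : F i ∈ facetsAt P x := hGF i (self_mem_faceOf hx)
        obtain ⟨φ, hφ⟩ := hpot ⟨x, hT.mem_deltaSurface_of_cycle hx hc hk3 F hadj hlast hinj hxF⟩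
        rw [hloop γ hF, Finset.sum_congr rfl
          fun i _ => hφ _ (hxF i.castSucc) _ (hxF i.succ) (hadj i),
          Finset.sum_sub_distrib]
        have h1 := Fin.sum_univ_succ fun i => φ (F i)
        rw [Fin.sum_univ_castSucc, hlast] at h1
        linarith
  have hlz : l = 0 := by
    obtain ⟨Kl, hKl⟩ := exists_path_desc (X := PiSurface P T)
      (fun γ => (⟨K γ, hKmem γ⟩ : graphChains (redVenkovGraph P T)))
    obtain ⟨Bl, hBl⟩ := exists_point_desc B
    obtain ⟨fl, hfl⟩ := exists_point_desc fun η => Finsupp.single (f η) (1 : ℚ)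
    -- On all paths `ω` is a coboundary plus `W` of a graph chain, hence also on all chains.
    have h1 : ω = Bl ∘ₗ ((singularChains (PiSurface P T)).d 1 0).hom +
        W ∘ₗ (graphChains (redVenkovGraph P T)).subtype ∘ₗ Kl := by
      refine path_hom_ext fun γ => ?_
      simp only [LinearMap.add_apply, LinearMap.comp_apply, d_pathChain, map_sub, hBl, hKl,
        Submodule.subtype_apply]
      exact hKg γ
    have h2 : boundary _ ∘ₗ (graphChains (redVenkovGraph P T)).subtype ∘ₗ Kl =
        fl ∘ₗ ((singularChains (PiSurface P T)).d 1 0).hom := by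
      refine path_hom_ext fun γ => ?_
      simp only [LinearMap.comp_apply, d_pathChain, map_sub, hfl, hKl, Submodule.subtype_apply]
      exact hKb γ
    refine LinearMap.ext fun a => ?_
    obtain ⟨z, rfl⟩ := homologyπ_surjective a
    have h3 := LinearMap.congr_fun h2 (((singularChains (PiSurface P T)).iCycles 1).hom z)
    simp only [LinearMap.comp_apply, d_iCycles, map_zero] at h3
    rw [← hω, h1, LinearMap.add_apply, LinearMap.comp_apply, d_iCycles, map_zero, zero_add,
      LinearMap.zero_apply]
    refine hWbasic ?_
    rw [h]
    exact mem_cycleSpace_iff.2 ⟨(Kl _).2, h3⟩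
  exact hl0 hlz

end IsTiling
end

end Parallelohedron

end

theorem lemma4p6 (d : ℕ) (P T : Set (Parallelohedron.Euc d))
    (hP : Parallelohedron.IsTiling P T) :
    Submodule.span ℚ {h : Parallelohedron.H1 (Parallelohedron.PiSurface P T) |
        ∃ γ : C(unitInterval, Parallelohedron.PiSurface P T),
          Parallelohedron.IsHalfBelt γ ∧ Parallelohedron.IsClassOf γ h} = ⊤ ↔
      Submodule.span ℚ (Parallelohedron.basicCycles P T) =
        Parallelohedron.cycleSpace (Parallelohedron.redVenkovGraph P T) :=
  ⟨hP.span_basicCycles_eq, hP.span_halfBelt_eq⟩
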